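/- Setting. A single-sink network consists of a finite directed graph $G=(V,E)$, capacities $\nu_e\in\mathbb Q_{>0}$ and travel times $\tau_e\in\mathbb Q_{>0}$ ($e\in E$), a sink $t\in V$ reachable from every node, and for every $v\in V\setminus\{t\}$ an inflow rate $u_v:\mathbb R_{\ge 0}\to\mathbb Q_{\ge 0}$ that is a right-constant step function with bounded support and finitely many jumps, all at rational times. Let $\delta^+_v,\delta^-_v$ be the sets of edges leaving and entering $v$, and $\tau_{\min}=\min_e\tau_e$. A flow over time is a pair of families of integrable functions $f^+_e,f^-_e:\mathbb R_{\ge0}\to\mathbb R_{\ge0}$ ($e \in E$) (edge in- and outflow rates), with cumulative flows $F^\pm_e(\theta)=\int_0^\theta f^\pm_e$ and queues $q_e(\theta)=F^+_e(\theta)-F^-_e(\theta+\tau_e)$. It is feasible if for all $\theta\ge0$: $\sum_{e\in\delta^+_v}f^+_e(\theta)-\sum_{e\in\delta^-_v}f^-_e(\theta)=u_v(\theta)$ for $v\ne t$, the same difference is $\le 0$ for $v=t$, $f^-_e(\theta)=0$ if $\theta<\tau_e$, and $$f^-_e(\theta+\tau_e)=\nu_e\ \text{ if } q_e(\theta)>0,\qquad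 f^-_e(\theta+\tau_e)=\min\{f^+_e(\theta),\nu_e\}\ \text{ otherwise.}\tag{Q}$$ Put $c_e(\theta)=\tau_e+q_e(\theta)/\nu_e$, $\ell_t(\theta)=0$ and $\ell_v(\theta)=\min_{e=vw\in E}\{\ell_w(\theta)+c_e(\theta)\}$ for $v\neq t$. The edge $e=vw$ is active at $\theta$ if $\ell_v(\theta)=\ell_w(\theta)+c_e(\theta)$. An instantaneous dynamic equilibrium (IDE) is a feasible flow such that $f^+_e(\theta)>0$ implies that $e$ is active at $\theta$, for all $e \in E$ and $\theta \ge 0$. A flow terminates by time $T$ if $F^+_e(\theta)=F^-_e(\theta)$ for all $e \in E$ and $\theta\ge T$, i.e. no flow is left in the network from time $T$ on. Algorithm. Let $G$ be acyclic. Fix a rational $T\ge 0$ such that every IDE terminates by time $T$, and a topological order $t=v_1<\dots<v_n$ of $V$ (every edge leads from a larger to a smaller node). Start with the zero flow. For $k=0,1,\dots,\lfloor T/\tau_{\min}\rfloor$ and, inside this loop, for $i=2,\dots,n$, extend the flow at the node $v=v_i$ over $[k\tau_{\min},(k+1)\tau_{\min})$ by successive local phases. A local phase extends the flow at $v$ from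 the current time $a$ to a time $b$ with $a<b\le(k+1)\tau_{\min}$ as follows: choose constants $x_e\ge0$ ($e\in\delta^+_v$), set $f^+_e=x_e$ on $[a,b)$, and let $f^-_e$ on $[a+\tau_e,b+\tau_e)$ be given by (Q), such that for all $\theta\in[a,b)$ the gross node inflow is distributed, $\sum_{e\in\delta^+_v}x_e=\sum_{e\in\delta^-_v}f^-_e(\theta)+u_v(\theta)$, and every $e\in\delta^+_v$ with $x_e>0$ is active at $\theta$; moreover $b$ is maximal, i.e. with the same constants $x_e$ this is not possible up to any $b'$ with $b<b'\le(k+1)\tau_{\min}$. When the interval is covered at $v_i$, the algorithm proceeds to the next node or, after $v_n$, to the next $k$. It ends when both loops are completed; its output is the flow constructed, continued by zero. Theorem. For every acyclic single-sink network with inflow rates as above, the algorithm constructs an IDE in finite time. That is, there are a number $T$ and a topological order as required; and for every such $T$ and every such order: 1. every run of the algorithm is finite, i.e. consists of finitely many local phases in total, however the constants $x_e$ are chosen in the local phases; 2. no run gets stuck: as long as the algorithm has not ended, a next step exists, and if the current time is rational and all edge in- and outflow rates constructed so far are right-constant step functions with finitely many jumps, rational values and rational jump points, then the next step can be chosen so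 that this remains true (so the algorithm can be carried out in exact rational arithmetic); 3. the output of every completed run is an IDE. -/

import Mathlib

open MeasureTheory

noncomputable section

/-- `g` is, on `[0, ∞)`, a right-constant step function with finitely many jumps, all of them at
rational points, and with rational values: `g` takes the same value at `a` and `b` whenever no
jump point lies in `(a, b]`. -/
def IsRationalStepFunction (g : ℝ → ℝ) : Prop :=
  (∃ J : Finset ℚ, ∀ a b : ℝ, 0 ≤ a → a ≤ b →
    (∀ j ∈ J, ¬ (a < (j : ℝ) ∧ (j : ℝ) ≤ b)) → g a = g b) ∧
  ∀ θ : ℝ, 0 ≤ θ → ∃ q : ℚ, g θ = (q : ℝ)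

/-- A single-sink network on the nodes `V` and the edges `E` (the edge `e` leads from `src e` to
`dst e`), with capacities `ν`, travel times `τ`, sink `t` and network inflow rates `u`.
Only the values `u v θ` with `v ≠ t` and `0 ≤ θ` are ever used. -/
structure Network (V E : Type*) where
  src : E → V
  dst : E → V
  ν : E → ℚ
  τ : E → ℚ
  t : V
  u : V → ℝ → ℝ
  ν_pos : ∀ e, 0 < ν e
  τ_pos : ∀ e, 0 < τ e
  sink_reachable : ∀ v, Relation.ReflTransGen (fun a b => ∃ e, src e = a ∧ dst e = b) v t
  u_nonneg : ∀ v, v ≠ t → ∀ θ : ℝ, 0 ≤ θ → 0 ≤ u v θ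
  u_step : ∀ v, v ≠ t → IsRationalStepFunction (u v)
  u_bounded_support : ∀ v, v ≠ t → ∃ M : ℝ, ∀ θ : ℝ, M ≤ θ → u v θ = 0

/-- A single-sink network whose directed graph has no directed cycle. -/
structure AcyclicNetwork (V E : Type*) extends Network V E where
  acyclic : ∀ v, ¬ Relation.TransGen (fun a b => ∃ e, src e = a ∧ dst e = b) v v

/-- The edge inflow rates `f⁺` and the edge outflow rates `f⁻` of a flow over time; only their
values at times `θ ≥ 0` matter. Partial flows are continued by zero. -/
structure FlowOverTime (E : Type*) where
  inflow : E → ℝ → ℝ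
  outflow : E → ℝ → ℝ

/-- From time `T` on there is no flow on any edge: everything that has entered an edge has left
it. For a feasible flow this says that all flow particles have reached the sink by time `T`, since
every edge takes a positive time and a particle entering a node other than the sink enters an
edge at once. -/
def FlowOverTime.TerminatesBy {E : Type*} (f : FlowOverTime E) (T : ℝ) : Prop :=
  ∀ θ : ℝ, T ≤ θ → ∀ e,
    ∫ ζ in (0 : ℝ)..θ, f.inflow e ζ = ∫ ζ in (0 : ℝ)..θ, f.outflow e ζ

namespace Network

variable {V E : Type*} (N : Network V E)

/-- `q_e(θ) = F⁺_e(θ) - F⁻_e(θ + τ_e)`. -/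
def queue (f : FlowOverTime E) (e : E) (θ : ℝ) : ℝ :=
  (∫ ζ in (0 : ℝ)..θ, f.inflow e ζ) - ∫ ζ in (0 : ℝ)..(θ + N.τ e), f.outflow e ζ

/-- The instantaneous travel time `c_e(θ) = τ_e + q_e(θ) / ν_e`. -/
def travelTime (f : FlowOverTime E) (e : E) (θ : ℝ) : ℝ :=
  N.τ e + N.queue f e θ / N.ν e

/-- The queue of `e` operates at capacity at time `θ`. -/
def QueueOperatesAtCapacity (f : FlowOverTime E) (e : E) (θ : ℝ) : Prop :=
  f.outflow e (θ + N.τ e) =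
    if 0 < N.queue f e θ then (N.ν e : ℝ) else min (f.inflow e θ) (N.ν e)

/-- The gross node inflow rate `b_v⁻(θ)`. -/
def grossInflow [Fintype E] [DecidableEq V] (f : FlowOverTime E) (v : V) (θ : ℝ) : ℝ :=
  (∑ e with N.dst e = v, f.outflow e θ) + N.u v θ

/-- `f` is a feasible flow over time for the network inflow rates `u`. -/
structure IsFeasible [Fintype E] [DecidableEq V] (f : FlowOverTime E) : Prop where
  inflow_nonneg : ∀ e, ∀ θ : ℝ, 0 ≤ θ → 0 ≤ f.inflow e θ
  outflow_nonneg : ∀ e, ∀ θ : ℝ, 0 ≤ θ → 0 ≤ f.outflow e θ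
  inflow_integrable : ∀ e, IntegrableOn (f.inflow e) (Set.Ici 0)
  outflow_integrable : ∀ e, IntegrableOn (f.outflow e) (Set.Ici 0)
  conservation : ∀ v, v ≠ N.t → ∀ θ : ℝ, 0 ≤ θ →
    (∑ e with N.src e = v, f.inflow e θ) - (∑ e with N.dst e = v, f.outflow e θ) = N.u v θ
  conservation_sink : ∀ θ : ℝ, 0 ≤ θ →
    (∑ e with N.src e = N.t, f.inflow e θ) - (∑ e with N.dst e = N.t, f.outflow e θ) ≤ 0
  no_early_outflow : ∀ e, ∀ θ : ℝ, 0 ≤ θ → θ < N.τ e → f.outflow e θ = 0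
  queue_op : ∀ e, ∀ θ : ℝ, 0 ≤ θ → N.QueueOperatesAtCapacity f e θ

/-- `τ_min`; its value `0` for a network without edges is harmless, since the sink is then the
only node. -/
def τmin : ℝ := ⨅ e, (N.τ e : ℝ)

/-- The numbering `t = v₁ < ⋯ < v_n` of the nodes given by `rank` (here starting with the rank
`0`) is a topological order: every edge leads to a node of smaller rank. -/
def IsTopologicalOrder [Fintype V] (rank : V ≃ Fin (Fintype.card V)) : Prop :=
  (rank N.t : ℕ) = 0 ∧ ∀ e, rank (N.dst e) < rank (N.src e)

theorem exists_outgoing {v : V} (hv : v ≠ N.t) : ∃ e, N.src e = v := by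
  rcases (N.sink_reachable v).cases_head with h | ⟨c, ⟨e, he, _⟩, _⟩
  · exact absurd h hv
  · exact ⟨e, he⟩

end Network

namespace AcyclicNetwork

variable {V E : Type*} (N : AcyclicNetwork V E)

theorem wellFounded [Finite V] :
    WellFounded (fun w v : V => ∃ e, N.src e = v ∧ N.dst e = w) := by
  have h : Std.Irrefl (Relation.TransGen (fun w v : V => ∃ e, N.src e = v ∧ N.dst e = w)) := by
    refine ⟨fun v hv => N.acyclic v ?_⟩
    exact Relation.transGen_swap.mp hv
  have hw : WellFounded (Relation.TransGen (fun w v : V => ∃ e, N.src e = v ∧ N.dst e = w)) :=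
    Finite.wellFounded_of_trans_of_irrefl _
  exact Subrelation.wf (fun hab => Relation.TransGen.single hab) hw

variable [Fintype V] [DecidableEq V]

/-- The node labels `ℓ_v` for the edge costs `c`: `ℓ_t = 0` and
`ℓ_v = min_{e = vw} (ℓ_w + c_e)` for `v ≠ t`, a recursion along the edges of the acyclic graph. -/
def labelOf (c : E → ℝ) : V → ℝ :=
  N.wellFounded.fix fun v rec =>
    if v = N.t then 0
    else ⨅ e : {e : E // N.src e = v}, (rec (N.dst e.1) ⟨e.1, e.2, rfl⟩ + c e.1)

theorem labelOf_sink (c : E → ℝ) : N.labelOf c N.t = 0 := by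
  rw [labelOf, WellFounded.fix_eq, if_pos rfl]

theorem labelOf_isLeast [Finite E] (c : E → ℝ) {v : V} (hv : v ≠ N.t) :
    IsLeast {x : ℝ | ∃ e, N.src e = v ∧ x = N.labelOf c (N.dst e) + c e} (N.labelOf c v) := by
  have key : N.labelOf c v =
      ⨅ e : {e : E // N.src e = v}, (N.labelOf c (N.dst e.1) + c e.1) := by
    conv_lhs => rw [labelOf, WellFounded.fix_eq, if_neg hv]
    rfl
  obtain ⟨e₀, he₀⟩ := N.exists_outgoing hv
  have : Nonempty {e : E // N.src e = v} := ⟨⟨e₀, he₀⟩⟩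
  constructor
  · obtain ⟨e, he⟩ := exists_eq_ciInf_of_finite
      (f := fun e : {e : E // N.src e = v} => N.labelOf c (N.dst e.1) + c e.1)
    exact ⟨e.1, e.2, key.trans he.symm⟩
  · rintro x ⟨e, he, rfl⟩
    rw [key]
    exact ciInf_le (Set.finite_range
      (fun e : {e : E // N.src e = v} => N.labelOf c (N.dst e.1) + c e.1)).bddBelow ⟨e, he⟩

/-- The label `ℓ_v(θ)`, the current shortest path distance from `v` to the sink. -/
def label (f : FlowOverTime E) (v : V) (θ : ℝ) : ℝ :=
  N.labelOf (fun e => N.travelTime f e θ) v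

/-- The edge `e = vw` is active at time `θ`: `ℓ_v(θ) = ℓ_w(θ) + c_e(θ)`. -/
def IsActive (f : FlowOverTime E) (e : E) (θ : ℝ) : Prop :=
  N.label f (N.src e) θ = N.label f (N.dst e) θ + N.travelTime f e θ

variable [Fintype E]

/-- `f` is an instantaneous dynamic equilibrium: a feasible flow that only ever enters active
edges. -/
def IsIDE (f : FlowOverTime E) : Prop :=
  N.IsFeasible f ∧ ∀ θ : ℝ, 0 ≤ θ → ∀ e, 0 < f.inflow e θ → N.IsActive f e θ

/-- All IDE flows terminate before `T`. -/
def IsTerminationBound (T : ℚ) : Prop :=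
  0 ≤ T ∧ ∀ f : FlowOverTime E, N.IsIDE f → f.TerminatesBy T

/-- `f'` extends the partial flow `f` at the single node `v` from time `a` up to time `b` by the
constant distribution `x` of the gross node inflow of `v` to the edges leaving `v`, in such a way
that the equilibrium condition holds at `v` during `[a, b)`. The edge inflow rates change on
`[a, b)` only, the edge outflow rates on `[a + τ_e, b + τ_e)` only, where they are determined by
the queues operating at capacity. -/
structure IsConstantExtension (f f' : FlowOverTime E) (v : V) (a b : ℝ) (x : E → ℝ) : Prop where
  lt : a < b
  nonneg : ∀ e, N.src e = v → 0 ≤ x e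
  other_edges : ∀ e, N.src e ≠ v → f'.inflow e = f.inflow e ∧ f'.outflow e = f.outflow e
  inflow_eq : ∀ e, N.src e = v → ∀ θ : ℝ,
    f'.inflow e θ = if a ≤ θ ∧ θ < b then x e else f.inflow e θ
  outflow_eq : ∀ e, N.src e = v → ∀ θ : ℝ, ¬ (a + N.τ e ≤ θ ∧ θ < b + N.τ e) →
    f'.outflow e θ = f.outflow e θ
  outflow_integrable : ∀ e, N.src e = v → IntegrableOn (f'.outflow e) (Set.Ici 0)
  queue_op : ∀ e, N.src e = v → ∀ θ : ℝ, a ≤ θ → θ < b → N.QueueOperatesAtCapacity f' e θ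
  conservation : ∀ θ : ℝ, a ≤ θ → θ < b → ∑ e with N.src e = v, x e = N.grossInflow f v θ
  only_active : ∀ e, N.src e = v → 0 < x e → ∀ θ : ℝ, a ≤ θ → θ < b → N.IsActive f' e θ

/-- `f'` arises from `f` by one local phase at `v`, lasting from `a` to `b`: a constant extension
that is maximal, i.e. the same distribution `x` cannot be kept up beyond `b`, within the interval
ending at `c` that is to be covered. -/
def IsLocalPhase (f f' : FlowOverTime E) (v : V) (a b c : ℝ) (x : E → ℝ) : Prop :=
  b ≤ c ∧ N.IsConstantExtension f f' v a b x ∧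
    ∀ (b' : ℝ) (f'' : FlowOverTime E), b < b' → b' ≤ c → ¬ N.IsConstantExtension f f'' v a b' x

end AcyclicNetwork

/-- A state of the node-by-node extension algorithm: the partial flow constructed so far, the
counter `round` of the outer loop (over intervals of length `τ_min`), the counter `pos` of the
inner loop (the rank of the node under consideration), and the time `time` up to which the flow
has been extended at that node. -/
structure AlgState (E : Type*) where
  flow : FlowOverTime E
  round : ℕ
  pos : ℕ
  time : ℝ

/-- The current time is rational and all edge in- and outflow rates are step functions with
rational jump points and rational values: the state is an exact finite rational datum. -/
def AlgState.IsRational {E : Type*} (s : AlgState E) : Prop :=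
  (∃ q : ℚ, s.time = (q : ℝ)) ∧
    ∀ e, IsRationalStepFunction (s.flow.inflow e) ∧ IsRationalStepFunction (s.flow.outflow e)

/-- The algorithm starts with the zero flow, in round `0`, at the node following the sink. -/
def AlgState.initial (E : Type*) : AlgState E :=
  ⟨⟨fun _ _ => 0, fun _ _ => 0⟩, 0, 1, 0⟩

namespace AcyclicNetwork

variable {V E : Type*} [Fintype V] [DecidableEq V] [Fintype E] (N : AcyclicNetwork V E)

/-- The index of the last round of the outer loop, `⌊T / τ_min⌋`. -/
def lastRound (T : ℚ) : ℕ := ⌊(T : ℝ) / N.τmin⌋₊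

/-- One step of the algorithm for the time horizon `T` and the order `rank` of the nodes. -/
inductive Step (T : ℚ) (rank : V ≃ Fin (Fintype.card V)) : AlgState E → AlgState E → Prop
  /-- Extend the flow at the current node `v` by one local phase inside
  `[round * τ_min, (round + 1) * τ_min)`. -/
  | phase (s : AlgState E) (v : V) (x : E → ℝ) (b : ℝ) (f' : FlowOverTime E)
      (hround : s.round ≤ N.lastRound T) (hv : (rank v : ℕ) = s.pos)
      (hphase : N.IsLocalPhase s.flow f' v s.time b ((s.round + 1) * N.τmin) x) :
      Step T rank s ⟨f', s.round, s.pos, b⟩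
  /-- The interval is covered at the current node: go to the next node. -/
  | nextNode (s : AlgState E) (hround : s.round ≤ N.lastRound T)
      (hpos : s.pos < Fintype.card V) (htime : s.time = (s.round + 1) * N.τmin) :
      Step T rank s ⟨s.flow, s.round, s.pos + 1, s.round * N.τmin⟩
  /-- All nodes are done: go to the next round. -/
  | nextRound (s : AlgState E) (hround : s.round ≤ N.lastRound T)
      (hpos : s.pos = Fintype.card V) :
      Step T rank s ⟨s.flow, s.round + 1, 1, (s.round + 1) * N.τmin⟩

/-- All rounds `0, …, ⌊T / τ_min⌋` have been carried out; the output is the flow of the state. -/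
def IsFinal (T : ℚ) (s : AlgState E) : Prop := s.round = N.lastRound T + 1

end AcyclicNetwork

end

/-!
The three parts of the theorem rest on the following facts.

*Exact arithmetic.* The constants of a local phase determine the phase: the queue of an edge with
constant inflow rate below capacity drains linearly and stays empty afterwards, so the new outflow
rate is an explicit step function (`AcyclicNetwork.extend`,
`AcyclicNetwork.IsConstantExtension.eq_extend`). All of this is done over an arbitrary subfield `K`
of the reals, where `K = ℝ` gives the statement about arbitrary runs and `K = ℚ` the one about
rational states. If the rates are step functions over `K`, then queues, travel times and labels are
continuous and piecewise affine over `K`. Two different lines over `K` meet in `K`, so a phase of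
maximal length cannot end at a time outside of `K`: there neither does the gross inflow rate jump
nor does an active edge become inactive (`IsPartialIDE.exists_isLocalPhase`). The constants
themselves come from distributing the gross inflow at the starting time such that the used edges
have the least slope of the total travel time, which amounts to solving one linear equation over `K`
(`exists_equilibrium_distribution`).

*Finiteness.* Infinitely many phases at one node would have starting times increasing to a limit
`z`. Close enough before `z` the gross inflow rate of the node is constant and the labels of its
neighbours are affine. In this situation (`NodeDistribution`) the slope of the node label jumps
up only at times when the queue of an active edge `i` has just run empty, and then at most to the
slope `β i` of the cost of that edge without queue (`labelRate_jump`). Such jumps do not accumulate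
at `z`: among the edges concerned infinitely often take one with maximal `β i`; after one of its
jumps the slope of the label never exceeds `β i`, which contradicts its next jump
(`eventually_no_jump`). Then the label is concave, each edge is eventually always or never active,
each active queue is eventually always or never empty, and so the slope of the label and the inflow
rates of all edges with a queue are eventually constant (`eventually_stationary`). From then on a
phase could have been continued through the next one, against its maximality
(`InfinitePhases.false`).

*Output.* The invariant of the algorithm is that the flow is an equilibrium up to the time to which
it has been extended at each node (`IsValidState`). It persists because a node is extended after its
successors and by at most `τmin`, so that flow sent along an edge arrives only at times that have
not been covered at its head. Along a topological order one sees that in every feasible flow all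
edges are empty from a common time on, even if feasibility holds on a bounded interval only
(`IsFeasibleUntil.exists_empty_from`); this gives a termination bound. For a given `T`, a completed
run is continued with a larger bound, until the flow is an equilibrium on the whole half-line.
This equilibrium terminates by `T`, so its rates vanish after `T` and it is the output of the
original run (`isIDE_of_final`).
-/

noncomputable section

open Filter Topology

/-! ### Real induction, step functions and piecewise affine functions over a subfield -/

/-- Real induction on `[a, b)`: a property that holds at `a`, spreads to the right of every point
where it holds, and passes to limits from the left, holds everywhere. -/
theorem Ico_induction {P : ℝ → Prop} {a b : ℝ} (h0 : P a)
    (hr : ∀ x, a ≤ x → x < b → P x → ∀ᶠ y in 𝓝[>] x, P y)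
    (hl : ∀ x, a < x → x < b → (∀ y, a ≤ y → y < x → P y) → P x) :
    ∀ x, a ≤ x → x < b → P x := by
  by_contra! hcon
  obtain ⟨x₀, hax₀, hx₀b, hx₀⟩ := hcon
  set S : Set ℝ := {x | a ≤ x ∧ x < b ∧ ¬ P x} with hS
  have hne : S.Nonempty := ⟨x₀, hax₀, hx₀b, hx₀⟩
  have hbdd : BddBelow S := ⟨a, fun x hx => hx.1⟩
  set z := sInf S with hz
  have haz : a ≤ z := le_csInf hne fun x hx => hx.1
  have hzb : z < b := lt_of_le_of_lt (csInf_le hbdd ⟨hax₀, hx₀b, hx₀⟩) hx₀b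
  have hbelow : ∀ y, a ≤ y → y < z → P y := by
    intro y hay hyz
    by_contra hy
    exact absurd (csInf_le hbdd ⟨hay, hyz.trans hzb, hy⟩) (not_le.mpr hyz)
  have hPz : P z := by
    rcases haz.eq_or_lt with h | h
    · rwa [← h]
    · exact hl z h hzb hbelow
  obtain ⟨w, hzw, hw⟩ := (mem_nhdsGT_iff_exists_Ioo_subset).mp (hr z haz hzb hPz)
  obtain ⟨y, hyS, hyw⟩ := exists_lt_of_csInf_lt hne (show sInf S < w from hzw)
  have hzy : z ≤ y := csInf_le hbdd hyS
  rcases hzy.eq_or_lt with h | h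
  · exact hyS.2.2 (h ▸ hPz)
  · exact hyS.2.2 (hw ⟨h, hyw⟩)

/-- `g` is on `[0, ∞)` a right-constant step function with finitely many jumps, whose values and
jump points lie in the subfield `K` of the reals. The cases of interest are `K = ℚ` and `K = ℝ`. -/
def IsStepOver (K : Subfield ℝ) (g : ℝ → ℝ) : Prop :=
  (∃ J : Finset ℝ, (∀ j ∈ J, j ∈ K) ∧ ∀ a b : ℝ, 0 ≤ a → a ≤ b →
    (∀ j ∈ J, ¬ (a < j ∧ j ≤ b)) → g a = g b) ∧
  ∀ θ : ℝ, 0 ≤ θ → g θ ∈ K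

/-- `g` agrees along the filter `F` with an affine function whose coefficients lie in `K`. Used for
one-sided neighbourhoods, which include their centre. -/
def AffineAlong (K : Subfield ℝ) (F : Filter ℝ) (g : ℝ → ℝ) : Prop :=
  ∃ α ∈ K, ∃ β ∈ K, ∀ᶠ y in F, g y = α + β * y

/-- `g` is on `[0, ∞)` continuous and piecewise affine with coefficients in `K`, expressed through
its one-sided germs. Breakpoints then lie in `K` automatically, as intersections of two different
lines over `K`. -/
def IsPiecewiseAffine (K : Subfield ℝ) (g : ℝ → ℝ) : Prop :=
  ∀ θ : ℝ, 0 ≤ θ → AffineAlong K (𝓝[≥] θ) g ∧ (0 < θ → AffineAlong K (𝓝[≤] θ) g)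

namespace IsStepOver

variable {K : Subfield ℝ} {g h : ℝ → ℝ}

theorem const {c : ℝ} (hc : c ∈ K) : IsStepOver K fun _ => c :=
  ⟨⟨∅, by simp, fun _ _ _ _ _ => rfl⟩, fun _ _ => hc⟩

theorem ite_lt {d : ℝ} (hd : d ∈ K) (hg : IsStepOver K g) (hh : IsStepOver K h) :
    IsStepOver K fun θ => if θ < d then g θ else h θ := by
  classical
  obtain ⟨⟨J, hJ, hJg⟩, hv⟩ := hg
  obtain ⟨⟨J', hJ', hJh⟩, hv'⟩ := hh
  refine ⟨⟨insert d (J ∪ J'), ?_, ?_⟩, ?_⟩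
  · intro j hj
    simp only [Finset.mem_insert, Finset.mem_union] at hj
    rcases hj with rfl | hj | hj
    exacts [hd, hJ j hj, hJ' j hj]
  · intro a b ha hab hj
    have h1 := hJg a b ha hab fun j hjJ => hj j (by simp [hjJ])
    have h2 := hJh a b ha hab fun j hjJ => hj j (by simp [hjJ])
    have h3 := hj d (by simp)
    by_cases had : a < d
    · have hbd : b < d := by
        by_contra hbd
        exact h3 ⟨had, not_lt.mp hbd⟩
      simp only [had, hbd, if_true, h1]
    · have hbd : ¬ b < d := fun hbd => had (hab.trans_lt hbd)
      simp only [had, hbd, if_false, h2]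
  · intro θ hθ
    dsimp only
    split_ifs
    exacts [hv θ hθ, hv' θ hθ]

theorem ite_Ico {c d : ℝ} (hc : c ∈ K) (hd : d ∈ K) (hg : IsStepOver K g) (hh : IsStepOver K h) :
    IsStepOver K fun θ => if c ≤ θ ∧ θ < d then g θ else h θ := by
  have := ite_lt hc hh (ite_lt hd hg hh)
  convert this using 2 with θ
  by_cases h1 : θ < c
  · simp [h1]
  · by_cases h2 : θ < d <;> simp [h1, h2, not_lt.mp h1]

theorem add (hg : IsStepOver K g) (hh : IsStepOver K h) : IsStepOver K fun θ => g θ + h θ := by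
  classical
  obtain ⟨⟨J, hJ, hJg⟩, hv⟩ := hg
  obtain ⟨⟨J', hJ', hJh⟩, hv'⟩ := hh
  refine ⟨⟨J ∪ J', ?_, ?_⟩, fun θ hθ => K.add_mem (hv θ hθ) (hv' θ hθ)⟩
  · intro j hj
    rcases Finset.mem_union.mp hj with hj | hj
    exacts [hJ j hj, hJ' j hj]
  · intro a b ha hab hj
    dsimp only
    rw [hJg a b ha hab fun j hjJ => hj j (by simp [hjJ]),
      hJh a b ha hab fun j hjJ => hj j (by simp [hjJ])]

theorem sum {ι : Type*} (s : Finset ι) {G : ι → ℝ → ℝ} (hG : ∀ i ∈ s, IsStepOver K (G i)) :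
    IsStepOver K fun θ => ∑ i ∈ s, G i θ := by
  classical
  induction s using Finset.induction_on with
  | empty => simpa using const K.zero_mem
  | insert i s hi ih =>
    simp only [Finset.sum_insert hi]
    exact (hG i (by simp)).add (ih fun j hj => hG j (by simp [hj]))

theorem eventually_right (hg : IsStepOver K g) {θ : ℝ} (hθ : 0 ≤ θ) :
    ∀ᶠ y in 𝓝[≥] θ, g y = g θ := by
  obtain ⟨⟨J, -, hJg⟩, -⟩ := hg
  have h1 : ∀ᶠ y in 𝓝[≥] θ, ∀ j ∈ J, ¬ (θ < j ∧ j ≤ y) := by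
    rw [Filter.eventually_all_finset]
    intro j _
    by_cases hj : θ < j
    · filter_upwards [mem_nhdsWithin_of_mem_nhds (Iio_mem_nhds hj)] with y hy
      exact fun h => absurd h.2 (not_le.mpr hy)
    · exact Eventually.of_forall fun y h => hj h.1
  filter_upwards [h1, self_mem_nhdsWithin] with y hy hθy
  exact (hJg θ y hθ hθy hy).symm

/-- The left limit of a step function over `K` lies in `K`, and it is the value itself outside of
`K`, where there are no jumps. -/
theorem eventually_left (hg : IsStepOver K g) {θ : ℝ} (hθ : 0 < θ) :
    ∃ c ∈ K, (∀ᶠ y in 𝓝[<] θ, g y = c) ∧ (θ ∉ K → c = g θ) := by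
  obtain ⟨⟨J, hJ, hJg⟩, hv⟩ := hg
  have h1 : ∀ᶠ z in 𝓝[<] θ, ∀ j ∈ J, ¬ (z < j ∧ j < θ) := by
    rw [Filter.eventually_all_finset]
    intro j _
    by_cases hj : j < θ
    · filter_upwards [mem_nhdsWithin_of_mem_nhds (Ioi_mem_nhds hj)] with y hy
      exact fun h => absurd h.1 (not_lt.mpr (le_of_lt hy))
    · exact Eventually.of_forall fun y h => hj h.2
  obtain ⟨z, hz, hz0, hzθ⟩ :=
    (h1.and (Ioo_mem_nhdsLT hθ)).exists
  refine ⟨g z, hv z hz0.le, ?_, ?_⟩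
  · filter_upwards [Ioo_mem_nhdsLT hzθ] with y hy
    refine (hJg z y hz0.le hy.1.le fun j hj h => hz j hj ⟨h.1, h.2.trans_lt hy.2⟩).symm
  · intro hθK
    refine hJg z θ hz0.le hzθ.le fun j hj h => ?_
    rcases h.2.eq_or_lt with h' | h'
    · exact hθK (h' ▸ hJ j hj)
    · exact hz j hj ⟨h.1, h'⟩

theorem intervalIntegrable_zero (hg : IsStepOver K g) {θ : ℝ} (hθ : 0 ≤ θ) :
    IntervalIntegrable g volume 0 θ := by
  refine Ico_induction (P := fun θ => IntervalIntegrable g volume 0 θ) (a := 0) (b := θ + 1)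
    IntervalIntegrable.refl ?_ ?_ θ hθ (by linarith)
  · intro x hx _ hint
    obtain ⟨w, hxw, hw⟩ := mem_nhdsGE_iff_exists_Icc_subset.mp (hg.eventually_right hx)
    filter_upwards [Ioo_mem_nhdsGT hxw] with y hy
    refine hint.trans ?_
    refine (intervalIntegrable_const (c := g x)).congr_ae ?_
    rw [Filter.EventuallyEq, Set.uIoc_of_le hy.1.le]
    refine (ae_restrict_iff' measurableSet_Ioc).mpr (Eventually.of_forall fun z hz => ?_)
    exact (hw ⟨hz.1.le, hz.2.trans hy.2.le⟩).symm
  · intro x hx _ hint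
    obtain ⟨c, -, hc, -⟩ := hg.eventually_left hx
    obtain ⟨z, hzx, hz⟩ := mem_nhdsLT_iff_exists_Ioo_subset.mp hc
    have hm : max z 0 < x := max_lt hzx hx
    obtain ⟨y, hy1, hy2⟩ := exists_between hm
    have hy0 : 0 < y := (le_max_right _ _).trans_lt hy1
    refine (hint y hy0.le hy2).trans ?_
    refine (intervalIntegrable_const (c := c)).congr_ae ?_
    rw [Filter.EventuallyEq, Set.uIoc_of_le hy2.le]
    refine (ae_restrict_iff' measurableSet_Ioc).mpr ?_
    have : ∀ᵐ w : ℝ, w ≠ x := by simp [ae_iff]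
    filter_upwards [this] with w hwx hw
    exact (hz ⟨((le_max_left _ _).trans_lt hy1).trans hw.1, lt_of_le_of_ne hw.2 hwx⟩).symm

/-- A step function that vanishes from some time on is integrable on `[0, ∞)`. -/
theorem integrableOn_Ici (hg : IsStepOver K g) {M : ℝ} (hM : ∀ θ, M ≤ θ → g θ = 0) :
    IntegrableOn g (Set.Ici 0) := by
  have hM0 : (0 : ℝ) ≤ max M 0 := le_max_right _ _
  have h1 := (hg.intervalIntegrable_zero hM0)
  rw [intervalIntegrable_iff_integrableOn_Ioc_of_le hM0] at h1
  rw [integrableOn_Ici_iff_integrableOn_Ioi, ← Set.Ioc_union_Ioi_eq_Ioi hM0]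
  refine h1.union ?_
  refine (integrableOn_zero).congr_fun (fun θ hθ => ?_) measurableSet_Ioi
  exact (hM θ ((le_max_left _ _).trans (le_of_lt hθ))).symm

end IsStepOver

theorem IsRationalStepFunction.isStepOver {g : ℝ → ℝ} (hg : IsRationalStepFunction g)
    (K : Subfield ℝ) : IsStepOver K g := by
  classical
  obtain ⟨⟨J, hJ⟩, hv⟩ := hg
  refine ⟨⟨J.image (fun q : ℚ => (q : ℝ)), ?_, ?_⟩, ?_⟩
  · intro j hj
    obtain ⟨q, -, rfl⟩ := Finset.mem_image.mp hj
    exact SubfieldClass.ratCast_mem K q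
  · intro a b ha hab h
    exact hJ a b ha hab fun j hj => h j (Finset.mem_image_of_mem _ hj)
  · intro θ hθ
    obtain ⟨q, hq⟩ := hv θ hθ
    exact hq ▸ SubfieldClass.ratCast_mem K q

/-- The rational numbers as a subfield of the reals. -/
def ratSubfield : Subfield ℝ := (Rat.castHom ℝ).fieldRange

theorem mem_ratSubfield {x : ℝ} : x ∈ ratSubfield ↔ ∃ q : ℚ, x = q := by
  simp [ratSubfield, RingHom.mem_fieldRange, eq_comm]

theorem isRationalStepFunction_iff {g : ℝ → ℝ} :
    IsRationalStepFunction g ↔ IsStepOver ratSubfield g := by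
  classical
  refine ⟨fun h => h.isStepOver _, ?_⟩
  rintro ⟨⟨J, hJ, hJg⟩, hv⟩
  refine ⟨⟨J.preimage (fun q : ℚ => (q : ℝ)) (Rat.cast_injective.injOn), ?_⟩,
    fun θ hθ => mem_ratSubfield.mp (hv θ hθ)⟩
  intro a b ha hab h
  refine hJg a b ha hab fun j hj hjab => ?_
  obtain ⟨q, rfl⟩ := mem_ratSubfield.mp (hJ j hj)
  exact h q (Finset.mem_preimage.mpr hj) hjab

namespace AffineAlong

variable {K : Subfield ℝ} {F : Filter ℝ} {g h : ℝ → ℝ}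

theorem congr (hg : AffineAlong K F g) (hgh : ∀ᶠ y in F, h y = g y) : AffineAlong K F h := by
  obtain ⟨α, hα, β, hβ, hy⟩ := hg
  exact ⟨α, hα, β, hβ, by filter_upwards [hy, hgh] with y h1 h2; rw [h2, h1]⟩

theorem const {c : ℝ} (hc : c ∈ K) : AffineAlong K F fun _ => c :=
  ⟨c, hc, 0, K.zero_mem, by simp⟩

theorem add (hg : AffineAlong K F g) (hh : AffineAlong K F h) :
    AffineAlong K F fun θ => g θ + h θ := by
  obtain ⟨α, hα, β, hβ, hy⟩ := hg
  obtain ⟨α', hα', β', hβ', hy'⟩ := hh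
  refine ⟨α + α', K.add_mem hα hα', β + β', K.add_mem hβ hβ', ?_⟩
  filter_upwards [hy, hy'] with y h1 h2
  rw [h1, h2]; ring

theorem const_mul {c : ℝ} (hc : c ∈ K) (hg : AffineAlong K F g) :
    AffineAlong K F fun θ => c * g θ := by
  obtain ⟨α, hα, β, hβ, hy⟩ := hg
  refine ⟨c * α, K.mul_mem hc hα, c * β, K.mul_mem hc hβ, ?_⟩
  filter_upwards [hy] with y h1
  rw [h1]; ring

theorem sub (hg : AffineAlong K F g) (hh : AffineAlong K F h) :
    AffineAlong K F fun θ => g θ - h θ := by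
  refine (hg.add (hh.const_mul (K.neg_mem K.one_mem))).congr (Eventually.of_forall fun y => ?_)
  ring

/-- An affine function has constant sign along each one-sided neighbourhood; this makes
minima of affine functions affine there. -/
theorem sign_right (θ α β : ℝ) :
    (∀ᶠ y in 𝓝[≥] θ, 0 ≤ α + β * y) ∨ ∀ᶠ y in 𝓝[≥] θ, α + β * y ≤ 0 := by
  have hc : Tendsto (fun y : ℝ => α + β * y) (𝓝[≥] θ) (𝓝 (α + β * θ)) :=
    ((continuous_const.add (continuous_const.mul continuous_id)).tendsto θ).mono_left
      nhdsWithin_le_nhds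
  rcases lt_trichotomy (α + β * θ) 0 with h | h | h
  · exact Or.inr ((hc.eventually (Iio_mem_nhds h)).mono fun y hy => le_of_lt hy)
  · rcases le_total 0 β with hβ | hβ
    · left
      filter_upwards [self_mem_nhdsWithin] with y hy
      nlinarith [mul_nonneg hβ (sub_nonneg.mpr (show θ ≤ y from hy))]
    · right
      filter_upwards [self_mem_nhdsWithin] with y hy
      nlinarith [mul_nonneg (neg_nonneg.mpr hβ) (sub_nonneg.mpr (show θ ≤ y from hy))]
  · exact Or.inl ((hc.eventually (Ioi_mem_nhds h)).mono fun y hy => le_of_lt hy)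

theorem sign_left (θ α β : ℝ) :
    (∀ᶠ y in 𝓝[≤] θ, 0 ≤ α + β * y) ∨ ∀ᶠ y in 𝓝[≤] θ, α + β * y ≤ 0 := by
  have hc : Tendsto (fun y : ℝ => α + β * y) (𝓝[≤] θ) (𝓝 (α + β * θ)) :=
    ((continuous_const.add (continuous_const.mul continuous_id)).tendsto θ).mono_left
      nhdsWithin_le_nhds
  rcases lt_trichotomy (α + β * θ) 0 with h | h | h
  · exact Or.inr ((hc.eventually (Iio_mem_nhds h)).mono fun y hy => le_of_lt hy)
  · rcases le_total 0 β with hβ | hβ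
    · right
      filter_upwards [self_mem_nhdsWithin] with y hy
      nlinarith [mul_nonneg hβ (sub_nonneg.mpr (show y ≤ θ from hy))]
    · left
      filter_upwards [self_mem_nhdsWithin] with y hy
      nlinarith [mul_nonneg (neg_nonneg.mpr hβ) (sub_nonneg.mpr (show y ≤ θ from hy))]
  · exact Or.inl ((hc.eventually (Ioi_mem_nhds h)).mono fun y hy => le_of_lt hy)

/-- Along a filter on which affine functions have constant sign, one of finitely many functions
affine along the filter is the least. -/
theorem exists_eventually_le {ι : Type*}
    (hF : ∀ α β : ℝ, (∀ᶠ y in F, 0 ≤ α + β * y) ∨ ∀ᶠ y in F, α + β * y ≤ 0)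
    {s : Finset ι} (hs : s.Nonempty) {G : ι → ℝ → ℝ} (hG : ∀ i ∈ s, AffineAlong K F (G i)) :
    ∃ i ∈ s, ∀ j ∈ s, ∀ᶠ y in F, G i y ≤ G j y := by
  classical
  induction hs using Finset.Nonempty.cons_induction with
  | singleton i => exact ⟨i, by simp, by simp⟩
  | cons i s hi hs ih =>
    obtain ⟨k, hk, hmin⟩ := ih fun j hj => hG j (by simp [hj])
    obtain ⟨α, -, β, -, h1⟩ := hG i (by simp)
    obtain ⟨α', -, β', -, h2⟩ := hG k (by simp [hk])
    rcases hF (α - α') (β - β') with h | h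
    · refine ⟨k, by simp [hk], fun j hj => ?_⟩
      rcases Finset.mem_cons.mp hj with rfl | hj
      · filter_upwards [h, h1, h2] with y e1 e2 e3
        rw [e2, e3]; linarith
      · exact hmin j hj
    · have hik : ∀ᶠ y in F, G i y ≤ G k y := by
        filter_upwards [h, h1, h2] with y e1 e2 e3
        rw [e2, e3]; linarith
      refine ⟨i, by simp, fun j hj => ?_⟩
      rcases Finset.mem_cons.mp hj with rfl | hj
      · exact Eventually.of_forall fun y => le_rfl
      · filter_upwards [hik, hmin j hj] with y e1 e2
        exact e1.trans e2

end AffineAlong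

namespace IsPiecewiseAffine

variable {K : Subfield ℝ} {g h : ℝ → ℝ}

theorem const {c : ℝ} (hc : c ∈ K) : IsPiecewiseAffine K fun _ => c :=
  fun _ _ => ⟨.const hc, fun _ => .const hc⟩

theorem add (hg : IsPiecewiseAffine K g) (hh : IsPiecewiseAffine K h) :
    IsPiecewiseAffine K fun θ => g θ + h θ :=
  fun θ hθ => ⟨(hg θ hθ).1.add (hh θ hθ).1, fun h0 => ((hg θ hθ).2 h0).add ((hh θ hθ).2 h0)⟩

theorem sub (hg : IsPiecewiseAffine K g) (hh : IsPiecewiseAffine K h) :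
    IsPiecewiseAffine K fun θ => g θ - h θ :=
  fun θ hθ => ⟨(hg θ hθ).1.sub (hh θ hθ).1, fun h0 => ((hg θ hθ).2 h0).sub ((hh θ hθ).2 h0)⟩

theorem const_mul {c : ℝ} (hc : c ∈ K) (hg : IsPiecewiseAffine K g) :
    IsPiecewiseAffine K fun θ => c * g θ :=
  fun θ hθ => ⟨(hg θ hθ).1.const_mul hc, fun h0 => ((hg θ hθ).2 h0).const_mul hc⟩

theorem mem (hg : IsPiecewiseAffine K g) {θ : ℝ} (hθ : 0 ≤ θ) (hK : θ ∈ K) : g θ ∈ K := by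
  obtain ⟨α, hα, β, hβ, hy⟩ := (hg θ hθ).1
  rw [hy.self_of_nhdsWithin Set.self_mem_Ici]
  exact K.add_mem hα (K.mul_mem hβ hK)

/-- A finite minimum of piecewise affine functions is piecewise affine. -/
theorem of_isLeast {ι : Type*} {s : Finset ι} (hs : s.Nonempty) {G : ι → ℝ → ℝ}
    (hG : ∀ i ∈ s, IsPiecewiseAffine K (G i))
    (hg : ∀ θ, 0 ≤ θ → IsLeast {x | ∃ i ∈ s, x = G i θ} (g θ)) : IsPiecewiseAffine K g := by
  have hle : ∀ θ, 0 ≤ θ → ∀ i ∈ s, (∀ j ∈ s, G i θ ≤ G j θ) → g θ = G i θ := by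
    intro θ hθ i hi hmin
    refine le_antisymm ((hg θ hθ).2 ⟨i, hi, rfl⟩) ?_
    obtain ⟨j, hj, hj'⟩ := (hg θ hθ).1
    exact hj' ▸ hmin j hj
  intro θ hθ
  refine ⟨?_, fun h0 => ?_⟩
  · obtain ⟨i, hi, hmin⟩ := AffineAlong.exists_eventually_le (K := K) (AffineAlong.sign_right θ) hs
      fun i hi => (hG i hi θ hθ).1
    refine ((hG i hi θ hθ).1).congr ?_
    filter_upwards [(Filter.eventually_all_finset s).mpr hmin, self_mem_nhdsWithin] with y hy hθy
    exact hle y (hθ.trans hθy) i hi hy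
  · obtain ⟨i, hi, hmin⟩ := AffineAlong.exists_eventually_le (K := K) (AffineAlong.sign_left θ) hs
      fun i hi => (hG i hi θ hθ).2 h0
    refine ((hG i hi θ hθ).2 h0).congr ?_
    filter_upwards [(Filter.eventually_all_finset s).mpr hmin,
      mem_nhdsWithin_of_mem_nhds (Ioi_mem_nhds h0)] with y hy hy0
    exact hle y (le_of_lt hy0) i hi hy

theorem comp_add {τ : ℝ} (hτ : 0 < τ) (hK : τ ∈ K) (hg : IsPiecewiseAffine K g) :
    IsPiecewiseAffine K fun θ => g (θ + τ) := by
  intro θ hθ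
  have key : ∀ F F' : Filter ℝ, Tendsto (fun y => y + τ) F F' → AffineAlong K F' g →
      AffineAlong K F fun θ => g (θ + τ) := by
    rintro F F' hFF' ⟨α, hα, β, hβ, hy⟩
    refine ⟨α + β * τ, K.add_mem hα (K.mul_mem hβ hK), β, hβ, ?_⟩
    filter_upwards [hFF'.eventually hy] with y h1
    rw [h1]; ring
  have hcont : Continuous fun y : ℝ => y + τ := by fun_prop
  have h0 : 0 < θ + τ := by linarith
  refine ⟨key _ (𝓝[≥] (θ + τ)) ?_ (hg _ h0.le).1,
    fun _ => key _ (𝓝[≤] (θ + τ)) ?_ ((hg _ h0.le).2 h0)⟩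
  · refine tendsto_nhdsWithin_of_tendsto_nhds_of_eventually_within _
      ((hcont.tendsto θ).mono_left nhdsWithin_le_nhds) ?_
    filter_upwards [self_mem_nhdsWithin] with y hy
    simpa using hy
  · refine tendsto_nhdsWithin_of_tendsto_nhds_of_eventually_within _
      ((hcont.tendsto θ).mono_left nhdsWithin_le_nhds) ?_
    filter_upwards [self_mem_nhdsWithin] with y hy
    simpa using hy

/-- Outside of `K`, the zeros of a piecewise affine function over `K` are not isolated from the
right: two different lines over `K` meet in `K` only. -/
theorem eventually_eq_zero (hg : IsPiecewiseAffine K g) {θ : ℝ} (hθ : 0 ≤ θ) (hK : θ ∉ K)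
    (h0 : g θ = 0) : ∀ᶠ y in 𝓝[≥] θ, g y = 0 := by
  obtain ⟨α, hα, β, hβ, hy⟩ := (hg θ hθ).1
  have h1 : α + β * θ = 0 := by rw [← hy.self_of_nhdsWithin Set.self_mem_Ici, h0]
  have hβ0 : β = 0 := by
    by_contra hne
    apply hK
    have : θ = -α / β := by field_simp; linarith
    rw [this]
    exact K.div_mem (K.neg_mem hα) hβ
  have hα0 : α = 0 := by simpa [hβ0] using h1
  filter_upwards [hy] with y h
  simp [h, hα0, hβ0]

end IsPiecewiseAffine

/-- Also the intercepts of the primitive lie in `K`, because the jumps do. -/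
theorem IsStepOver.isPiecewiseAffine_integral {K : Subfield ℝ} {g : ℝ → ℝ} (hg : IsStepOver K g) :
    IsPiecewiseAffine K fun θ => ∫ ζ in (0 : ℝ)..θ, g ζ := by
  set G : ℝ → ℝ := fun θ => ∫ ζ in (0 : ℝ)..θ, g ζ with hG
  have hsub : ∀ {c d k : ℝ}, 0 ≤ c → c ≤ d → (∀ z, c < z → z < d → g z = k) →
      G d = G c + k * (d - c) := by
    intro c d k hc hcd hk
    have h1 : G c + ∫ ζ in c..d, g ζ = G d :=
      intervalIntegral.integral_add_adjacent_intervals (hg.intervalIntegrable_zero hc)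
        ((hg.intervalIntegrable_zero hc).symm.trans (hg.intervalIntegrable_zero (hc.trans hcd)))
    have h2 : ∫ ζ in c..d, g ζ = ∫ ζ in c..d, k := by
      refine intervalIntegral.integral_congr_ae ?_
      have : ∀ᵐ w : ℝ, w ≠ d := by simp [ae_iff]
      filter_upwards [this] with w hwd hw
      rw [Set.uIoc_of_le hcd] at hw
      exact hk w hw.1 (lt_of_le_of_ne hw.2 hwd)
    rw [← h1, h2, intervalIntegral.integral_const, smul_eq_mul, mul_comm]
  have hright : ∀ θ, 0 ≤ θ → ∀ᶠ y in 𝓝[≥] θ, G y = G θ + g θ * (y - θ) := by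
    intro θ hθ
    obtain ⟨w, hxw, hw⟩ := mem_nhdsGE_iff_exists_Icc_subset.mp (hg.eventually_right hθ)
    filter_upwards [Icc_mem_nhdsGE hxw] with y hy
    exact hsub hθ hy.1 fun z h1 h2 => hw ⟨h1.le, h2.le.trans hy.2⟩
  have hleft : ∀ θ, 0 < θ → ∃ c ∈ K, (θ ∉ K → c = g θ) ∧
      ∃ z, 0 ≤ z ∧ z < θ ∧ g z = c ∧ ∀ y, z ≤ y → y ≤ θ → G y = G θ + c * (y - θ) := by
    intro θ hθ
    obtain ⟨c, hcK, hc, hK⟩ := hg.eventually_left hθ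
    obtain ⟨z, hzx, hz⟩ := mem_nhdsLT_iff_exists_Ioo_subset.mp hc
    have hm : max z 0 < θ := max_lt hzx hθ
    obtain ⟨y, hy1, hy2⟩ := exists_between hm
    have hzy := (le_max_left _ _).trans_lt hy1
    refine ⟨c, hcK, hK, y, ((le_max_right _ _).trans_lt hy1).le, hy2, hz ⟨hzy, hy2⟩,
      fun w hw1 hw2 => ?_⟩
    have := hsub (k := c) (((le_max_right _ _).trans_lt hy1).le.trans hw1) hw2
      fun u hu1 hu2 => hz ⟨hzy.trans_le (hw1.trans hu1.le), hu2⟩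
    linarith
  -- The intercept `G θ - g θ * θ` of the right germ changes at jumps only, and these lie in `K`.
  have hmem : ∀ θ, 0 ≤ θ → G θ - g θ * θ ∈ K := by
    intro θ hθ
    refine Ico_induction (P := fun θ => G θ - g θ * θ ∈ K) (a := 0) (b := θ + 1)
      (by simp [hG, K.zero_mem]) ?_ ?_ θ hθ (by linarith)
    · intro x hx _ hxK
      filter_upwards [nhdsWithin_mono x Set.Ioi_subset_Ici_self (hright x hx),
        nhdsWithin_mono x Set.Ioi_subset_Ici_self (hg.eventually_right hx)] with y h1 h2
      rw [h1, h2]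
      convert hxK using 1
      ring
    · intro x hx _ ih
      obtain ⟨c, hcK, hc, z, hz0, hzx, hgz, hz⟩ := hleft x hx
      have h1 : G x - c * x ∈ K := by
        have := ih z hz0 hzx
        rw [hz z le_rfl hzx.le, hgz] at this
        convert this using 1
        ring
      by_cases hxK : x ∈ K
      · have : G x - g x * x = (G x - c * x) + (c - g x) * x := by ring
        rw [this]
        exact K.add_mem h1 (K.mul_mem (K.sub_mem hcK (hg.2 x hx.le)) hxK)
      · rwa [hc hxK] at h1
  intro θ hθ
  refine ⟨⟨_, hmem θ hθ, g θ, hg.2 θ hθ, ?_⟩, fun h0 => ?_⟩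
  · filter_upwards [hright θ hθ] with y hy
    rw [hy]; ring
  · obtain ⟨c, hcK, -, z, hz0, hzx, hgz, hz⟩ := hleft θ h0
    refine ⟨G θ - c * θ, ?_, c, hcK, ?_⟩
    · have := hmem z hz0
      rw [hz z le_rfl hzx.le, hgz] at this
      convert this using 1
      ring
    · filter_upwards [Icc_mem_nhdsLE hzx] with y hy
      rw [hz y hy.1 hy.2]; ring

/-! ### Queues operating at capacity -/

/-- A continuous function that starts nonpositive and does not grow while it is positive stays
nonpositive. -/
theorem nonpos_of_no_growth {g : ℝ → ℝ} {a b : ℝ} (hg : ContinuousOn g (Set.Icc a b))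
    (ha : g a ≤ 0)
    (h : ∀ c d, a ≤ c → c ≤ d → d ≤ b → (∀ z, c < z → z ≤ d → 0 < g z) → g d ≤ g c) :
    ∀ θ, a ≤ θ → θ ≤ b → g θ ≤ 0 := by
  intro θ haθ hθb
  by_contra! hpos
  set S : Set ℝ := {z ∈ Set.Icc a θ | g z ≤ 0} with hS
  have hcont : ContinuousOn g (Set.Icc a θ) := hg.mono (Set.Icc_subset_Icc_right hθb)
  have hcl : IsClosed S := hcont.preimage_isClosed_of_isClosed isClosed_Icc isClosed_Iic
  have hne : S.Nonempty := ⟨a, ⟨le_rfl, haθ⟩, ha⟩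
  have hbdd : BddAbove S := ⟨θ, fun z hz => hz.1.2⟩
  have hc := hcl.csSup_mem hne hbdd
  set c := sSup S
  have := h c θ hc.1.1 hc.1.2 hθb fun z hz1 hz2 => by
    by_contra! hz
    exact absurd (le_csSup hbdd ⟨⟨hc.1.1.trans hz1.le, hz2⟩, hz⟩) (not_le.mpr hz1)
  linarith [hc.2]

namespace Network

variable {V E : Type*} (N : Network V E) {f : FlowOverTime E} {e : E}

theorem τ_pos' (e : E) : (0 : ℝ) < N.τ e := by exact_mod_cast N.τ_pos e

theorem ν_pos' (e : E) : (0 : ℝ) < N.ν e := by exact_mod_cast N.ν_pos e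

/-- Both rates of the edge `e` are integrable on bounded intervals of nonnegative times. -/
def LocallyIntegrableRates (f : FlowOverTime E) (e : E) : Prop :=
  ∀ θ : ℝ, 0 ≤ θ → IntervalIntegrable (f.inflow e) volume 0 θ ∧
    IntervalIntegrable (f.outflow e) volume 0 θ

variable {N}

theorem LocallyIntegrableRates.inflow (hf : LocallyIntegrableRates f e) {c d : ℝ} (hc : 0 ≤ c)
    (hd : 0 ≤ d) : IntervalIntegrable (f.inflow e) volume c d :=
  (hf c hc).1.symm.trans (hf d hd).1

theorem LocallyIntegrableRates.outflow (hf : LocallyIntegrableRates f e) {c d : ℝ} (hc : 0 ≤ c)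
    (hd : 0 ≤ d) : IntervalIntegrable (f.outflow e) volume c d :=
  (hf c hc).2.symm.trans (hf d hd).2

theorem LocallyIntegrableRates.outflow_shift (hf : LocallyIntegrableRates f e) {c d τ : ℝ}
    (hτ : 0 ≤ τ) (hc : 0 ≤ c) (hd : 0 ≤ d) :
    IntervalIntegrable (fun ζ => f.outflow e (ζ + τ)) volume c d := by
  have := (hf.outflow (add_nonneg hc hτ) (add_nonneg hd hτ)).comp_add_right τ
  simpa using this

/-- The queue is the primitive of inflow rate minus shifted outflow rate. -/
theorem queue_sub (hf : LocallyIntegrableRates f e) {c d : ℝ} (hc : 0 ≤ c) (hd : 0 ≤ d) :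
    N.queue f e d - N.queue f e c =
      ∫ ζ in c..d, (f.inflow e ζ - f.outflow e (ζ + N.τ e)) := by
  have hτ := (N.τ_pos' e).le
  rw [intervalIntegral.integral_sub (hf.inflow hc hd) (hf.outflow_shift hτ hc hd),
    intervalIntegral.integral_comp_add_right (fun ζ => f.outflow e ζ),
    ← intervalIntegral.integral_interval_sub_left (hf.inflow le_rfl hd) (hf.inflow le_rfl hc),
    ← intervalIntegral.integral_interval_sub_left (hf.outflow le_rfl (add_nonneg hd hτ))
      (hf.outflow le_rfl (add_nonneg hc hτ))]
  simp only [queue]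
  ring

theorem queue_eq_add_mul (hf : LocallyIntegrableRates f e) {c d k : ℝ} (hc : 0 ≤ c) (hcd : c ≤ d)
    (h : ∀ z, c < z → z < d → f.inflow e z - f.outflow e (z + N.τ e) = k) :
    N.queue f e d = N.queue f e c + k * (d - c) := by
  have h1 := N.queue_sub hf hc (hc.trans hcd)
  have h2 : ∫ ζ in c..d, (f.inflow e ζ - f.outflow e (ζ + N.τ e)) = ∫ ζ in c..d, k := by
    refine intervalIntegral.integral_congr_ae ?_
    have : ∀ᵐ w : ℝ, w ≠ d := by simp [ae_iff]
    filter_upwards [this] with w hwd hw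
    rw [Set.uIoc_of_le hcd] at hw
    exact h w hw.1 (lt_of_le_of_ne hw.2 hwd)
  rw [h2, intervalIntegral.integral_const, smul_eq_mul] at h1
  linarith

theorem queue_ge_add_mul (hf : LocallyIntegrableRates f e) {c d k : ℝ} (hc : 0 ≤ c) (hcd : c ≤ d)
    (h : ∀ z, c < z → z < d → k ≤ f.inflow e z - f.outflow e (z + N.τ e)) :
    N.queue f e c + k * (d - c) ≤ N.queue f e d := by
  have h1 := N.queue_sub hf hc (hc.trans hcd)
  have h2 : ∫ ζ in c..d, k ≤ ∫ ζ in c..d, (f.inflow e ζ - f.outflow e (ζ + N.τ e)) := by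
    refine intervalIntegral.integral_mono_on_of_le_Ioo hcd (by simp)
      ((hf.inflow hc (hc.trans hcd)).sub
        (hf.outflow_shift (N.τ_pos' e).le hc (hc.trans hcd))) ?_
    exact fun z hz => h z hz.1 hz.2
  rw [intervalIntegral.integral_const, smul_eq_mul] at h2
  linarith

theorem continuousOn_queue (hf : LocallyIntegrableRates f e) (X : ℝ) :
    ContinuousOn (N.queue f e) (Set.Icc 0 X) := by
  rcases lt_or_ge X 0 with hX | hX
  · simp [Set.Icc_eq_empty (not_le.mpr hX)]
  have h1 : IntegrableOn (fun ζ => f.inflow e ζ - f.outflow e (ζ + N.τ e)) (Set.Icc 0 X) := by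
    rw [integrableOn_Icc_iff_integrableOn_Ioc, ← intervalIntegrable_iff_integrableOn_Ioc_of_le hX]
    exact (hf.inflow le_rfl hX).sub (hf.outflow_shift (N.τ_pos' e).le le_rfl hX)
  have h2 := (intervalIntegral.continuousOn_primitive_interval
    (μ := volume) (a := 0) (b := X) (by rwa [Set.uIcc_of_le hX])).const_add (N.queue f e 0)
  rw [Set.uIcc_of_le hX] at h2
  refine h2.congr fun θ hθ => ?_
  have := N.queue_sub hf le_rfl hθ.1
  simp only at *
  linarith

theorem queue_zero (hearly : ∀ θ : ℝ, 0 ≤ θ → θ < N.τ e → f.outflow e θ = 0) :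
    N.queue f e 0 = 0 := by
  have hτ := (N.τ_pos' e).le
  simp only [queue, intervalIntegral.integral_same, zero_add, zero_sub, neg_eq_zero]
  refine (intervalIntegral.integral_congr_ae (g := fun _ => 0) ?_).trans (by simp)
  have : ∀ᵐ w : ℝ, w ≠ N.τ e := by simp [ae_iff]
  filter_upwards [this] with w hwd hw
  rw [Set.uIoc_of_le hτ] at hw
  exact hearly w hw.1.le (lt_of_le_of_ne hw.2 hwd)

/-- Operating at capacity keeps a queue nonnegative. -/
theorem queue_nonneg_of_operates (hf : LocallyIntegrableRates f e) {a b : ℝ} (ha : 0 ≤ a)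
    (hqa : 0 ≤ N.queue f e a)
    (hq : ∀ θ, a ≤ θ → θ < b → N.QueueOperatesAtCapacity f e θ) :
    ∀ θ, a ≤ θ → θ ≤ b → 0 ≤ N.queue f e θ := by
  have key := nonpos_of_no_growth (g := fun θ => - N.queue f e θ) (a := a) (b := b)
    ((N.continuousOn_queue hf b).neg.mono (Set.Icc_subset_Icc_left ha)) (by simpa using hqa) ?_
  · intro θ h1 h2
    have := key θ h1 h2
    linarith
  · intro c d hc hcd hd hneg
    have := N.queue_ge_add_mul hf (k := 0) (ha.trans hc) hcd fun z hz1 hz2 => by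
      have h1 := hq z (hc.trans hz1.le) (hz2.trans_le hd)
      have h2 := hneg z hz1 hz2.le
      rw [QueueOperatesAtCapacity, if_neg (by linarith)] at h1
      rw [h1]
      linarith [min_le_left (f.inflow e z) (N.ν e : ℝ)]
    linarith

/-- Under constant inflow, a queue operating at capacity changes at the rate inflow minus capacity
until it is empty. -/
theorem queue_eq_max (hf : LocallyIntegrableRates f e) {a b x : ℝ} (ha : 0 ≤ a)
    (hqa : 0 ≤ N.queue f e a)
    (hx : ∀ θ, a ≤ θ → θ < b → f.inflow e θ = x)
    (hq : ∀ θ, a ≤ θ → θ < b → N.QueueOperatesAtCapacity f e θ) :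
    ∀ θ, a ≤ θ → θ ≤ b →
      N.queue f e θ = max 0 (N.queue f e a + (x - N.ν e) * (θ - a)) := by
  intro θ haθ hθb
  apply le_antisymm
  · have hcont : ContinuousOn
        (fun z => N.queue f e z - max 0 (N.queue f e a + (x - N.ν e) * (z - a)))
        (Set.Icc a b) :=
      ((N.continuousOn_queue hf b).mono (Set.Icc_subset_Icc_left ha)).sub
        (by fun_prop : Continuous _).continuousOn
    have := nonpos_of_no_growth hcont (by simp [hqa]) ?_ θ haθ hθb
    · linarith
    · intro c d hc hcd hd hpos
      have h1 := N.queue_eq_add_mul hf (k := x - N.ν e) (ha.trans hc) hcd fun z hz1 hz2 => by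
        have h1 := hq z (hc.trans hz1.le) (hz2.trans_le hd)
        have h2 := hpos z hz1 hz2.le
        have h3 := le_max_left 0 (N.queue f e a + (x - N.ν e) * (z - a))
        rw [QueueOperatesAtCapacity, if_pos (by linarith)] at h1
        rw [h1, hx z (hc.trans hz1.le) (hz2.trans_le hd)]
      rw [h1]
      have h4 : max 0 (N.queue f e a + (x - N.ν e) * (c - a)) + (x - N.ν e) * (d - c) ≤
          max 0 (N.queue f e a + (x - N.ν e) * (d - a)) := by
        rcases le_total 0 (N.queue f e a + (x - N.ν e) * (c - a)) with h | h
        · rw [max_eq_right h]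
          refine le_trans (le_of_eq ?_) (le_max_right _ _)
          ring
        · rw [max_eq_left h]
          have : x - N.ν e ≤ 0 ∨ c = a := by
            by_contra! hcon
            have : 0 < (x - N.ν e) * (c - a) :=
              mul_pos hcon.1 (sub_pos.mpr (lt_of_le_of_ne hc (Ne.symm hcon.2)))
            linarith
          rcases this with h' | rfl
          · refine le_trans ?_ (le_max_left _ _)
            linarith [mul_nonneg (neg_nonneg.mpr h') (sub_nonneg.mpr hcd)]
          · refine le_trans ?_ (le_max_right _ _)
            linarith
      linarith
  · refine max_le (queue_nonneg_of_operates hf ha hqa hq θ haθ hθb) ?_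
    refine N.queue_ge_add_mul hf ha haθ fun z hz1 hz2 => ?_
    have h1 := hq z hz1.le (hz2.trans_le hθb)
    rw [QueueOperatesAtCapacity] at h1
    rw [h1, hx z hz1.le (hz2.trans_le hθb)]
    split_ifs
    · exact le_rfl
    · linarith [min_le_right x (N.ν e : ℝ)]

end Network

/-! ### The distribution process at one node -/

theorem eventually_ge_nhdsLT {z θ : ℝ} (h : z < θ) : ∀ᶠ y in 𝓝[<] θ, z ≤ y ∧ y < θ := by
  filter_upwards [Ioo_mem_nhdsLT h] with y hy using ⟨hy.1.le, hy.2⟩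

theorem eventually_lt_nhdsGE {θ c : ℝ} (h : θ < c) : ∀ᶠ y in 𝓝[≥] θ, θ ≤ y ∧ y < c := by
  filter_upwards [Ico_mem_nhdsGE h] with y hy using hy

theorem eventually_nhdsGT_of_nhdsGE {θ : ℝ} {P : ℝ → Prop} (h : ∀ᶠ y in 𝓝[≥] θ, P y) :
    ∀ᶠ y in 𝓝[>] θ, P y :=
  h.filter_mono (nhdsWithin_mono θ Set.Ioi_subset_Ici_self)

/-- The situation at one node during `[a, c)` while its gross inflow rate is constantly `B > 0`:
the outgoing edge `i` has capacity `ν i`, receives the inflow rate `x i` and has the waiting time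
`p i`, and without waiting the sink is reached through `i` in time `α i + β i * θ`. The node label
`L` is the least total travel time, and only edges realizing it are used. The inflow rates are
constant near every time from the right and, with a possible jump, from the left. -/
structure NodeDistribution {ι : Type*} [Fintype ι] (a c B : ℝ) (ν α β : ι → ℝ)
    (x p : ι → ℝ → ℝ) (L : ℝ → ℝ) : Prop where
  B_pos : 0 < B
  ν_pos : ∀ i, 0 < ν i
  x_nonneg : ∀ i θ, a ≤ θ → θ < c → 0 ≤ x i θ
  p_nonneg : ∀ i θ, a ≤ θ → θ < c → 0 ≤ p i θ
  sum_eq : ∀ θ, a ≤ θ → θ < c → ∑ i, x i θ = B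
  right : ∀ θ, a ≤ θ → θ < c → ∀ i, ∀ᶠ y in 𝓝[≥] θ,
    x i y = x i θ ∧ p i y = max 0 (p i θ + (x i θ / ν i - 1) * (y - θ))
  left : ∀ θ, a < θ → θ < c → ∃ z, a ≤ z ∧ z < θ ∧ ∀ i y, z ≤ y → y ≤ θ →
    (y < θ → x i y = x i z) ∧ p i y = max 0 (p i z + (x i z / ν i - 1) * (y - z))
  label_le : ∀ i θ, a ≤ θ → θ < c → L θ ≤ α i + β i * θ + p i θ
  used : ∀ i θ, a ≤ θ → θ < c → 0 < x i θ → L θ = α i + β i * θ + p i θ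

namespace NodeDistribution

variable {ι : Type*} {a c B : ℝ} {ν α β : ι → ℝ} {x p : ι → ℝ → ℝ} {L : ℝ → ℝ}

/-- The right derivative of the waiting time of the edge `i`. -/
def waitRate (ν : ι → ℝ) (x p : ι → ℝ → ℝ) (i : ι) (θ : ℝ) : ℝ :=
  if 0 < p i θ then x i θ / ν i - 1 else max 0 (x i θ / ν i - 1)

open Classical in
/-- The right derivative of the node label, read off from a used edge. -/
def labelRate (ν β : ι → ℝ) (x p : ι → ℝ → ℝ) (θ : ℝ) : ℝ :=
  if h : ∃ i, 0 < x i θ then β h.choose + waitRate ν x p h.choose θ else 0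

theorem waitRate_ge (i : ι) (θ : ℝ) : x i θ / ν i - 1 ≤ waitRate ν x p i θ := by
  unfold waitRate
  split_ifs
  · exact le_rfl
  · exact le_max_right _ _

variable [Fintype ι]

theorem exists_used (D : NodeDistribution a c B ν α β x p L) {θ : ℝ} (h1 : a ≤ θ) (h2 : θ < c) :
    ∃ i, 0 < x i θ := by
  by_contra! hcon
  have := D.sum_eq θ h1 h2
  have h3 : ∑ i, x i θ ≤ 0 := Finset.sum_nonpos fun i _ => hcon i
  linarith [D.B_pos]

theorem wait_right (D : NodeDistribution a c B ν α β x p L) {θ : ℝ} (h1 : a ≤ θ) (h2 : θ < c)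
    (i : ι) : ∀ᶠ y in 𝓝[≥] θ, p i y = p i θ + waitRate ν x p i θ * (y - θ) ∧
      waitRate ν x p i y = waitRate ν x p i θ := by
  set k := x i θ / ν i - 1 with hk
  rcases (D.p_nonneg i θ h1 h2).eq_or_lt with h0 | hpos
  · have hg : waitRate ν x p i θ = max 0 k := by simp [waitRate, ← h0, hk]
    filter_upwards [D.right θ h1 h2 i, self_mem_nhdsWithin] with y hy hθy
    have hθy' : 0 ≤ y - θ := sub_nonneg.mpr hθy
    have hpy : p i y = max 0 (k * (y - θ)) := by rw [hy.2, ← h0, zero_add]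
    rw [hg]
    refine ⟨?_, ?_⟩
    · rw [hpy, ← h0, zero_add, max_mul_of_nonneg _ _ hθy', zero_mul]
    · unfold waitRate
      rw [hy.1, ← hk]
      split_ifs with hp
      · refine (max_eq_right ?_).symm
        by_contra! hneg
        rw [hpy] at hp
        have : k * (y - θ) ≤ 0 := mul_nonpos_of_nonpos_of_nonneg hneg.le hθy'
        simp [this] at hp
      · rfl
  · have hg : waitRate ν x p i θ = k := by simp [waitRate, hpos, hk]
    have hcont : Tendsto (fun y => p i θ + k * (y - θ)) (𝓝[≥] θ) (𝓝 (p i θ)) := by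
      have : Continuous fun y => p i θ + k * (y - θ) := by fun_prop
      simpa using (this.tendsto θ).mono_left (nhdsWithin_le_nhds (s := Set.Ici θ))
    filter_upwards [D.right θ h1 h2 i, hcont.eventually (Ioi_mem_nhds hpos)] with y hy hy'
    have hpy : p i y = p i θ + k * (y - θ) := by rw [hy.2]; exact max_eq_right (le_of_lt hy')
    refine ⟨by rw [hpy, hg], ?_⟩
    rw [hg]
    unfold waitRate
    rw [hpy, if_pos hy', hy.1]

theorem labelRate_eq (D : NodeDistribution a c B ν α β x p L) {θ : ℝ} (h1 : a ≤ θ) (h2 : θ < c)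
    {i : ι} (hi : 0 < x i θ) : labelRate ν β x p θ = β i + waitRate ν x p i θ := by
  have h : ∃ i, 0 < x i θ := ⟨i, hi⟩
  rw [labelRate, dif_pos h]
  set j := h.choose
  have hj : 0 < x j θ := h.choose_spec
  have key : ∀ᶠ y in 𝓝[≥] θ, (β j + waitRate ν x p j θ) * (y - θ) =
      (β i + waitRate ν x p i θ) * (y - θ) := by
    filter_upwards [D.wait_right h1 h2 i, D.wait_right h1 h2 j, D.right θ h1 h2 i,
      D.right θ h1 h2 j, eventually_lt_nhdsGE h2] with y e1 e2 e3 e4 e5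
    have e6 := D.used i y (h1.trans e5.1) e5.2 (by rwa [e3.1])
    have e7 := D.used j y (h1.trans e5.1) e5.2 (by rwa [e4.1])
    have e8 := D.used i θ h1 h2 hi
    have e9 := D.used j θ h1 h2 hj
    rw [e1.1] at e6
    rw [e2.1] at e7
    linarith
  obtain ⟨y, hy, hθy⟩ := ((eventually_nhdsGT_of_nhdsGE key).and
    self_mem_nhdsWithin).exists
  exact mul_right_cancel₀ (sub_ne_zero.mpr (ne_of_gt hθy)) hy

/-- To the right of a time the node label is affine; its slope is constant there. -/
theorem label_right (D : NodeDistribution a c B ν α β x p L) {θ : ℝ} (h1 : a ≤ θ) (h2 : θ < c) :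
    ∀ᶠ y in 𝓝[≥] θ, L y = L θ + labelRate ν β x p θ * (y - θ) ∧
      labelRate ν β x p y = labelRate ν β x p θ := by
  obtain ⟨i, hi⟩ := D.exists_used h1 h2
  filter_upwards [D.wait_right h1 h2 i, D.right θ h1 h2 i, eventually_lt_nhdsGE h2]
    with y e1 e2 e3
  have hiy : 0 < x i y := by rwa [e2.1]
  have e4 := D.used i y (h1.trans e3.1) e3.2 hiy
  have e5 := D.used i θ h1 h2 hi
  refine ⟨?_, ?_⟩
  · rw [e4, e5, e1.1, D.labelRate_eq h1 h2 hi]; ring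
  · rw [D.labelRate_eq h1 h2 hi, D.labelRate_eq (h1.trans e3.1) e3.2 hiy, e1.2]

theorem labelRate_le (D : NodeDistribution a c B ν α β x p L) {θ : ℝ} (h1 : a ≤ θ) (h2 : θ < c)
    {i : ι} (hi : L θ = α i + β i * θ + p i θ) :
    labelRate ν β x p θ ≤ β i + waitRate ν x p i θ := by
  have key : ∀ᶠ y in 𝓝[≥] θ, labelRate ν β x p θ * (y - θ) ≤
      (β i + waitRate ν x p i θ) * (y - θ) := by
    filter_upwards [D.wait_right h1 h2 i, D.label_right h1 h2, eventually_lt_nhdsGE h2]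
      with y e1 e2 e3
    have e4 := D.label_le i y (h1.trans e3.1) e3.2
    rw [e1.1, e2.1] at e4
    linarith
  obtain ⟨y, hy, hθy⟩ := ((eventually_nhdsGT_of_nhdsGE key).and
    self_mem_nhdsWithin).exists
  exact le_of_mul_le_mul_right hy (sub_pos.mpr hθy)

/-- To the left of a time the inflow rates and the slopes of the waiting times are constant, and the
waiting times are left-continuous. -/
theorem wait_left (D : NodeDistribution a c B ν α β x p L) {θ : ℝ} (h1 : a < θ) (h2 : θ < c)
    (i : ι) : ∃ ξ γ : ℝ, ∀ᶠ y in 𝓝[<] θ, x i y = ξ ∧ waitRate ν x p i y = γ ∧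
      p i θ = p i y + γ * (θ - y) := by
  obtain ⟨z, haz, hzθ, hz⟩ := D.left θ h1 h2
  set k := x i z / ν i - 1 with hk
  have hp : ∀ y, z ≤ y → y ≤ θ → p i y = max 0 (p i z + k * (y - z)) := fun y e1 e2 =>
    (hz i y e1 e2).2
  have hx : ∀ y, z ≤ y → y < θ → x i y = x i z := fun y e1 e2 => (hz i y e1 e2.le).1 e2
  have hrate : ∀ y, z ≤ y → y < θ → waitRate ν x p i y = if 0 < p i y then k else max 0 k := by
    intro y e1 e2
    rw [waitRate, hx y e1 e2]
  have hpz := D.p_nonneg i z haz (hzθ.trans h2)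
  have hcont : Tendsto (fun y => p i z + k * (y - z)) (𝓝[<] θ) (𝓝 (p i z + k * (θ - z))) := by
    have : Continuous fun y => p i z + k * (y - z) := by fun_prop
    exact (this.tendsto θ).mono_left nhdsWithin_le_nhds
  have hpθ := hp θ hzθ.le le_rfl
  rcases lt_trichotomy (p i z + k * (θ - z)) 0 with h | h | h
  · refine ⟨x i z, 0, ?_⟩
    have hk0 : k < 0 := by
      by_contra! hk0
      linarith [mul_nonneg hk0 (sub_nonneg.mpr hzθ.le)]
    filter_upwards [eventually_ge_nhdsLT hzθ, hcont.eventually (Iio_mem_nhds h)] with y e1 e2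
    have hpy : p i y = 0 := by rw [hp y e1.1 e1.2.le]; exact max_eq_left (le_of_lt e2)
    refine ⟨hx y e1.1 e1.2, ?_, ?_⟩
    · rw [hrate y e1.1 e1.2, hpy, if_neg (lt_irrefl _), max_eq_left hk0.le]
    · rw [hpy, hpθ, max_eq_left h.le]; ring
  · refine ⟨x i z, k, ?_⟩
    rcases lt_or_ge k 0 with hk0 | hk0
    · filter_upwards [eventually_ge_nhdsLT hzθ] with y e1
      have h3 : 0 < p i z + k * (y - z) := by
        nlinarith [mul_pos (neg_pos.mpr hk0) (sub_pos.mpr e1.2)]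
      have hpy : p i y = p i z + k * (y - z) := by rw [hp y e1.1 e1.2.le]; exact max_eq_right h3.le
      refine ⟨hx y e1.1 e1.2, ?_, ?_⟩
      · rw [hrate y e1.1 e1.2, hpy, if_pos h3]
      · rw [hpy, hpθ, h, max_self]; linarith
    · have h3 : k * (θ - z) = 0 := by
        linarith [mul_nonneg hk0 (sub_nonneg.mpr hzθ.le)]
      have h4 : k = 0 := (mul_eq_zero.mp h3).resolve_right (sub_ne_zero.mpr hzθ.ne')
      have h5 : p i z = 0 := by rw [h4] at h; linarith
      filter_upwards [eventually_ge_nhdsLT hzθ] with y e1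
      have hpy : p i y = 0 := by rw [hp y e1.1 e1.2.le, h4, h5]; simp
      refine ⟨hx y e1.1 e1.2, ?_, ?_⟩
      · rw [hrate y e1.1 e1.2, hpy, if_neg (lt_irrefl _), h4, max_self]
      · rw [hpy, hpθ, h4, h5]; simp
  · refine ⟨x i z, k, ?_⟩
    filter_upwards [eventually_ge_nhdsLT hzθ, hcont.eventually (Ioi_mem_nhds h)] with y e1 e2
    have e2' : 0 < p i z + k * (y - z) := e2
    have hpy : p i y = p i z + k * (y - z) := by rw [hp y e1.1 e1.2.le]; exact max_eq_right e2'.le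
    refine ⟨hx y e1.1 e1.2, ?_, ?_⟩
    · rw [hrate y e1.1 e1.2, hpy, if_pos e2']
    · rw [hpy, hpθ, max_eq_right h.le]; ring

theorem tendsto_wait_left (D : NodeDistribution a c B ν α β x p L) {θ : ℝ} (h1 : a < θ)
    (h2 : θ < c) (i : ι) :
    Tendsto (fun y => α i + β i * y + p i y) (𝓝[<] θ) (𝓝 (α i + β i * θ + p i θ)) := by
  obtain ⟨ξ, γ, h⟩ := D.wait_left h1 h2 i
  have : Continuous fun y => α i + β i * y + (p i θ - γ * (θ - y)) := by fun_prop
  have h3 := (this.tendsto θ).mono_left (nhdsWithin_le_nhds (s := Set.Iio θ))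
  simp only [sub_self, mul_zero, sub_zero] at h3
  refine h3.congr' ?_
  filter_upwards [h] with y hy
  rw [hy.2.2]; ring

/-- By left-continuity, an edge that is active at times arbitrarily close before `θ` is active at
`θ`. -/
theorem label_eq_of_left (D : NodeDistribution a c B ν α β x p L) {θ : ℝ} (h1 : a < θ)
    (h2 : θ < c) {i : ι} (h : ∃ᶠ y in 𝓝[<] θ, L y = α i + β i * y + p i y) :
    L θ = α i + β i * θ + p i θ := by
  obtain ⟨j, hj⟩ := D.exists_used h1.le h2
  rw [D.used j θ h1.le h2 hj]
  refine le_antisymm ((D.used j θ h1.le h2 hj) ▸ D.label_le i θ h1.le h2) ?_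
  refine le_of_tendsto_of_tendsto_of_frequently (D.tendsto_wait_left h1 h2 i)
    (D.tendsto_wait_left h1 h2 j) ?_
  refine (h.and_eventually (eventually_ge_nhdsLT h1)).mono fun y hy => ?_
  exact hy.1 ▸ D.label_le j y hy.2.1 (hy.2.2.trans h2)

theorem label_left (D : NodeDistribution a c B ν α β x p L) {θ : ℝ} (h1 : a < θ) (h2 : θ < c) :
    ∃ m : ℝ, ∀ᶠ y in 𝓝[<] θ, labelRate ν β x p y = m ∧ L θ = L y + m * (θ - y) := by
  choose ξ γ h using D.wait_left h1 h2
  have hall := Filter.eventually_all.mpr h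
  obtain ⟨y₀, hy₀, hay₀, hy₀θ⟩ := (hall.and (eventually_ge_nhdsLT h1)).exists
  obtain ⟨i, hi⟩ := D.exists_used hay₀ (hy₀θ.trans h2)
  rw [(hy₀ i).1] at hi
  have hLθ : L θ = α i + β i * θ + p i θ := by
    refine D.label_eq_of_left h1 h2 (Eventually.frequently ?_)
    filter_upwards [hall, eventually_ge_nhdsLT h1] with y e1 e2
    exact D.used i y e2.1 (e2.2.trans h2) (by rw [(e1 i).1]; exact hi)
  refine ⟨β i + γ i, ?_⟩
  filter_upwards [hall, eventually_ge_nhdsLT h1] with y e1 e2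
  have hxy : 0 < x i y := by rw [(e1 i).1]; exact hi
  refine ⟨by rw [D.labelRate_eq e2.1 (e2.2.trans h2) hxy, (e1 i).2.1], ?_⟩
  rw [hLθ, D.used i y e2.1 (e2.2.trans h2) hxy, (e1 i).2.2]; ring

/-- At the time `θ` the queue of the active edge `i` has just run empty, and this allows the slope
of the node label to jump up, but not beyond the slope `β i`. -/
def DepletionJump (a c : ℝ) (ν α β : ι → ℝ) (x p : ι → ℝ → ℝ) (L : ℝ → ℝ) (i : ι) (θ : ℝ) :
    Prop :=
  a < θ ∧ θ < c ∧ L θ = α i + β i * θ ∧ labelRate ν β x p θ ≤ β i ∧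
    ∀ᶠ y in 𝓝[<] θ, labelRate ν β x p y < β i

/-- The slope of the node label increases only where a queue runs empty: if no used edge changes
its behaviour, a larger slope would require larger inflow rates on all used edges, contradicting
that their sum is constant. -/
theorem labelRate_jump (D : NodeDistribution a c B ν α β x p L) {θ : ℝ} (h1 : a < θ)
    (h2 : θ < c) : (∀ᶠ y in 𝓝[<] θ, labelRate ν β x p θ ≤ labelRate ν β x p y) ∨
      ∃ i, DepletionJump a c ν α β x p L i θ := by
  obtain ⟨m, hm⟩ := D.label_left h1 h2
  rcases le_or_gt (labelRate ν β x p θ) m with hle | hgt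
  · left
    filter_upwards [hm] with y hy
    rwa [hy.1]
  right
  choose ξ γ h using D.wait_left h1 h2
  have hall := Filter.eventually_all.mpr h
  have hnear := (hall.and (eventually_ge_nhdsLT h1)).and hm
  obtain ⟨y₀, ⟨hy₀, hay₀, hy₀θ⟩, hmy₀⟩ := hnear.exists
  -- Not all edges used before `θ` can receive more from `θ` on, since the sum stays the same.
  obtain ⟨i, hi, hxi⟩ : ∃ i, 0 < ξ i ∧ x i θ ≤ ξ i := by
    by_contra! hcon
    have hs1 := D.sum_eq θ h1.le h2
    have hs2 := D.sum_eq y₀ hay₀ (hy₀θ.trans h2)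
    obtain ⟨j, hj⟩ := D.exists_used hay₀ (hy₀θ.trans h2)
    rw [(hy₀ j).1] at hj
    have : ∑ i, x i y₀ < ∑ i, x i θ := by
      refine Finset.sum_lt_sum (fun i _ => ?_) ⟨j, Finset.mem_univ _, ?_⟩
      · rw [(hy₀ i).1]
        rcases le_or_gt (ξ i) 0 with h0 | h0
        · exact h0.trans (D.x_nonneg i θ h1.le h2)
        · exact (hcon i h0).le
      · rw [(hy₀ j).1]; exact hcon j hj
    linarith
  have hact : L θ = α i + β i * θ + p i θ := by
    refine D.label_eq_of_left h1 h2 (Eventually.frequently ?_)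
    filter_upwards [hall, eventually_ge_nhdsLT h1] with y e1 e2
    exact D.used i y e2.1 (e2.2.trans h2) (by rw [(e1 i).1]; exact hi)
  have hmi : m = β i + γ i := by
    rw [← hmy₀.1, ← (hy₀ i).2.1]
    exact D.labelRate_eq hay₀ (hy₀θ.trans h2) (by rw [(hy₀ i).1]; exact hi)
  have hγ : ξ i / ν i - 1 ≤ γ i := by
    rw [← (hy₀ i).2.1, ← (hy₀ i).1]; exact waitRate_ge i y₀
  have hrate := D.labelRate_le h1.le h2 hact
  have hxν : x i θ / ν i ≤ ξ i / ν i := div_le_div_of_nonneg_right hxi (D.ν_pos i).le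
  have hp0 : ¬ 0 < p i θ := by
    intro hp
    rw [waitRate, if_pos hp] at hrate
    linarith
  have hg0 : waitRate ν x p i θ = 0 := by
    rw [waitRate, if_neg hp0] at hrate ⊢
    rcases le_total (x i θ / ν i - 1) 0 with h0 | h0
    · exact max_eq_left h0
    · rw [max_eq_right h0] at hrate
      linarith
  have hpz : p i θ = 0 := le_antisymm (not_lt.mp hp0) (D.p_nonneg i θ h1.le h2)
  refine ⟨i, h1, h2, by rw [hact, hpz, add_zero], by linarith, ?_⟩
  filter_upwards [hm] with y hy
  rw [hy.1]; linarith

/-- If the slope of the node label stays at most `k`, the label stays below a line of slope `k`. -/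
theorem label_le_line (D : NodeDistribution a c B ν α β x p L) {θ₁ k d : ℝ} (h1 : a ≤ θ₁)
    (hL : L θ₁ ≤ d + k * θ₁) (hk : ∀ θ, θ₁ ≤ θ → θ < c → labelRate ν β x p θ ≤ k) :
    ∀ θ, θ₁ ≤ θ → θ < c → L θ ≤ d + k * θ := by
  refine Ico_induction hL ?_ ?_
  · intro z hz1 hz2 hz
    filter_upwards [eventually_nhdsGT_of_nhdsGE (D.label_right (h1.trans hz1) hz2),
      self_mem_nhdsWithin] with y e1 e2
    have e3 := mul_le_mul_of_nonneg_right (hk z hz1 hz2) (sub_pos.mpr e2).le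
    rw [e1.1]
    linarith
  · intro z hz1 hz2 ih
    obtain ⟨m, hm⟩ := D.label_left (h1.trans_lt hz1) hz2
    obtain ⟨y, e1, e2⟩ := (hm.and (eventually_ge_nhdsLT hz1)).exists
    have e3 := ih y e2.1 e2.2
    have e4 := mul_le_mul_of_nonneg_right (e1.1 ▸ hk y e2.1 (e2.2.trans hz2))
      (sub_pos.mpr e2.2).le
    rw [e1.2]
    linarith

/-- Upward jumps of the slope of the node label do not accumulate. Among the edges whose jumps
would, take one with the largest slope `β i`: from some time on the slope of the label is at most
`β i`, so that the label cannot come back to the line of the edge `i` from above. -/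
theorem eventually_no_jump (D : NodeDistribution a c B ν α β x p L) (hac : a < c) :
    ∀ᶠ z in 𝓝[<] c, ∀ i θ, z < θ → ¬ DepletionJump a c ν α β x p L i θ := by
  classical
  by_contra hcon
  set good : ι → Prop := fun i => ∀ᶠ z in 𝓝[<] c, ∀ θ, z < θ →
    ¬ DepletionJump a c ν α β x p L i θ with hgood
  have hex : ∃ i, ¬ good i := by
    by_contra! hall
    exact hcon (Filter.eventually_all.mpr hall)
  obtain ⟨i₀, hi₀⟩ := hex
  obtain ⟨i, hi, hmax⟩ := (Finset.univ.filter fun i => ¬ good i).exists_max_image β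
    ⟨i₀, by simpa using hi₀⟩
  replace hi : ¬ good i := by simpa using hi
  have hlater : ∀ᶠ z in 𝓝[<] c, ∀ j, β i < β j → ∀ θ, z < θ →
      ¬ DepletionJump a c ν α β x p L j θ := by
    refine Filter.eventually_all.mpr fun j => ?_
    by_cases hj : good j
    · filter_upwards [hj] with z hz _ using hz
    · exact Eventually.of_forall fun z hlt =>
        absurd (hmax j (by simpa using hj)) (not_le.mpr hlt)
  obtain ⟨z, ⟨hz, hza⟩, hzi⟩ := ((hlater.and (eventually_ge_nhdsLT hac)).and_frequently
    (Filter.not_eventually.mp hi)).exists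
  push Not at hzi
  obtain ⟨θ₁, hzθ₁, hj₁⟩ := hzi
  -- After `θ₁` all jumps of the slope end at most at `β j ≤ β i`.
  have hrate : ∀ θ, θ₁ ≤ θ → θ < c → labelRate ν β x p θ ≤ β i := by
    refine Ico_induction hj₁.2.2.2.1 ?_ ?_
    · intro w hw1 hw2 hw
      filter_upwards [eventually_nhdsGT_of_nhdsGE
        (D.label_right (hj₁.1.le.trans hw1) hw2)] with y e1
      rwa [e1.2]
    · intro w hw1 hw2 ih
      rcases D.labelRate_jump (hj₁.1.trans hw1) hw2 with h | ⟨j, hj⟩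
      · obtain ⟨y, e1, e2⟩ := (h.and (eventually_ge_nhdsLT hw1)).exists
        exact e1.trans (ih y e2.1 e2.2)
      · refine hj.2.2.2.1.trans ?_
        by_contra! hlt
        exact hz j hlt w (hzθ₁.trans hw1) hj
  have hline := D.label_le_line hj₁.1.le hj₁.2.2.1.le hrate
  have hfreq := Filter.not_eventually.mp hi
  obtain ⟨w, hw, hw1, -⟩ := (hfreq.and_eventually (eventually_ge_nhdsLT hj₁.2.1)).exists
  push Not at hw
  obtain ⟨θ₂, hwθ₂, hj₂⟩ := hw
  have hlt : θ₁ < θ₂ := hw1.trans_lt hwθ₂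
  -- At the second jump `θ₂` of the edge `i` the label is on the line of `i` again, but shortly
  -- before it was on or below this line and grew with a slope less than `β i`.
  obtain ⟨m, hm⟩ := D.label_left hj₂.1 hj₂.2.1
  obtain ⟨y, ⟨e1, e2⟩, e3⟩ := ((hm.and hj₂.2.2.2.2).and (eventually_ge_nhdsLT hlt)).exists
  have e4 := hline y e3.1 (e3.2.trans hj₂.2.1)
  have e5 := mul_lt_mul_of_pos_right (e1.1 ▸ e2) (sub_pos.mpr e3.2)
  have e6 := hj₂.2.2.1
  rw [e1.2] at e6
  linarith

/-- Without upward jumps the slope of the node label is antitone. -/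
theorem labelRate_antitone (D : NodeDistribution a c B ν α β x p L) {z : ℝ} (haz : a ≤ z)
    (hz : ∀ i θ, z < θ → ¬ DepletionJump a c ν α β x p L i θ) {θ₁ : ℝ} (h1 : z ≤ θ₁) :
    ∀ θ, θ₁ ≤ θ → θ < c → labelRate ν β x p θ ≤ labelRate ν β x p θ₁ := by
  refine Ico_induction le_rfl ?_ ?_
  · intro w hw1 hw2 hw
    filter_upwards [eventually_nhdsGT_of_nhdsGE
      (D.label_right (haz.trans (h1.trans hw1)) hw2)] with y e1
    rwa [e1.2]
  · intro w hw1 hw2 ih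
    rcases D.labelRate_jump ((haz.trans h1).trans_lt hw1) hw2 with h | ⟨j, hj⟩
    · obtain ⟨y, e1, e2⟩ := (h.and (eventually_ge_nhdsLT hw1)).exists
      exact e1.trans (ih y e2.1 e2.2)
    · exact absurd hj (hz j w (h1.trans_lt hw1))

/-- Once the slope of the node label is antitone, every edge is eventually always active or
eventually never active: an edge that has become inactive has a larger slope, and its slope does
not decrease as long as it is inactive. -/
theorem eventually_active_or_inactive (D : NodeDistribution a c B ν α β x p L) {z : ℝ}
    (haz : a ≤ z) (hzc : z < c)
    (hz : ∀ i θ, z < θ → ¬ DepletionJump a c ν α β x p L i θ) (i : ι) :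
    (∀ᶠ w in 𝓝[<] c, ∀ θ, w ≤ θ → θ < c → L θ = α i + β i * θ + p i θ) ∨
      ∀ᶠ w in 𝓝[<] c, ∀ θ, w ≤ θ → θ < c → L θ < α i + β i * θ + p i θ := by
  have hmono := fun {θ₁ : ℝ} h => D.labelRate_antitone haz hz (θ₁ := θ₁) h
  by_cases hA : ∃ θ₁, z ≤ θ₁ ∧ θ₁ < c ∧ L θ₁ < α i + β i * θ₁ + p i θ₁ ∧
      labelRate ν β x p θ₁ ≤ β i + waitRate ν x p i θ₁
  · right
    obtain ⟨θ₁, h1, h2, h3⟩ := hA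
    have key : ∀ θ, θ₁ ≤ θ → θ < c → (L θ < α i + β i * θ + p i θ ∧
        labelRate ν β x p θ ≤ β i + waitRate ν x p i θ) := by
      refine Ico_induction h3 ?_ ?_
      · intro w hw1 hw2 hw
        have haw := haz.trans (h1.trans hw1)
        filter_upwards [eventually_nhdsGT_of_nhdsGE (D.label_right haw hw2),
          eventually_nhdsGT_of_nhdsGE (D.wait_right haw hw2 i),
          self_mem_nhdsWithin] with y e1 e2 e3
        rw [e1.2, e2.2]
        refine ⟨?_, hw.2⟩
        have e4 := mul_le_mul_of_nonneg_right hw.2 (sub_pos.mpr e3).le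
        rw [e1.1, e2.1]
        linarith [hw.1]
      · intro w hw1 hw2 ih
        have haw := (haz.trans h1).trans_lt hw1
        obtain ⟨m, hm⟩ := D.label_left haw hw2
        obtain ⟨ξ, γ, hγ⟩ := D.wait_left haw hw2 i
        obtain ⟨y, ⟨e1, e2⟩, e3⟩ := ((hm.and hγ).and (eventually_ge_nhdsLT hw1)).exists
        have hy := ih y e3.1 e3.2
        have hay : a ≤ y := haz.trans (h1.trans e3.1)
        have hin : L w < α i + β i * w + p i w := by
          have h5 := hy.2
          rw [e1.1, e2.2.1] at h5
          have e4 := mul_le_mul_of_nonneg_right h5 (sub_pos.mpr e3.2).le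
          rw [e1.2, e2.2.2]
          linarith [hy.1]
        refine ⟨hin, ?_⟩
        have hx0 : x i w = 0 := by
          by_contra hne
          exact hin.ne (D.used i w haw.le hw2
            (lt_of_le_of_ne (D.x_nonneg i w haw.le hw2) (Ne.symm hne)))
        have hxy0 : x i y = 0 := by
          by_contra hne
          exact hy.1.ne (D.used i y hay (e3.2.trans hw2)
            (lt_of_le_of_ne (D.x_nonneg i y hay (e3.2.trans hw2)) (Ne.symm hne)))
        have hle : waitRate ν x p i y ≤ waitRate ν x p i w := by
          simp only [waitRate, hx0, hxy0, zero_div, zero_sub]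
          by_cases hpw : 0 < p i w
          · have hpy : 0 < p i y := by
              by_contra hpy
              have h6 := e2.2.1
              simp only [waitRate, if_neg hpy, hxy0, zero_div, zero_sub] at h6
              have h7 := e2.2.2
              rw [← h6] at h7
              norm_num at h7
              linarith
            rw [if_pos hpw, if_pos hpy]
          · rw [if_neg hpw]
            split_ifs <;> norm_num
        linarith [hy.2, hmono (h1.trans e3.1) w e3.2.le hw2]
    filter_upwards [eventually_ge_nhdsLT h2] with w hw θ hθ1 hθ2
    exact (key θ (hw.1.trans hθ1) hθ2).1
  · push Not at hA
    by_cases hB : ∃ θ₀, z ≤ θ₀ ∧ θ₀ < c ∧ L θ₀ = α i + β i * θ₀ + p i θ₀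
    · left
      obtain ⟨θ₀, h1, h2, h3⟩ := hB
      have key : ∀ θ, θ₀ ≤ θ → θ < c → L θ = α i + β i * θ + p i θ := by
        refine Ico_induction h3 ?_ ?_
        · intro w hw1 hw2 hw
          have hzw := h1.trans hw1
          have haw := haz.trans hzw
          filter_upwards [eventually_nhdsGT_of_nhdsGE (D.label_right haw hw2),
            eventually_nhdsGT_of_nhdsGE (D.wait_right haw hw2 i),
            Ioo_mem_nhdsGT hw2] with y e1 e2 e3
          by_contra hne
          have h4 := hA y (hzw.trans e3.1.le) e3.2
            (lt_of_le_of_ne (D.label_le i y (haw.trans e3.1.le) e3.2) hne)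
          rw [e1.2, e2.2] at h4
          linarith [D.labelRate_le haw hw2 hw]
        · intro w hw1 hw2 ih
          refine D.label_eq_of_left ((haz.trans h1).trans_lt hw1) hw2 (Eventually.frequently ?_)
          filter_upwards [eventually_ge_nhdsLT hw1] with y hy using ih y hy.1 hy.2
      filter_upwards [eventually_ge_nhdsLT h2] with w hw θ hθ1 hθ2
      exact key θ (hw.1.trans hθ1) hθ2
    · right
      push Not at hB
      filter_upwards [eventually_ge_nhdsLT hzc] with w hw θ hθ1 hθ2
      exact lt_of_le_of_ne (D.label_le i θ (haz.trans (hw.1.trans hθ1)) hθ2)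
        (hB θ (hw.1.trans hθ1) hθ2)

/-- The waiting time on an edge that stays active is the label minus an affine function, hence
concave once the slope of the label is antitone; so it is eventually zero or eventually
positive. -/
theorem eventually_queue_empty_or_pos (D : NodeDistribution a c B ν α β x p L) {z : ℝ}
    (haz : a ≤ z) (hzc : z < c)
    (hz : ∀ i θ, z < θ → ¬ DepletionJump a c ν α β x p L i θ) {i : ι}
    (hact : ∀ θ, z ≤ θ → θ < c → L θ = α i + β i * θ + p i θ) :
    (∀ᶠ w in 𝓝[<] c, ∀ θ, w ≤ θ → θ < c → p i θ = 0) ∨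
      ∀ᶠ w in 𝓝[<] c, ∀ θ, w ≤ θ → θ < c → 0 < p i θ := by
  have hmono := fun {θ₁ : ℝ} h => D.labelRate_antitone haz hz (θ₁ := θ₁) h
  by_cases hA : ∃ θ₁, z ≤ θ₁ ∧ θ₁ < c ∧ p i θ₁ = 0 ∧ labelRate ν β x p θ₁ ≤ β i
  · left
    obtain ⟨θ₁, h1, h2, h3, h4⟩ := hA
    have hline := D.label_le_line (haz.trans h1) (d := α i) (k := β i)
      (by rw [hact θ₁ h1 h2, h3, add_zero]) fun θ e1 e2 => (hmono h1 θ e1 e2).trans h4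
    filter_upwards [eventually_ge_nhdsLT h2] with w hw θ hθ1 hθ2
    have h5 := hline θ (hw.1.trans hθ1) hθ2
    rw [hact θ (h1.trans (hw.1.trans hθ1)) hθ2] at h5
    exact le_antisymm (by linarith) (D.p_nonneg i θ (haz.trans (h1.trans (hw.1.trans hθ1))) hθ2)
  · push Not at hA
    by_cases hB : ∃ θ₀, z ≤ θ₀ ∧ θ₀ < c ∧ 0 < p i θ₀
    · right
      obtain ⟨θ₀, h1, h2, h3⟩ := hB
      have key : ∀ θ, θ₀ ≤ θ → θ < c → 0 < p i θ := by
        refine Ico_induction h3 ?_ ?_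
        · intro w hw1 hw2 hw
          have haw := haz.trans (h1.trans hw1)
          have : Continuous fun y => p i w + waitRate ν x p i w * (y - w) := by fun_prop
          have hc := ((this.tendsto w).mono_left (nhdsWithin_le_nhds (s := Set.Ioi w))).eventually
            (Ioi_mem_nhds (a := 0) (by simpa using hw))
          filter_upwards [eventually_nhdsGT_of_nhdsGE (D.wait_right haw hw2 i), hc]
            with y e1 e2
          rw [e1.1]; exact e2
        · intro w hw1 hw2 ih
          have hzw := h1.trans hw1.le
          have haw := (haz.trans h1).trans_lt hw1
          by_contra hp
          have hp0 : p i w = 0 := le_antisymm (not_lt.mp hp) (D.p_nonneg i w haw.le hw2)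
          have h4 := hA w hzw hw2 hp0
          obtain ⟨m, hm⟩ := D.label_left haw hw2
          obtain ⟨y, e1, e3⟩ := (hm.and (eventually_ge_nhdsLT hw1)).exists
          have h5 := ih y e3.1 e3.2
          have h6 := hact y (h1.trans e3.1) (e3.2.trans hw2)
          have h7 := hact w hzw hw2
          rw [e1.2, hp0, h6] at h7
          have h8 := hmono (h1.trans e3.1) w e3.2.le hw2
          rw [e1.1] at h8
          have h9 : β i * (w - y) < m * (w - y) :=
            mul_lt_mul_of_pos_right (by linarith) (sub_pos.mpr e3.2)
          linarith
      filter_upwards [eventually_ge_nhdsLT h2] with w hw θ hθ1 hθ2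
      exact key θ (hw.1.trans hθ1) hθ2
    · left
      push Not at hB
      filter_upwards [eventually_ge_nhdsLT hzc] with w hw θ hθ1 hθ2
      exact le_antisymm (hB θ (hw.1.trans hθ1) hθ2)
        (D.p_nonneg i θ (haz.trans (hw.1.trans hθ1)) hθ2)

theorem labelRate_eq_of_active (D : NodeDistribution a c B ν α β x p L) {z : ℝ}
    (haz : a ≤ z) {i : ι} (hact : ∀ θ, z ≤ θ → θ < c → L θ = α i + β i * θ + p i θ)
    {θ : ℝ} (h1 : z ≤ θ) (h2 : θ < c) : labelRate ν β x p θ = β i + waitRate ν x p i θ := by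
  have haθ := haz.trans h1
  obtain ⟨y, ⟨e1, e2⟩, e3⟩ := (((eventually_nhdsGT_of_nhdsGE
    (D.label_right haθ h2)).and (eventually_nhdsGT_of_nhdsGE
    (D.wait_right haθ h2 i))).and (Ioo_mem_nhdsGT h2)).exists
  have e4 := hact y (h1.trans e3.1.le) e3.2
  rw [e1.1, hact θ h1 h2, e2.1] at e4
  exact mul_right_cancel₀ (sub_ne_zero.mpr e3.1.ne') (by linarith)

/-- Before the end of the interval the process becomes stationary: every edge eventually receives a
constant inflow or has no queue, and an edge that is still used is always active. -/
theorem eventually_stationary (D : NodeDistribution a c B ν α β x p L) (hac : a < c) :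
    ∃ z, a ≤ z ∧ z < c ∧ ∀ i,
      ((∀ θ θ', z ≤ θ → θ < c → z ≤ θ' → θ' < c → x i θ = x i θ') ∨
        ∀ θ, z ≤ θ → θ < c → p i θ = 0) ∧
      ∀ θ, z ≤ θ → θ < c → 0 < x i θ → ∀ θ', z ≤ θ' → θ' < c →
        L θ' = α i + β i * θ' + p i θ' := by
  classical
  obtain ⟨z₁, hz₁, haz₁, hz₁c⟩ := ((D.eventually_no_jump hac).and (eventually_ge_nhdsLT hac)).exists
  have hstat : ∀ i, ∀ᶠ w in 𝓝[<] c,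
      (∀ θ, w ≤ θ → θ < c → L θ < α i + β i * θ + p i θ) ∨
      ((∀ θ, w ≤ θ → θ < c → L θ = α i + β i * θ + p i θ) ∧
        ((∀ θ, w ≤ θ → θ < c → p i θ = 0) ∨ ∀ θ, w ≤ θ → θ < c → 0 < p i θ)) := by
    intro i
    rcases D.eventually_active_or_inactive haz₁ hz₁c hz₁ i with h | h
    · obtain ⟨z₂, h2, hz₁₂, hz₂c⟩ := (h.and (eventually_ge_nhdsLT hz₁c)).exists
      rcases D.eventually_queue_empty_or_pos (haz₁.trans hz₁₂) hz₂c
        (fun j θ hθ => hz₁ j θ (hz₁₂.trans_lt hθ)) h2 with h' | h'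
      · filter_upwards [h, h'] with w e1 e2 using Or.inr ⟨e1, Or.inl e2⟩
      · filter_upwards [h, h'] with w e1 e2 using Or.inr ⟨e1, Or.inr e2⟩
    · filter_upwards [h] with w e1 using Or.inl e1
  obtain ⟨z, hz, haz, hzc⟩ := ((Filter.eventually_all.mpr hstat).and
    (eventually_ge_nhdsLT hac)).exists
  set A : Finset ι := Finset.univ.filter fun i =>
    ∀ θ, z ≤ θ → θ < c → L θ = α i + β i * θ + p i θ with hA
  have hAmem : ∀ i, i ∈ A ↔ ∀ θ, z ≤ θ → θ < c → L θ = α i + β i * θ + p i θ := by simp [hA]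
  have hused : ∀ i θ, z ≤ θ → θ < c → 0 < x i θ → i ∈ A := by
    intro i θ h1 h2 hx
    rcases hz i with h | h
    · exact absurd (D.used i θ (haz.trans h1) h2 hx) (h θ h1 h2).ne
    · exact (hAmem i).mpr h.1
  have hunused : ∀ i, i ∉ A → ∀ θ, z ≤ θ → θ < c → x i θ = 0 := by
    intro i hi θ h1 h2
    by_contra hne
    exact hi (hused i θ h1 h2 (lt_of_le_of_ne (D.x_nonneg i θ (haz.trans h1) h2) (Ne.symm hne)))
  have hpos : ∀ i ∈ A, ¬ (∀ θ, z ≤ θ → θ < c → p i θ = 0) → ∀ θ, z ≤ θ → θ < c →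
      x i θ = ν i * (1 + labelRate ν β x p θ - β i) := by
    intro i hi hne θ h1 h2
    have hact := (hAmem i).mp hi
    rcases hz i with h | h
    · exact absurd (hact θ h1 h2) (h θ h1 h2).ne
    · have h3 := h.2.resolve_left hne θ h1 h2
      have h4 := D.labelRate_eq_of_active haz hact h1 h2
      rw [waitRate, if_pos h3] at h4
      have := (D.ν_pos i).ne'
      rw [h4]
      field_simp
      ring
  -- The slope of the label is now constant: it is `β i` for an active edge `i` without queue, and
  -- otherwise it is determined by the total inflow.
  have hconst : ∃ s, ∀ θ, z ≤ θ → θ < c → labelRate ν β x p θ = s := by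
    by_cases hex : ∃ i ∈ A, ∀ θ, z ≤ θ → θ < c → p i θ = 0
    · obtain ⟨i, hi, hp⟩ := hex
      refine ⟨β i, fun θ h1 h2 => ?_⟩
      obtain ⟨y, e1, e2⟩ := ((eventually_nhdsGT_of_nhdsGE
        (D.wait_right (haz.trans h1) h2 i)).and (Ioo_mem_nhdsGT h2)).exists
      have e3 := e1.1
      rw [hp y (h1.trans e2.1.le) e2.2, hp θ h1 h2, zero_add, eq_comm, mul_eq_zero] at e3
      rw [D.labelRate_eq_of_active haz ((hAmem i).mp hi) h1 h2,
        e3.resolve_right (sub_ne_zero.mpr e2.1.ne'), add_zero]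
    · push Not at hex
      have hsum : ∀ θ, z ≤ θ → θ < c →
          (∑ i ∈ A, ν i) * labelRate ν β x p θ = B - ∑ i ∈ A, ν i * (1 - β i) := by
        intro θ h1 h2
        have h3 := D.sum_eq θ (haz.trans h1) h2
        rw [← Finset.sum_subset (Finset.subset_univ A)
          (fun i _ hi => hunused i hi θ h1 h2)] at h3
        rw [← h3, ← Finset.sum_sub_distrib, Finset.sum_mul]
        refine Finset.sum_congr rfl fun i hi => ?_
        rw [hpos i hi (by push Not; exact hex i hi) θ h1 h2]
        ring
      have hν : 0 < ∑ i ∈ A, ν i := by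
        obtain ⟨i, hi⟩ := D.exists_used haz hzc
        exact Finset.sum_pos (fun i _ => D.ν_pos i) ⟨i, hused i z le_rfl hzc hi⟩
      exact ⟨(B - ∑ i ∈ A, ν i * (1 - β i)) / ∑ i ∈ A, ν i, fun θ h1 h2 => by
        rw [← hsum θ h1 h2]; field_simp⟩
  obtain ⟨s, hs⟩ := hconst
  refine ⟨z, haz, hzc, fun i => ⟨?_, ?_⟩⟩
  · by_cases hi : i ∈ A
    · by_cases hp : ∀ θ, z ≤ θ → θ < c → p i θ = 0
      · exact Or.inr hp
      · left
        intro θ θ' h1 h2 h3 h4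
        rw [hpos i hi hp θ h1 h2, hpos i hi hp θ' h3 h4, hs θ h1 h2, hs θ' h3 h4]
    · left
      intro θ θ' h1 h2 h3 h4
      rw [hunused i hi θ h1 h2, hunused i hi θ' h3 h4]
  · intro θ h1 h2 hx
    exact (hAmem i).mp (hused i θ h1 h2 hx)

end NodeDistribution

/-! ### Instantaneous equilibrium distributions -/

/-- Existence of an instantaneous equilibrium distribution over the subfield `K`. The edge `i ∈ A`
has label slope `β i` plus the rate of change of its waiting time, which for the inflow rate `x i`
is `x i / ν i - 1`, truncated at `0` if there is no queue (`¬ Q i`). The inflow `B` can be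
distributed so that the used edges have the least slope. At the common slope `s` the edge `i`
receives nothing if `s < κ i`, where `κ i` is its slope without inflow, and
`ν i * (1 + s - β i)` if `κ i < s`. So `s` is either one of the values `κ i` or the solution of a
linear equation over `K`. -/
theorem exists_equilibrium_distribution {K : Subfield ℝ} {ι : Type*} {A : Finset ι}
    (hA : A.Nonempty) {ν β : ι → ℝ} (Q : ι → Prop) {B : ℝ} (hν : ∀ i ∈ A, 0 < ν i)
    (hνK : ∀ i ∈ A, ν i ∈ K) (hβK : ∀ i ∈ A, β i ∈ K) (hB : 0 ≤ B) (hBK : B ∈ K) :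
    ∃ (x : ι → ℝ) (s : ℝ), (∀ i ∈ A, 0 ≤ x i ∧ x i ∈ K) ∧ ∑ i ∈ A, x i = B ∧
      ∀ i ∈ A, (s ≤ β i + x i / ν i - 1 ∨ ¬ Q i ∧ s ≤ β i) ∧
        (0 < x i → Q i ∧ s = β i + x i / ν i - 1 ∨ ¬ Q i ∧ s = β i + max 0 (x i / ν i - 1)) := by
  classical
  set κ : ι → ℝ := fun i => if Q i then β i - 1 else β i with hκ
  have hκK : ∀ i ∈ A, κ i ∈ K := by
    intro i hi
    simp only [hκ]
    split_ifs
    exacts [K.sub_mem (hβK i hi) K.one_mem, hβK i hi]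
  have hκge : ∀ i, β i - 1 ≤ κ i := by
    intro i; simp only [hκ]; split_ifs <;> linarith
  set D : ι → ℝ → ℝ := fun i s => ν i * (1 + s - β i) with hD
  have hD0 : ∀ i ∈ A, ∀ s, κ i ≤ s → 0 ≤ D i s := fun i hi s hs =>
    mul_nonneg (hν i hi).le (by linarith [hκge i])
  set m : ℝ → ℝ := fun s => ∑ i ∈ A with κ i < s, D i s with hm
  -- `m s` is the inflow the edges with `κ i < s` receive at the common slope `s`. Let `κ i₀` be the
  -- largest of the values `κ i` at which it does not exceed `B`.
  obtain ⟨j₀, hj₀, hmin⟩ := A.exists_min_image κ hA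
  have hm0 : m (κ j₀) = 0 := by
    simp only [hm]
    rw [Finset.filter_false_of_mem (fun i hi => not_lt.mpr (hmin i hi)), Finset.sum_empty]
  obtain ⟨i₀, hi₀, hmax⟩ := (A.filter fun i => m (κ i) ≤ B).exists_max_image κ
    ⟨j₀, by simp [hj₀, hm0, hB]⟩
  obtain ⟨hi₀A, hi₀B⟩ := Finset.mem_filter.mp hi₀
  -- An edge receiving `D i s` with `κ i < s` has slope `s`.
  have hslope : ∀ i ∈ A, ∀ s, κ i ≤ s → (κ i = s → Q i) →
      Q i ∧ s = β i + D i s / ν i - 1 ∨ ¬ Q i ∧ s = β i + max 0 (D i s / ν i - 1) := by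
    intro i hi s hs hQ
    have h1 : D i s / ν i = 1 + s - β i := mul_div_cancel_left₀ _ (hν i hi).ne'
    rw [h1]
    by_cases hQi : Q i
    · exact Or.inl ⟨hQi, by ring⟩
    · refine Or.inr ⟨hQi, ?_⟩
      have h2 : κ i = β i := by simp [hκ, hQi]
      rw [max_eq_right (by linarith)]
      ring
  by_cases hcase : B ≤ ∑ i ∈ A with κ i ≤ κ i₀, D i (κ i₀)
  · -- The slope is `κ i₀`; the edges with `κ i = κ i₀` receive the fraction `t` of their maximum.
    set s := κ i₀ with hs
    set lo : ι → ℝ := fun i => if κ i < s then D i s else 0 with hlo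
    set up : ι → ℝ := fun i => if κ i ≤ s then D i s else 0 with hup
    have hlosum : ∑ i ∈ A, lo i = m s := by simp only [hlo, hm, Finset.sum_filter]
    have hupsum : B ≤ ∑ i ∈ A, up i := by rwa [Finset.sum_filter] at hcase
    have hloup : ∀ i ∈ A, 0 ≤ lo i ∧ lo i ≤ up i := by
      intro i hi
      simp only [hlo, hup]
      by_cases h1 : κ i < s
      · simp [h1, h1.le, hD0 i hi s h1.le]
      · by_cases h2 : κ i ≤ s
        · simp [h1, h2, hD0 i hi s h2]
        · simp [h1, h2]
    have hDK : ∀ i ∈ A, D i s ∈ K := fun i hi =>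
      K.mul_mem (hνK i hi) (K.sub_mem (K.add_mem K.one_mem (hκK i₀ hi₀A)) (hβK i hi))
    have hloK : ∀ i ∈ A, lo i ∈ K := by
      intro i hi; simp only [hlo]; split_ifs
      exacts [hDK i hi, K.zero_mem]
    have hupK : ∀ i ∈ A, up i ∈ K := by
      intro i hi; simp only [hup]; split_ifs
      exacts [hDK i hi, K.zero_mem]
    set t : ℝ := (B - ∑ i ∈ A, lo i) / (∑ i ∈ A, up i - ∑ i ∈ A, lo i) with ht
    have htK : t ∈ K := K.div_mem (K.sub_mem hBK (K.sum_mem hloK))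
      (K.sub_mem (K.sum_mem hupK) (K.sum_mem hloK))
    have h1 : 0 ≤ B - ∑ i ∈ A, lo i := by rw [hlosum]; linarith
    have h2 : B - ∑ i ∈ A, lo i ≤ ∑ i ∈ A, up i - ∑ i ∈ A, lo i := by linarith
    have ht0 : 0 ≤ t := div_nonneg h1 (h1.trans h2)
    have ht1 : t ≤ 1 := div_le_one_of_le₀ h2 (h1.trans h2)
    have htmul : t * (∑ i ∈ A, up i - ∑ i ∈ A, lo i) = B - ∑ i ∈ A, lo i := by
      by_cases h0 : ∑ i ∈ A, up i - ∑ i ∈ A, lo i = 0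
      · rw [h0, mul_zero]; linarith
      · rw [ht]; field_simp
    refine ⟨fun i => lo i + t * (up i - lo i), s, fun i hi => ⟨?_, ?_⟩, ?_, fun i hi => ?_⟩
    · have := hloup i hi
      exact add_nonneg this.1 (mul_nonneg ht0 (by linarith))
    · exact K.add_mem (hloK i hi) (K.mul_mem htK (K.sub_mem (hupK i hi) (hloK i hi)))
    · rw [Finset.sum_add_distrib, ← Finset.mul_sum, Finset.sum_sub_distrib, htmul]; ring
    · rcases lt_trichotomy (κ i) s with h3 | h3 | h3
      · have hx : lo i + t * (up i - lo i) = D i s := by simp [hlo, hup, h3, h3.le]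
        simp only [hx]
        have h4 := hslope i hi s h3.le fun h => absurd h h3.ne
        refine ⟨?_, fun _ => h4⟩
        rcases h4 with h4 | h4
        · exact Or.inl h4.2.le
        · left
          rw [mul_div_cancel_left₀ _ (hν i hi).ne']
          linarith
      · have hx : lo i + t * (up i - lo i) = t * D i s := by simp [hlo, hup, h3]
        simp only [hx]
        by_cases hQi : Q i
        · have h5 : β i = 1 + s := by
            have : κ i = β i - 1 := by simp [hκ, hQi]
            linarith
          have h6 : D i s = 0 := by simp [hD, h5]
          rw [h6]
          refine ⟨Or.inl (by simp; linarith), fun h => absurd h (by simp)⟩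
        · have h5 : β i = s := by
            have : κ i = β i := by simp [hκ, hQi]
            linarith
          have h6 : D i s = ν i := by simp [hD, h5]
          refine ⟨Or.inr ⟨hQi, h5.ge⟩, fun _ => Or.inr ⟨hQi, ?_⟩⟩
          rw [h6, mul_div_cancel_right₀ _ (hν i hi).ne', max_eq_left (by linarith), h5, add_zero]
      · have hx : lo i + t * (up i - lo i) = 0 := by
          simp [hlo, hup, not_le.mpr h3, not_lt.mpr h3.le]
        simp only [hx]
        refine ⟨?_, fun h => absurd h (lt_irrefl _)⟩
        by_cases hQi : Q i
        · have : κ i = β i - 1 := by simp [hκ, hQi]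
          left; simp; linarith
        · have : κ i = β i := by simp [hκ, hQi]
          exact Or.inr ⟨hQi, by linarith⟩
  · -- The slope lies beyond `κ i₀`, but not beyond the next of the values `κ i`; the edges in `A'`
    -- share the inflow.
    push Not at hcase
    set A' := A.filter fun i => κ i ≤ κ i₀ with hA'
    have hA'A : A' ⊆ A := Finset.filter_subset _ _
    have hi₀A' : i₀ ∈ A' := by simp [hA', hi₀A]
    set N := ∑ i ∈ A', ν i with hN
    have hNpos : 0 < N := Finset.sum_pos (fun i hi => hν i (hA'A hi)) ⟨i₀, hi₀A'⟩
    have hDsum : ∀ s, ∑ i ∈ A', D i s = N * s + ∑ i ∈ A', ν i * (1 - β i) := by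
      intro s
      rw [hN, Finset.sum_mul, ← Finset.sum_add_distrib]
      exact Finset.sum_congr rfl fun i _ => by simp only [hD]; ring
    set s := (B - ∑ i ∈ A', ν i * (1 - β i)) / N with hs
    have hsB : ∑ i ∈ A', D i s = B := by rw [hDsum, hs]; field_simp; ring
    have hsK : s ∈ K := K.div_mem (K.sub_mem hBK (K.sum_mem fun i hi =>
      K.mul_mem (hνK i (hA'A hi)) (K.sub_mem K.one_mem (hβK i (hA'A hi)))))
      (K.sum_mem fun i hi => hνK i (hA'A hi))
    have hlt : κ i₀ < s := by
      have h1 : ∑ i ∈ A', D i (κ i₀) < ∑ i ∈ A', D i s := by rw [hsB]; exact hcase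
      rw [hDsum, hDsum] at h1
      exact lt_of_mul_lt_mul_left (by linarith) hNpos.le
    have hnext : ∀ i ∈ A, i ∉ A' → s ≤ κ i := by
      intro i hi hiA'
      obtain ⟨k, hk, hkmin⟩ := (A \ A').exists_min_image κ ⟨i, Finset.mem_sdiff.mpr ⟨hi, hiA'⟩⟩
      obtain ⟨hkA, hkA'⟩ := Finset.mem_sdiff.mp hk
      have hk1 : κ i₀ < κ k := by
        by_contra! hle
        exact hkA' (by simp [hA', hkA, hle])
      have hk2 : B < m (κ k) := by
        by_contra! hle
        exact absurd (hmax k (Finset.mem_filter.mpr ⟨hkA, hle⟩)) (not_le.mpr hk1)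
      have hfilt : A.filter (fun i => κ i < κ k) = A' := by
        ext j
        simp only [hA', Finset.mem_filter]
        refine and_congr_right fun hj => ⟨fun hjk => ?_, fun hj0 => hj0.trans_lt hk1⟩
        by_contra hj0
        exact absurd (hkmin j (Finset.mem_sdiff.mpr ⟨hj, by simp [hA', hj0]⟩)) (not_le.mpr hjk)
      have hk3 : ∑ i ∈ A', D i s < ∑ i ∈ A', D i (κ k) := by
        rw [hsB, ← hfilt]; exact hk2
      rw [hDsum, hDsum] at hk3
      have : s < κ k := lt_of_mul_lt_mul_left (by linarith) hNpos.le
      exact this.le.trans (hkmin i (Finset.mem_sdiff.mpr ⟨hi, hiA'⟩))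
    refine ⟨fun i => if i ∈ A' then D i s else 0, s, fun i hi => ?_, ?_, fun i hi => ?_⟩
    · dsimp only
      split_ifs with h
      · have : κ i ≤ κ i₀ := by simpa [hA', hi] using h
        exact ⟨hD0 i hi s (this.trans hlt.le), K.mul_mem (hνK i hi)
          (K.sub_mem (K.add_mem K.one_mem hsK) (hβK i hi))⟩
      · exact ⟨le_rfl, K.zero_mem⟩
    · rw [Finset.sum_ite_mem, Finset.inter_eq_right.mpr hA'A, hsB]
    · dsimp only
      split_ifs with h
      · have hκi : κ i < s := lt_of_le_of_lt (by simpa [hA', hi] using h) hlt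
        have h4 := hslope i hi s hκi.le fun h => absurd h hκi.ne
        refine ⟨?_, fun _ => h4⟩
        rcases h4 with h4 | h4
        · exact Or.inl h4.2.le
        · left
          rw [mul_div_cancel_left₀ _ (hν i hi).ne']
          linarith
      · refine ⟨?_, fun h => absurd h (lt_irrefl _)⟩
        have h3 := hnext i hi h
        by_cases hQi : Q i
        · have : κ i = β i - 1 := by simp [hκ, hQi]
          left; simp; linarith
        · have : κ i = β i := by simp [hκ, hQi]
          exact Or.inr ⟨hQi, by linarith⟩

/-! ### Constant extensions and partial equilibria -/

namespace Network

variable {V E : Type*} (N : Network V E) {f f' : FlowOverTime E} {e : E}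

theorem locallyIntegrableRates_of_step {K : Subfield ℝ} (hin : IsStepOver K (f.inflow e))
    (hout : IsStepOver K (f.outflow e)) : LocallyIntegrableRates f e :=
  fun _ hθ => ⟨hin.intervalIntegrable_zero hθ, hout.intervalIntegrable_zero hθ⟩

theorem integral_congr_of_lt {g h : ℝ → ℝ} {θ : ℝ} (hθ : 0 ≤ θ)
    (hgh : ∀ z, 0 ≤ z → z < θ → g z = h z) :
    ∫ ζ in (0 : ℝ)..θ, g ζ = ∫ ζ in (0 : ℝ)..θ, h ζ := by
  refine intervalIntegral.integral_congr_ae ?_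
  have : ∀ᵐ w : ℝ, w ≠ θ := by simp [ae_iff]
  filter_upwards [this] with w hwd hw
  rw [Set.uIoc_of_le hθ] at hw
  exact hgh w hw.1.le (lt_of_le_of_ne hw.2 hwd)

theorem queue_congr {θ : ℝ} (hθ : 0 ≤ θ)
    (hin : ∀ z, 0 ≤ z → z < θ → f.inflow e z = f'.inflow e z)
    (hout : ∀ z, 0 ≤ z → z < θ + N.τ e → f.outflow e z = f'.outflow e z) :
    N.queue f e θ = N.queue f' e θ := by
  have hτ := N.τ_pos' e
  rw [queue, queue, integral_congr_of_lt hθ hin, integral_congr_of_lt (by linarith) hout]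

theorem queue_congr_of_eq (hin : f.inflow e = f'.inflow e) (hout : f.outflow e = f'.outflow e)
    (θ : ℝ) : N.queue f e θ = N.queue f' e θ := by
  rw [queue, queue, hin, hout]

theorem isPiecewiseAffine_queue {K : Subfield ℝ} (hin : IsStepOver K (f.inflow e))
    (hout : IsStepOver K (f.outflow e)) : IsPiecewiseAffine K (N.queue f e) :=
  hin.isPiecewiseAffine_integral.sub (hout.isPiecewiseAffine_integral.comp_add (N.τ_pos' e)
    (SubfieldClass.ratCast_mem K (N.τ e)))

theorem isPiecewiseAffine_travelTime {K : Subfield ℝ} (hin : IsStepOver K (f.inflow e))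
    (hout : IsStepOver K (f.outflow e)) : IsPiecewiseAffine K (N.travelTime f e) := by
  have := (IsPiecewiseAffine.const (SubfieldClass.ratCast_mem K (N.τ e))).add
    ((N.isPiecewiseAffine_queue hin hout).const_mul
      (K.inv_mem (SubfieldClass.ratCast_mem K (N.ν e))))
  refine fun θ hθ => ⟨(this θ hθ).1.congr (Eventually.of_forall fun y => ?_),
    fun h0 => ((this θ hθ).2 h0).congr (Eventually.of_forall fun y => ?_)⟩ <;>
  · rw [travelTime, div_eq_inv_mul]

end Network

namespace AcyclicNetwork

variable {V E : Type*} (N : AcyclicNetwork V E)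

theorem src_ne_sink (e : E) : N.src e ≠ N.t := by
  intro h
  refine N.acyclic N.t ?_
  exact Relation.TransGen.head' ⟨e, h, rfl⟩ (N.sink_reachable (N.dst e))

variable [DecidableEq V] {f f' : FlowOverTime E}

/-- The extension of `f` at the node `v` from `a` to `b` with the constant inflow rates `x`: the
queue present at time `a` drains at the rate `ν - x` if `x < ν`, and the outflow rate drops from
`ν` to `x` when it is empty. For `x = ν` the depletion time is a junk value, which is harmless
because both rates are then `ν`; the same holds for `x > ν`. -/
def extend (f : FlowOverTime E) (v : V) (a b : ℝ) (x : E → ℝ) : FlowOverTime E where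
  inflow e θ := if N.src e = v ∧ a ≤ θ ∧ θ < b then x e else f.inflow e θ
  outflow e θ := if N.src e = v ∧ a + N.τ e ≤ θ ∧ θ < b + N.τ e then
      (if θ < a + N.queue f e a / (N.ν e - x e) + N.τ e then (N.ν e : ℝ) else min (x e) (N.ν e))
    else f.outflow e θ

section

variable {v : V} {a b : ℝ} {x : E → ℝ} {e : E}

theorem extend_inflow_of_ne (h : N.src e ≠ v) : (N.extend f v a b x).inflow e = f.inflow e := by
  ext θ; simp [extend, h]

theorem extend_outflow_of_ne (h : N.src e ≠ v) : (N.extend f v a b x).outflow e = f.outflow e := by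
  ext θ; simp [extend, h]

theorem extend_inflow_of_lt {θ : ℝ} (h : θ < a) :
    (N.extend f v a b x).inflow e θ = f.inflow e θ := by
  simp [extend, not_le.mpr h]

theorem extend_outflow_of_lt {θ : ℝ} (h : θ < a + N.τ e) :
    (N.extend f v a b x).outflow e θ = f.outflow e θ := by
  simp [extend, not_le.mpr h]

theorem extend_outflow_of_ge {θ : ℝ} (h : b + N.τ e ≤ θ) :
    (N.extend f v a b x).outflow e θ = f.outflow e θ := by
  simp [extend, not_lt.mpr h]

theorem extend_inflow (he : N.src e = v) {θ : ℝ} (h1 : a ≤ θ) (h2 : θ < b) :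
    (N.extend f v a b x).inflow e θ = x e := by
  simp [extend, he, h1, h2]

theorem extend_outflow (he : N.src e = v) {θ : ℝ} (h1 : a ≤ θ) (h2 : θ < b) :
    (N.extend f v a b x).outflow e (θ + N.τ e) =
      if θ < a + N.queue f e a / (N.ν e - x e) then (N.ν e : ℝ) else min (x e) (N.ν e) := by
  simp [extend, he, h1, h2]

theorem isStepOver_extend {K : Subfield ℝ}
    (hf : ∀ e, IsStepOver K (f.inflow e) ∧ IsStepOver K (f.outflow e)) (ha0 : 0 ≤ a)
    (ha : a ∈ K) (hb : b ∈ K) (hx : ∀ e, N.src e = v → x e ∈ K) (e : E) :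
    IsStepOver K ((N.extend f v a b x).inflow e) ∧
      IsStepOver K ((N.extend f v a b x).outflow e) := by
  by_cases he : N.src e = v
  · have hτ : (N.τ e : ℝ) ∈ K := SubfieldClass.ratCast_mem K _
    have hν : (N.ν e : ℝ) ∈ K := SubfieldClass.ratCast_mem K _
    have hq := (N.isPiecewiseAffine_queue (hf e).1 (hf e).2).mem ha0 ha
    have hmin : min (x e) (N.ν e : ℝ) ∈ K := by
      rcases min_choice (x e) (N.ν e : ℝ) with h | h <;> rw [h]
      exacts [hx e he, hν]
    constructor
    · have := IsStepOver.ite_Ico ha hb (IsStepOver.const (hx e he)) (hf e).1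
      simpa [extend, he] using this
    · have := IsStepOver.ite_Ico (K.add_mem ha hτ) (K.add_mem hb hτ)
        (IsStepOver.ite_lt (K.add_mem (K.add_mem ha (K.div_mem hq (K.sub_mem hν (hx e he)))) hτ)
          (IsStepOver.const hν) (IsStepOver.const hmin)) (hf e).2
      simpa [extend, he] using this
  · rw [N.extend_inflow_of_ne he, N.extend_outflow_of_ne he]
    exact hf e

theorem queue_extend_of_le {θ : ℝ} (hθ : 0 ≤ θ) (h : θ ≤ a) :
    N.queue (N.extend f v a b x) e θ = N.queue f e θ :=
  N.queue_congr hθ (fun _ _ hz => N.extend_inflow_of_lt (hz.trans_le h))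
    fun _ _ hz => N.extend_outflow_of_lt (by linarith)

theorem queue_extend_of_ne (h : N.src e ≠ v) (θ : ℝ) :
    N.queue (N.extend f v a b x) e θ = N.queue f e θ :=
  N.queue_congr_of_eq (N.extend_inflow_of_ne h) (N.extend_outflow_of_ne h) θ

/-- The flow `extend` has been chosen such that the queues follow the dynamics of queues operating
at capacity under constant inflow. -/
theorem queue_extend (hf : ∀ e, IsStepOver ⊤ (f.inflow e) ∧ IsStepOver ⊤ (f.outflow e))
    (ha : 0 ≤ a) (hq : 0 ≤ N.queue f e a) (he : N.src e = v) {θ : ℝ} (h1 : a ≤ θ) (h2 : θ ≤ b) :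
    N.queue (N.extend f v a b x) e θ =
      max 0 (N.queue f e a + (x e - N.ν e) * (θ - a)) := by
  have hν := N.ν_pos' e
  have hst := N.isStepOver_extend (v := v) (a := a) (b := b) (x := x) hf ha
    (Subfield.mem_top _) (Subfield.mem_top _) (fun _ _ => Subfield.mem_top _) e
  have hint := Network.locallyIntegrableRates_of_step hst.1 hst.2
  have hqa := N.queue_extend_of_le (v := v) (b := b) (x := x) (e := e) (f := f) ha le_rfl
  set g := N.extend f v a b x with hg
  set d := a + N.queue f e a / (N.ν e - x e) with hd
  have hin : ∀ z, a ≤ z → z < b → g.inflow e z = x e := fun z e1 e2 => N.extend_inflow he e1 e2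
  have hout : ∀ z, a ≤ z → z < b → g.outflow e (z + N.τ e) =
      if z < d then (N.ν e : ℝ) else min (x e) (N.ν e) := fun z e1 e2 => N.extend_outflow he e1 e2
  rcases le_or_gt (N.ν e : ℝ) (x e) with hx | hx
  · rw [Network.queue_eq_add_mul hint (k := x e - N.ν e) ha h1 fun z e1 e2 => by
      rw [hin z e1.le (e2.trans_le h2), hout z e1.le (e2.trans_le h2), min_eq_right hx, ite_self],
      hqa, max_eq_right]
    have := mul_nonneg (sub_nonneg.mpr hx) (sub_nonneg.mpr h1)
    linarith
  · have hpos : 0 < (N.ν e : ℝ) - x e := by linarith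
    have had : a ≤ d := by
      have := div_nonneg hq hpos.le
      linarith
    have hda : (x e - N.ν e) * (d - a) = - N.queue f e a := by
      rw [hd]; field_simp; ring
    have hlin : ∀ y, a ≤ y → y ≤ b → y ≤ d →
        N.queue g e y = N.queue f e a + (x e - N.ν e) * (y - a) := by
      intro y e1 e2 e3
      rw [Network.queue_eq_add_mul hint (k := x e - N.ν e) ha e1 fun z e4 e5 => by
        rw [hin z e4.le (e5.trans_le e2), hout z e4.le (e5.trans_le e2), if_pos (e5.trans_le e3)],
        hqa]
    rcases le_total θ d with hθd | hθd
    · rw [hlin θ h1 h2 hθd, max_eq_right]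
      nlinarith [mul_nonneg hpos.le (sub_nonneg.mpr hθd)]
    · rw [Network.queue_eq_add_mul hint (k := 0) (ha.trans had) hθd fun z e4 e5 => by
        rw [hin z (had.trans e4.le) (e5.trans_le h2), hout z (had.trans e4.le) (e5.trans_le h2),
          if_neg (not_lt.mpr e4.le), min_eq_left hx.le, sub_self],
        hlin d had (hθd.trans h2) le_rfl, hda, max_eq_left]
      · ring
      · nlinarith [mul_nonneg hpos.le (sub_nonneg.mpr hθd)]

theorem queue_op_extend (hf : ∀ e, IsStepOver ⊤ (f.inflow e) ∧ IsStepOver ⊤ (f.outflow e))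
    (ha : 0 ≤ a) (hq : 0 ≤ N.queue f e a) (he : N.src e = v) {θ : ℝ} (h1 : a ≤ θ) (h2 : θ < b) :
    N.QueueOperatesAtCapacity (N.extend f v a b x) e θ := by
  rw [Network.QueueOperatesAtCapacity, N.extend_outflow he h1 h2, N.extend_inflow he h1 h2,
    N.queue_extend hf ha hq he h1 h2.le]
  rcases le_or_gt (N.ν e : ℝ) (x e) with hx | hx
  · rw [min_eq_right hx, ite_self, ite_self]
  · have hpos : 0 < (N.ν e : ℝ) - x e := by linarith
    congr 1
    rw [eq_iff_iff, lt_max_iff, or_iff_right (lt_irrefl _), ← sub_lt_iff_lt_add', lt_div_iff₀ hpos]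
    constructor <;> intro h <;> nlinarith

end

theorem isStepOver_grossInflow [Fintype E] {K : Subfield ℝ}
    (hf : ∀ e, IsStepOver K (f.inflow e) ∧ IsStepOver K (f.outflow e)) {v : V} (hv : v ≠ N.t) :
    IsStepOver K (N.grossInflow f v) :=
  (IsStepOver.sum _ fun e _ => (hf e).2).add ((N.u_step v hv).isStepOver K)

variable [Fintype V]

/-- The label of a node depends on the edges leaving nodes of at most the same rank only. -/
theorem labelOf_congr {rank : V ≃ Fin (Fintype.card V)} (hrank : N.IsTopologicalOrder rank)
    [Finite E] {c c' : E → ℝ} (w : V) (h : ∀ e, rank (N.src e) ≤ rank w → c e = c' e) :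
    N.labelOf c w = N.labelOf c' w := by
  induction w using N.wellFounded.induction with
  | _ w ih =>
    by_cases hw : w = N.t
    · rw [hw, labelOf_sink, labelOf_sink]
    · have h1 := N.labelOf_isLeast c hw
      have h2 := N.labelOf_isLeast c' hw
      refine h1.unique ?_
      suffices hset : {x : ℝ | ∃ e, N.src e = w ∧ x = N.labelOf c (N.dst e) + c e} =
          {x : ℝ | ∃ e, N.src e = w ∧ x = N.labelOf c' (N.dst e) + c' e} by rwa [hset]
      ext x
      refine exists_congr fun e => and_congr_right fun he => ?_
      rw [ih (N.dst e) ⟨e, he, rfl⟩ fun e' he' => h e' (he'.trans (he ▸ hrank.2 e).le),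
        h e (by rw [he])]

theorem label_congr {rank : V ≃ Fin (Fintype.card V)} (hrank : N.IsTopologicalOrder rank)
    [Finite E] {w : V} {θ : ℝ}
    (h : ∀ e, rank (N.src e) ≤ rank w → N.queue f e θ = N.queue f' e θ) :
    N.label f w θ = N.label f' w θ :=
  N.labelOf_congr hrank w fun e he => by rw [Network.travelTime, Network.travelTime, h e he]

theorem isActive_congr {rank : V ≃ Fin (Fintype.card V)} (hrank : N.IsTopologicalOrder rank)
    [Finite E] {e : E} {θ : ℝ}
    (h : ∀ e', rank (N.src e') ≤ rank (N.src e) → N.queue f e' θ = N.queue f' e' θ) :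
    N.IsActive f e θ ↔ N.IsActive f' e θ := by
  rw [IsActive, IsActive, N.label_congr hrank h,
    N.label_congr hrank fun e' he' => h e' (he'.trans (hrank.2 e).le),
    Network.travelTime, Network.travelTime, h e le_rfl]

theorem label_le [Finite E] (e : E) (θ : ℝ) :
    N.label f (N.src e) θ ≤ N.label f (N.dst e) θ + N.travelTime f e θ :=
  (N.labelOf_isLeast _ (N.src_ne_sink e)).2 ⟨e, rfl, rfl⟩

theorem isActive_of_forall_le [Finite E] {e : E} {θ : ℝ} (h : ∀ e', N.src e' = N.src e →
    N.label f (N.dst e) θ + N.travelTime f e θ ≤ N.label f (N.dst e') θ + N.travelTime f e' θ) :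
    N.IsActive f e θ := by
  refine le_antisymm (N.label_le e θ) ?_
  obtain ⟨e', he', h'⟩ := (N.labelOf_isLeast (fun e => N.travelTime f e θ) (N.src_ne_sink e)).1
  exact (h e' he').trans h'.ge

theorem isPiecewiseAffine_label [Fintype E] {K : Subfield ℝ}
    (hf : ∀ e, IsStepOver K (f.inflow e) ∧ IsStepOver K (f.outflow e)) (w : V) :
    IsPiecewiseAffine K (N.label f w) := by
  induction w using N.wellFounded.induction with
  | _ w ih =>
    by_cases hw : w = N.t
    · subst hw
      have : N.label f N.t = fun _ => 0 := funext fun θ => N.labelOf_sink _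
      rw [this]
      exact .const K.zero_mem
    · obtain ⟨e₀, he₀⟩ := N.exists_outgoing hw
      refine IsPiecewiseAffine.of_isLeast (s := Finset.univ.filter fun e => N.src e = w)
        (G := fun e θ => N.label f (N.dst e) θ + N.travelTime f e θ) ⟨e₀, by simp [he₀]⟩ ?_ ?_
      · intro e he
        exact (ih (N.dst e) ⟨e, by simpa using he, rfl⟩).add
          (N.isPiecewiseAffine_travelTime (hf e).1 (hf e).2)
      · intro θ _
        simp only [Finset.mem_filter, Finset.mem_univ, true_and]
        exact N.labelOf_isLeast (fun e => N.travelTime f e θ) hw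

variable [Fintype E]

section Extend

variable {v : V} {a b : ℝ} {x : E → ℝ} {e : E}

/-- A constant extension is determined by its inflow rates. -/
theorem IsConstantExtension.eq_extend
    (hf : ∀ e, IsStepOver ⊤ (f.inflow e) ∧ IsStepOver ⊤ (f.outflow e))
    (ha : 0 ≤ a) (hq : ∀ e, N.src e = v → 0 ≤ N.queue f e a)
    (h : N.IsConstantExtension f f' v a b x) : f' = N.extend f v a b x := by
  have hin : ∀ e, f'.inflow e = (N.extend f v a b x).inflow e := by
    intro e
    by_cases he : N.src e = v
    · ext θ
      rw [h.inflow_eq e he θ]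
      simp [extend, he]
    · rw [N.extend_inflow_of_ne he, (h.other_edges e he).1]
  have hout : ∀ e, f'.outflow e = (N.extend f v a b x).outflow e := by
    intro e
    by_cases he : N.src e = v
    · have hst := N.isStepOver_extend (v := v) (a := a) (b := b) (x := x) hf ha
        (Subfield.mem_top _) (Subfield.mem_top _) (fun _ _ => Subfield.mem_top _) e
      have hint : Network.LocallyIntegrableRates f' e := by
        intro θ hθ
        refine ⟨by rw [hin e]; exact hst.1.intervalIntegrable_zero hθ, ?_⟩
        rw [intervalIntegrable_iff_integrableOn_Ioc_of_le hθ]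
        exact (h.outflow_integrable e he).mono_set fun z hz => hz.1.le
      have hlt : ∀ z, z < a + N.τ e → f'.outflow e z = f.outflow e z := fun z hz =>
        h.outflow_eq e he z fun hcon => absurd hcon.1 (not_le.mpr hz)
      have hqa : N.queue f' e a = N.queue f e a := by
        refine N.queue_congr ha (fun z _ hz => ?_) fun z _ hz => hlt z hz
        rw [h.inflow_eq e he, if_neg fun hcon => absurd hcon.1 (not_le.mpr hz)]
      have hmax := Network.queue_eq_max (N := N.toNetwork) hint (x := x e) ha
        (by rw [hqa]; exact hq e he)
        (fun θ h1 h2 => by rw [h.inflow_eq e he, if_pos ⟨h1, h2⟩]) (h.queue_op e he)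
      ext θ
      by_cases hθ : a + N.τ e ≤ θ ∧ θ < b + N.τ e
      · have h1 : a ≤ θ - N.τ e := by linarith
        have h2 : θ - N.τ e < b := by linarith
        have h3 := h.queue_op e he _ h1 h2
        have h4 := N.queue_op_extend (x := x) hf ha (hq e he) he h1 h2
        rw [Network.QueueOperatesAtCapacity, sub_add_cancel] at h3 h4
        rw [h3, h4, hmax _ h1 h2.le, hqa, N.queue_extend hf ha (hq e he) he h1 h2.le, hin e]
      · rw [h.outflow_eq e he θ hθ]
        simp only [extend, he, true_and, if_neg hθ]
    · rw [N.extend_outflow_of_ne he, (h.other_edges e he).2]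
  cases f'
  congr
  · exact funext hin
  · exact funext hout

end Extend

/-- `f` is an instantaneous dynamic equilibrium up to the time `H v` at each node `v`: the edges
leaving `v` have received their inflow during `[0, H v)`, and nothing has been fixed for later
times, where the rates vanish. -/
structure IsPartialIDE (f : FlowOverTime E) (H : V → ℝ) : Prop where
  step : ∀ e, IsStepOver ⊤ (f.inflow e) ∧ IsStepOver ⊤ (f.outflow e)
  inflow_nonneg : ∀ e θ, 0 ≤ f.inflow e θ
  outflow_nonneg : ∀ e θ, 0 ≤ f.outflow e θ
  inflow_late : ∀ e θ, H (N.src e) ≤ θ → f.inflow e θ = 0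
  outflow_late : ∀ e θ, H (N.src e) + N.τ e ≤ θ → f.outflow e θ = 0
  outflow_early : ∀ e, ∀ θ : ℝ, θ < N.τ e → f.outflow e θ = 0
  queue_op : ∀ e θ, 0 ≤ θ → θ < H (N.src e) → N.QueueOperatesAtCapacity f e θ
  conservation : ∀ v, v ≠ N.t → ∀ θ, 0 ≤ θ → θ < H v →
    ∑ e with N.src e = v, f.inflow e θ = N.grossInflow f v θ
  active : ∀ e θ, 0 ≤ θ → θ < H (N.src e) → 0 < f.inflow e θ → N.IsActive f e θ

namespace IsPartialIDE

variable {N} {H : V → ℝ}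

theorem zero : N.IsPartialIDE ⟨fun _ _ => 0, fun _ _ => 0⟩ fun _ => 0 where
  step _ := ⟨.const (Subfield.mem_top _), .const (Subfield.mem_top _)⟩
  inflow_nonneg _ _ := le_rfl
  outflow_nonneg _ _ := le_rfl
  inflow_late _ _ _ := rfl
  outflow_late _ _ _ := rfl
  outflow_early _ _ _ := rfl
  queue_op _ _ h1 h2 := absurd h1 (not_le.mpr h2)
  conservation _ _ _ h1 h2 := absurd h1 (not_le.mpr h2)
  active _ _ h1 h2 := absurd h1 (not_le.mpr h2)

/-- The horizon of the sink is irrelevant, since no edge leaves the sink. -/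
theorem congr {H' : V → ℝ} (hf : N.IsPartialIDE f H) (hH : ∀ v, v ≠ N.t → H' v = H v) :
    N.IsPartialIDE f H' where
  step := hf.step
  inflow_nonneg := hf.inflow_nonneg
  outflow_nonneg := hf.outflow_nonneg
  inflow_late e θ h := hf.inflow_late e θ (by rwa [← hH _ (N.src_ne_sink e)])
  outflow_late e θ h := hf.outflow_late e θ (by rwa [← hH _ (N.src_ne_sink e)])
  outflow_early := hf.outflow_early
  queue_op e θ h1 h2 := hf.queue_op e θ h1 (by rwa [← hH _ (N.src_ne_sink e)])
  conservation v hv θ h1 h2 := hf.conservation v hv θ h1 (by rwa [← hH _ hv])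
  active e θ h1 h2 := hf.active e θ h1 (by rwa [← hH _ (N.src_ne_sink e)])

theorem integrable (hf : N.IsPartialIDE f H) (e : E) : Network.LocallyIntegrableRates f e :=
  Network.locallyIntegrableRates_of_step (hf.step e).1 (hf.step e).2

theorem queue_nonneg (hf : N.IsPartialIDE f H) (e : E) {θ : ℝ} (h0 : 0 ≤ θ)
    (h1 : θ ≤ H (N.src e)) : 0 ≤ N.queue f e θ :=
  Network.queue_nonneg_of_operates (hf.integrable e) le_rfl
    (Network.queue_zero fun θ _ h => hf.outflow_early e θ h).ge
    (fun θ e1 e2 => hf.queue_op e θ e1 e2) θ h0 h1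

theorem grossInflow_nonneg (hf : N.IsPartialIDE f H) {v : V} (hv : v ≠ N.t) {θ : ℝ} (h : 0 ≤ θ) :
    0 ≤ N.grossInflow f v θ :=
  add_nonneg (Finset.sum_nonneg fun e _ => hf.outflow_nonneg e θ) (N.u_nonneg v hv θ h)

end IsPartialIDE

variable {N}

theorem IsPartialIDE.isConstantExtension_extend {H : V → ℝ} (hf : N.IsPartialIDE f H) {v : V}
    {a b : ℝ} {x : E → ℝ} (hHa : H v = a) (ha : 0 ≤ a) (hab : a < b)
    (hx : ∀ e, N.src e = v → 0 ≤ x e)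
    (hcons : ∀ θ, a ≤ θ → θ < b → ∑ e with N.src e = v, x e = N.grossInflow f v θ)
    (hact : ∀ e, N.src e = v → 0 < x e → ∀ θ, a ≤ θ → θ < b →
      N.IsActive (N.extend f v a b x) e θ) :
    N.IsConstantExtension f (N.extend f v a b x) v a b x where
  lt := hab
  nonneg := hx
  other_edges e he := ⟨N.extend_inflow_of_ne he, N.extend_outflow_of_ne he⟩
  inflow_eq e he θ := by simp [extend, he]
  outflow_eq e he θ hθ := by simp only [extend, he, true_and, if_neg hθ]
  outflow_integrable e he := by
    have hst := N.isStepOver_extend (v := v) (a := a) (b := b) (x := x) hf.step ha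
        (Subfield.mem_top _) (Subfield.mem_top _) (fun _ _ => Subfield.mem_top _) e
    refine hst.2.integrableOn_Ici (M := b + N.τ e) fun θ hθ => ?_
    rw [N.extend_outflow_of_ge hθ, hf.outflow_late e θ (by rw [he, hHa]; linarith)]
  queue_op e he θ h1 h2 :=
    N.queue_op_extend hf.step ha (hf.queue_nonneg e ha (by rw [he, hHa])) he h1 h2
  conservation := hcons
  only_active := hact

/-- A constant extension at `v` turns a partial equilibrium into one with a later horizon at `v`,
provided that the nodes from which `v` can be reached lag behind, and that the outflow of the edges
leaving `v` concerns times after the horizons of their heads only. -/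
theorem IsPartialIDE.extend {rank : V ≃ Fin (Fintype.card V)} (hrank : N.IsTopologicalOrder rank)
    {H : V → ℝ} (hf : N.IsPartialIDE f H) {v : V} {a b : ℝ} {x : E → ℝ}
    (hHa : H v = a) (ha : 0 ≤ a) (hbefore : ∀ w, rank v < rank w → H w ≤ a)
    (hlag : ∀ e, N.src e = v → H (N.dst e) ≤ a + N.τ e)
    (h : N.IsConstantExtension f f' v a b x) :
    N.IsPartialIDE f' (Function.update H v b) := by
  have hq : ∀ e, N.src e = v → 0 ≤ N.queue f e a := fun e he =>
    hf.queue_nonneg e ha (by rw [he, hHa])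
  have heq := h.eq_extend N hf.step ha hq
  have hab := h.lt
  have hupd : ∀ w, w ≠ v → Function.update H v b w = H w := fun w hw =>
    Function.update_of_ne hw _ _
  have hout : ∀ e θ, f'.outflow e θ = f.outflow e θ ∨ N.src e = v ∧ a + N.τ e ≤ θ ∧
      (f'.outflow e θ = N.ν e ∨ f'.outflow e θ = min (x e) (N.ν e)) := by
    intro e θ
    rw [heq]
    simp only [AcyclicNetwork.extend]
    split_ifs with h1 h2
    · exact Or.inr ⟨h1.1, h1.2.1, Or.inl rfl⟩
    · exact Or.inr ⟨h1.1, h1.2.1, Or.inr rfl⟩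
    · exact Or.inl rfl
  have hqle : ∀ e θ, 0 ≤ θ → θ ≤ a → N.queue f' e θ = N.queue f e θ := by
    intro e θ h0 h1
    rw [heq]; exact N.queue_extend_of_le h0 h1
  have hqne : ∀ e θ, N.src e ≠ v → N.queue f' e θ = N.queue f e θ := by
    intro e θ he
    rw [heq]; exact N.queue_extend_of_ne he θ
  have hgross : ∀ w, ∀ θ, 0 ≤ θ → θ < Function.update H v b w → w ≠ N.t →
      N.grossInflow f' w θ = N.grossInflow f w θ := by
    intro w θ h0 hθ hw
    simp only [Network.grossInflow, add_left_inj]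
    refine Finset.sum_congr rfl fun e he => ?_
    have he' : N.dst e = w := by simpa using he
    rcases hout e θ with h1 | h1
    · exact h1
    · exfalso
      have hne : w ≠ v := by
        rintro rfl
        have := hrank.2 e
        rw [h1.1, he'] at this
        exact lt_irrefl _ this
      rw [hupd w hne] at hθ
      have := hlag e h1.1
      rw [he'] at this
      linarith [h1.2.1]
  constructor
  · rw [heq]
    exact N.isStepOver_extend hf.step ha (Subfield.mem_top _) (Subfield.mem_top _)
      fun _ _ => Subfield.mem_top _
  · intro e θ
    by_cases he : N.src e = v
    · rw [h.inflow_eq e he]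
      split_ifs
      exacts [h.nonneg e he, hf.inflow_nonneg e θ]
    · rw [(h.other_edges e he).1]; exact hf.inflow_nonneg e θ
  · intro e θ
    have hν := (N.ν_pos' e).le
    rcases hout e θ with h1 | ⟨he, -, h1 | h1⟩ <;> rw [h1]
    exacts [hf.outflow_nonneg e θ, hν, le_min (h.nonneg e he) hν]
  · intro e θ hθ
    by_cases he : N.src e = v
    · rw [he, Function.update_self] at hθ
      rw [h.inflow_eq e he, if_neg fun hc => absurd hc.2 (not_lt.mpr hθ)]
      exact hf.inflow_late e θ (by rw [he, hHa]; linarith)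
    · rw [(h.other_edges e he).1]; exact hf.inflow_late e θ (by rwa [hupd _ he] at hθ)
  · intro e θ hθ
    by_cases he : N.src e = v
    · rw [he, Function.update_self] at hθ
      rw [h.outflow_eq e he θ fun hc => absurd hc.2 (not_lt.mpr hθ)]
      exact hf.outflow_late e θ (by rw [he, hHa]; linarith)
    · rw [(h.other_edges e he).2]; exact hf.outflow_late e θ (by rwa [hupd _ he] at hθ)
  · intro e θ hθ
    rcases hout e θ with h1 | h1
    · rw [h1]; exact hf.outflow_early e θ hθ
    · linarith [h1.2.1]
  · intro e θ h0 hθ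
    by_cases he : N.src e = v
    · rw [he, Function.update_self] at hθ
      rcases lt_or_ge θ a with h1 | h1
      · have h2 := hf.queue_op e θ h0 (by rwa [he, hHa])
        have h3 : f'.inflow e θ = f.inflow e θ := by
          rw [h.inflow_eq e he, if_neg fun hc => absurd hc.1 (not_le.mpr h1)]
        rw [Network.QueueOperatesAtCapacity] at h2 ⊢
        rw [hqle e θ h0 h1.le, h3, h.outflow_eq e he _ fun hc => absurd hc.1 (by linarith), h2]
      · exact h.queue_op e he θ h1 hθ
    · have h2 := hf.queue_op e θ h0 (by rwa [hupd _ he] at hθ)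
      rw [Network.QueueOperatesAtCapacity] at h2 ⊢
      rw [hqne e θ he, (h.other_edges e he).1, (h.other_edges e he).2, h2]
  · intro w hw θ h0 hθ
    rw [hgross w θ h0 hθ hw]
    by_cases hwv : w = v
    · subst hwv
      rw [Function.update_self] at hθ
      rcases lt_or_ge θ a with h1 | h1
      · rw [← hf.conservation w hw θ h0 (by rwa [hHa])]
        refine Finset.sum_congr rfl fun e he => ?_
        rw [h.inflow_eq e (by simpa using he), if_neg fun hc => absurd hc.1 (not_le.mpr h1)]
      · rw [← h.conservation θ h1 hθ]
        refine Finset.sum_congr rfl fun e he => ?_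
        rw [h.inflow_eq e (by simpa using he), if_pos ⟨h1, hθ⟩]
    · rw [hupd w hwv] at hθ
      rw [← hf.conservation w hw θ h0 hθ]
      refine Finset.sum_congr rfl fun e he => ?_
      rw [(h.other_edges e (by rw [show N.src e = w by simpa using he]; exact hwv)).1]
  · intro e θ h0 hθ hpos
    by_cases he : N.src e = v
    · rw [he, Function.update_self] at hθ
      rw [h.inflow_eq e he] at hpos
      rcases lt_or_ge θ a with h1 | h1
      · rw [if_neg fun hc => absurd hc.1 (not_le.mpr h1)] at hpos
        rw [N.isActive_congr hrank fun e' _ => hqle e' θ h0 h1.le]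
        exact hf.active e θ h0 (by rwa [he, hHa]) hpos
      · rw [if_pos ⟨h1, hθ⟩] at hpos
        exact h.only_active e he hpos θ h1 hθ
    · rw [hupd _ he] at hθ
      rw [(h.other_edges e he).1] at hpos
      have h2 := hf.active e θ h0 hθ hpos
      rwa [N.isActive_congr hrank fun e' he' => ?_]
      rcases lt_or_ge (rank v) (rank (N.src e)) with h3 | h3
      · exact hqle e' θ h0 (hθ.le.trans (hbefore _ h3))
      · refine hqne e' θ fun hc => he ?_
        rw [hc] at he'
        exact rank.injective (le_antisymm h3 he')

end AcyclicNetwork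

/-! ### Existence of local phases -/

namespace AcyclicNetwork

variable {V E : Type*} [Fintype V] [DecidableEq V] [Fintype E] {N : AcyclicNetwork V E}
  {f : FlowOverTime E} {H : V → ℝ} {v : V} {a : ℝ}

namespace IsPartialIDE

/-- The end of the interval of extension does not matter for the queues before it. -/
theorem queue_extend_eq (hf : N.IsPartialIDE f H) (hHa : H v = a) (ha : 0 ≤ a) {b b' θ : ℝ}
    (x : E → ℝ) (h1 : a ≤ θ) (h2 : θ ≤ b) (h3 : θ ≤ b') (e : E) :
    N.queue (N.extend f v a b x) e θ = N.queue (N.extend f v a b' x) e θ := by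
  by_cases he : N.src e = v
  · have hq := hf.queue_nonneg e ha (by rw [he, hHa])
    rw [N.queue_extend hf.step ha hq he h1 h2, N.queue_extend hf.step ha hq he h1 h3]
  · rw [N.queue_extend_of_ne he, N.queue_extend_of_ne he]

theorem isActive_extend_iff {rank : V ≃ Fin (Fintype.card V)} (hrank : N.IsTopologicalOrder rank)
    (hf : N.IsPartialIDE f H) (hHa : H v = a) (ha : 0 ≤ a) {b b' θ : ℝ} {x : E → ℝ} (h1 : a ≤ θ)
    (h2 : θ ≤ b) (h3 : θ ≤ b') (e : E) :
    N.IsActive (N.extend f v a b x) e θ ↔ N.IsActive (N.extend f v a b' x) e θ :=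
  N.isActive_congr hrank fun e' _ => hf.queue_extend_eq hHa ha x h1 h2 h3 e'

/-- At every time the gross inflow of a node can be distributed such that the equilibrium condition
holds for some time. -/
theorem exists_isConstantExtension {rank : V ≃ Fin (Fintype.card V)}
    (hrank : N.IsTopologicalOrder rank) (hf : N.IsPartialIDE f H) {K : Subfield ℝ}
    (hK : ∀ e, IsStepOver K (f.inflow e) ∧ IsStepOver K (f.outflow e)) (hv : v ≠ N.t)
    (hHa : H v = a) (ha : 0 ≤ a) {c : ℝ} (hac : a < c) :
    ∃ (x : E → ℝ) (b : ℝ), (∀ e, N.src e = v → x e ∈ K) ∧ b ≤ c ∧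
      N.IsConstantExtension f (N.extend f v a b x) v a b x := by
  classical
  set A : Finset E := Finset.univ.filter fun e => N.src e = v ∧ N.IsActive f e a with hA
  have hAmem : ∀ e, e ∈ A ↔ N.src e = v ∧ N.IsActive f e a := by simp [hA]
  have hAne : A.Nonempty := by
    obtain ⟨e, he, h⟩ := (N.labelOf_isLeast (fun e => N.travelTime f e a) hv).1
    refine ⟨e, (hAmem e).mpr ⟨he, ?_⟩⟩
    rw [IsActive, he]; exact h
  -- The labels of the heads of the edges do not depend on the extension; near `a` they are affine
  -- with slopes `β e`.
  choose α hα β hβ hlab using fun e => (N.isPiecewiseAffine_label hK (N.dst e) a ha).1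
  have hgrossK := N.isStepOver_grossInflow hK hv
  obtain ⟨x₀, s, hx₀, hsum₀, hslope⟩ := exists_equilibrium_distribution (K := K) hAne
    (ν := fun e => (N.ν e : ℝ)) (β := β) (fun e => 0 < N.queue f e a) (B := N.grossInflow f v a)
    (fun e _ => N.ν_pos' e) (fun e _ => SubfieldClass.ratCast_mem K _) (fun e _ => hβ e)
    (hf.grossInflow_nonneg hv ha) (hgrossK.2 a ha)
  set x : E → ℝ := fun e => if e ∈ A then x₀ e else 0 with hx
  have hxA : ∀ e ∈ A, x e = x₀ e := fun e he => by simp [hx, he]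
  have hx0 : ∀ e, 0 ≤ x e := by
    intro e; simp only [hx]; split_ifs with h
    exacts [(hx₀ e h).1, le_rfl]
  have hsum : ∑ e with N.src e = v, x e = N.grossInflow f v a := by
    rw [← hsum₀, ← Finset.sum_subset (s₁ := A)]
    · exact Finset.sum_congr rfl hxA
    · intro e he
      simpa using ((hAmem e).mp he).1
    · intro e _ he
      simp [hx, he]
  set g := N.extend f v a c x with hg
  have hq : ∀ e, N.src e = v → 0 ≤ N.queue f e a := fun e he =>
    hf.queue_nonneg e ha (by rw [he, hHa])
  -- The right derivative of the waiting time.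
  set r : E → ℝ := fun e => if 0 < N.queue f e a then x e / N.ν e - 1
    else max 0 (x e / N.ν e - 1) with hr
  have hnear : ∀ᶠ y in 𝓝[≥] a, a ≤ y ∧ y < c := eventually_lt_nhdsGE hac
  have hqueue : ∀ e, N.src e = v → ∀ᶠ y in 𝓝[≥] a,
      N.queue g e y / N.ν e = N.queue f e a / N.ν e + r e * (y - a) := by
    intro e he
    have hν := N.ν_pos' e
    have key : ∀ k : ℝ, r e = k / N.ν e →
        (∀ᶠ y in 𝓝[≥] a, max 0 (N.queue f e a + (x e - N.ν e) * (y - a)) =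
          N.queue f e a + k * (y - a)) → ∀ᶠ y in 𝓝[≥] a,
      N.queue g e y / N.ν e = N.queue f e a / N.ν e + r e * (y - a) := by
      intro k hk h
      filter_upwards [h, hnear] with y e1 e2
      rw [hg, N.queue_extend hf.step ha (hq e he) he e2.1 e2.2.le, e1, hk]
      field_simp
    by_cases hpos : 0 < N.queue f e a
    · refine key (x e - N.ν e) (by simp only [hr, if_pos hpos]; field_simp) ?_
      have hc : Continuous fun y => N.queue f e a + (x e - N.ν e) * (y - a) := by fun_prop
      filter_upwards [((hc.tendsto a).mono_left (nhdsWithin_le_nhds (s := Set.Ici a))).eventually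
        (Ioi_mem_nhds (a := 0) (by simpa using hpos))] with y hy
      exact max_eq_right (le_of_lt hy)
    · have h0 : N.queue f e a = 0 := le_antisymm (not_lt.mp hpos) (hq e he)
      refine key (max 0 (x e - N.ν e)) ?_ ?_
      · simp only [hr, if_neg hpos]
        rw [← max_div_div_right hν.le, zero_div, sub_div, div_self hν.ne']
      · filter_upwards [hnear] with y hy
        rw [h0, zero_add, zero_add, max_mul_of_nonneg _ _ (sub_nonneg.mpr hy.1), zero_mul]
  have hcost : ∀ e, N.src e = v → ∀ᶠ y in 𝓝[≥] a,
      N.label g (N.dst e) y + N.travelTime g e y =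
        (N.label f (N.dst e) a + N.travelTime f e a) + (β e + r e) * (y - a) := by
    intro e he
    filter_upwards [hqueue e he, hlab e, hnear] with y e1 e2 e3
    have e4 : N.label g (N.dst e) y = N.label f (N.dst e) y := by
      refine N.label_congr hrank fun e' he' => N.queue_extend_of_ne (fun hc => ?_) y
      have := hrank.2 e
      rw [he, ← hc] at this
      exact absurd he' (not_le.mpr this)
    rw [e4, Network.travelTime, Network.travelTime, e1, e2,
      (hlab e).self_of_nhdsWithin Set.self_mem_Ici]
    ring
  have hactive : ∀ᶠ y in 𝓝[≥] a, ∀ e, N.src e = v → 0 < x e → N.IsActive g e y := by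
    refine Filter.eventually_all.mpr fun e => ?_
    by_cases hcond : N.src e = v ∧ 0 < x e
    swap
    · exact Eventually.of_forall fun y h1 h2 => absurd ⟨h1, h2⟩ hcond
    obtain ⟨he, hxe⟩ := hcond
    have heA : e ∈ A := by
      by_contra h
      simp [hx, h] at hxe
    have hs : s = β e + r e := by
      rcases (hslope e heA).2 (by rwa [← hxA e heA]) with h | h
      · rw [h.2]; simp only [hr, if_pos h.1, hxA e heA]; ring
      · rw [h.2]; simp only [hr, if_neg h.1, hxA e heA]
    have hle : ∀ e', N.src e' = v → ∀ᶠ y in 𝓝[≥] a,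
        N.label g (N.dst e) y + N.travelTime g e y ≤
          N.label g (N.dst e') y + N.travelTime g e' y := by
      intro e' he'
      have hact := ((hAmem e).mp heA).2
      rw [IsActive] at hact
      by_cases he'A : e' ∈ A
      · have hact' := ((hAmem e').mp he'A).2
        rw [IsActive, he', ← he, hact] at hact'
        have hs' : s ≤ β e' + r e' := by
          have h0 : x e' / N.ν e' - 1 ≤ r e' := by
            simp only [hr]; split_ifs
            exacts [le_rfl, le_max_right _ _]
          rcases (hslope e' he'A).1 with h | h
          · rw [← hxA e' he'A] at h; linarith
          · have : 0 ≤ r e' := by simp only [hr, if_neg h.1]; exact le_max_left _ _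
            linarith [h.2]
        filter_upwards [hcost e he, hcost e' he', hnear] with y e1 e2 e3
        rw [e1, e2, hact', ← hs]
        have := mul_le_mul_of_nonneg_right hs' (sub_nonneg.mpr e3.1)
        linarith
      · have hlt : N.label f (N.dst e) a + N.travelTime f e a <
            N.label f (N.dst e') a + N.travelTime f e' a := by
          have h1 := N.label_le (f := f) e' a
          rw [he', ← he, hact] at h1
          refine lt_of_le_of_ne h1 fun h2 => he'A ((hAmem e').mpr ⟨he', ?_⟩)
          rw [IsActive, he', ← he, hact, h2]
        have hc : Continuous fun y => (N.label f (N.dst e') a + N.travelTime f e' a) +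
            (β e' + r e') * (y - a) - ((N.label f (N.dst e) a + N.travelTime f e a) +
            (β e + r e) * (y - a)) := by fun_prop
        filter_upwards [hcost e he, hcost e' he', ((hc.tendsto a).mono_left
          (nhdsWithin_le_nhds (s := Set.Ici a))).eventually
          (Ioi_mem_nhds (a := 0) (by simpa using hlt))] with y e1 e2 e3
        rw [e1, e2]
        exact (sub_pos.mp e3).le
    have hall : ∀ᶠ y in 𝓝[≥] a, ∀ e', N.src e' = v →
        N.label g (N.dst e) y + N.travelTime g e y ≤
          N.label g (N.dst e') y + N.travelTime g e' y := by
      refine Filter.eventually_all.mpr fun e' => ?_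
      by_cases he' : N.src e' = v
      · filter_upwards [hle e' he'] with y hy _ using hy
      · exact Eventually.of_forall fun y h => absurd h he'
    filter_upwards [hall] with y hy _ _
    exact N.isActive_of_forall_le fun e' he' => hy e' (he'.trans he)
  obtain ⟨w, haw, hw⟩ := mem_nhdsGE_iff_exists_Icc_subset.mp
    (hactive.and (hgrossK.eventually_right ha))
  have hlt : a < min w c := lt_min haw hac
  refine ⟨x, min w c, fun e _ => ?_, min_le_right _ _, ?_⟩
  · simp only [hx]; split_ifs with h
    exacts [(hx₀ e h).2, K.zero_mem]
  · refine hf.isConstantExtension_extend hHa ha hlt (fun e _ => hx0 e) ?_ ?_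
    · intro θ h1 h2
      rw [hsum, (hw ⟨h1, h2.le.trans (min_le_left _ _)⟩).2]
    · intro e he hxe θ h1 h2
      rw [hf.isActive_extend_iff hrank hHa ha h1 h2.le (h2.le.trans (min_le_right _ _))]
      exact (hw ⟨h1, h2.le.trans (min_le_left _ _)⟩).1 e he hxe

/-- A local phase exists, and over `K` it ends at a time in `K`: a phase that ends before the
interval is covered ends at a jump of the gross inflow rate, or where a piecewise affine function
over `K` ceases to vanish. -/
theorem exists_isLocalPhase {rank : V ≃ Fin (Fintype.card V)}
    (hrank : N.IsTopologicalOrder rank) (hf : N.IsPartialIDE f H) {K : Subfield ℝ}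
    (hK : ∀ e, IsStepOver K (f.inflow e) ∧ IsStepOver K (f.outflow e)) (hv : v ≠ N.t)
    (hHa : H v = a) (ha : 0 ≤ a) (haK : a ∈ K) {c : ℝ} (hac : a < c) (hcK : c ∈ K) :
    ∃ (x : E → ℝ) (b : ℝ), (∀ e, N.src e = v → x e ∈ K) ∧ b ∈ K ∧
      N.IsLocalPhase f (N.extend f v a b x) v a b c x := by
  obtain ⟨x, b₀, hxK, hb₀c, hb₀⟩ := hf.exists_isConstantExtension hrank hK hv hHa ha hac
  have hq : ∀ e, N.src e = v → 0 ≤ N.queue f e a := fun e he =>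
    hf.queue_nonneg e ha (by rw [he, hHa])
  have hx0 := hb₀.nonneg
  -- The phase lasts as long as the constants `x` can be kept up; the conditions on `[a, b)` follow
  -- from those on shorter intervals.
  set S : Set ℝ := {b' | b' ≤ c ∧ ∃ f'', N.IsConstantExtension f f'' v a b' x} with hS
  have hb₀S : b₀ ∈ S := ⟨hb₀c, _, hb₀⟩
  have hbdd : BddAbove S := ⟨c, fun b' hb' => hb'.1⟩
  set b := sSup S with hb
  have hbc : b ≤ c := csSup_le ⟨b₀, hb₀S⟩ fun b' hb' => hb'.1
  have hb₀b : b₀ ≤ b := le_csSup hbdd hb₀S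
  have hab : a < b := hb₀.lt.trans_le hb₀b
  have hbefore : ∀ θ, a ≤ θ → θ < b → (∑ e with N.src e = v, x e = N.grossInflow f v θ) ∧
      ∀ e, N.src e = v → 0 < x e → N.IsActive (N.extend f v a c x) e θ := by
    intro θ h1 h2
    obtain ⟨b', ⟨hb'c, f'', hf''⟩, hb'⟩ := exists_lt_of_lt_csSup ⟨b₀, hb₀S⟩ h2
    refine ⟨hf''.conservation θ h1 hb', fun e he hxe => ?_⟩
    have := hf''.only_active e he hxe θ h1 hb'
    rw [hf''.eq_extend N hf.step ha hq] at this
    exact (hf.isActive_extend_iff hrank hHa ha h1 hb'.le (hb'.le.trans hb'c) e).mp this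
  have hmk : ∀ b', a < b' → b' ≤ c → (∀ θ, a ≤ θ → θ < b' →
      (∑ e with N.src e = v, x e = N.grossInflow f v θ) ∧
      ∀ e, N.src e = v → 0 < x e → N.IsActive (N.extend f v a c x) e θ) →
      N.IsConstantExtension f (N.extend f v a b' x) v a b' x := by
    intro b' h1 h2 h
    refine hf.isConstantExtension_extend hHa ha h1 hx0 (fun θ e1 e2 => (h θ e1 e2).1) ?_
    intro e he hxe θ e1 e2
    rw [hf.isActive_extend_iff hrank hHa ha e1 e2.le (e2.le.trans h2)]
    exact (h θ e1 e2).2 e he hxe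
  refine ⟨x, b, hxK, ?_, hbc, hmk b hab hbc hbefore, ?_⟩
  swap
  · intro b' f'' h1 h2 h3
    exact absurd (le_csSup hbdd ⟨h2, f'', h3⟩) (not_le.mpr h1)
  -- If `b` were not in `K`, then the conditions on the extension, which hold before `b`, would hold
  -- also for a while after `b`.
  by_contra hbK
  have hbc' : b < c := lt_of_le_of_ne hbc fun h => hbK (h ▸ hcK)
  have hb0 : 0 < b := ha.trans_lt hab
  set g := N.extend f v a c x with hg
  have hgK := N.isStepOver_extend (v := v) hK ha haK hcK hxK
  have hleft : ∀ᶠ y in 𝓝[<] b, a ≤ y ∧ y < b := eventually_ge_nhdsLT hab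
  have hactive : ∀ᶠ y in 𝓝[≥] b, ∀ e, N.src e = v → 0 < x e → N.IsActive g e y := by
    refine Filter.eventually_all.mpr fun e => ?_
    by_cases hcond : N.src e = v ∧ 0 < x e
    swap
    · exact Eventually.of_forall fun y h1 h2 => absurd ⟨h1, h2⟩ hcond
    have hD : IsPiecewiseAffine K fun y => N.label g (N.src e) y -
        (N.label g (N.dst e) y + N.travelTime g e y) :=
      (N.isPiecewiseAffine_label hgK _).sub ((N.isPiecewiseAffine_label hgK _).add
        (N.isPiecewiseAffine_travelTime (hgK e).1 (hgK e).2))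
    have hDb : N.label g (N.src e) b - (N.label g (N.dst e) b + N.travelTime g e b) = 0 := by
      obtain ⟨α, -, β, -, h⟩ := (hD b hb0.le).2 hb0
      refine (h.self_of_nhdsWithin Set.self_mem_Iic).trans ?_
      have hc : Continuous fun y : ℝ => α + β * y := by fun_prop
      refine tendsto_nhds_unique_of_eventuallyEq
        ((hc.tendsto b).mono_left (nhdsWithin_le_nhds (s := Set.Iio b)))
        (tendsto_const_nhds (x := (0 : ℝ))) ?_
      filter_upwards [h.filter_mono (nhdsWithin_mono b Set.Iio_subset_Iic_self), hleft]
        with y e1 e2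
      rw [← e1, sub_eq_zero]
      exact (hbefore y e2.1 e2.2).2 e hcond.1 hcond.2
    filter_upwards [hD.eventually_eq_zero hb0.le hbK hDb] with y hy _ _
    exact sub_eq_zero.mp hy
  have hgrossK := N.isStepOver_grossInflow hK hv
  have hgross : ∀ᶠ y in 𝓝[≥] b, ∑ e with N.src e = v, x e = N.grossInflow f v y := by
    obtain ⟨k, -, h1, h2⟩ := hgrossK.eventually_left hb0
    obtain ⟨y, e1, e2⟩ := (h1.and hleft).exists
    filter_upwards [hgrossK.eventually_right hb0.le] with y' hy'
    rw [hy', ← h2 hbK, ← e1]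
    exact (hbefore y e2.1 e2.2).1
  obtain ⟨w, hbw, hw⟩ := mem_nhdsGE_iff_exists_Icc_subset.mp (hgross.and hactive)
  have hlt : b < min w c := lt_min hbw hbc'
  refine absurd (le_csSup hbdd (show min w c ∈ S from ⟨min_le_right _ _, _,
    hmk _ (hab.trans hlt) (min_le_right _ _) fun θ h1 h2 => ?_⟩)) (not_le.mpr hlt)
  rcases lt_or_ge θ b with h3 | h3
  · exact hbefore θ h1 h3
  · exact hw ⟨h3, h2.le.trans (min_le_left _ _)⟩

end IsPartialIDE

end AcyclicNetwork

/-! ### Topological orders and termination -/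

namespace AcyclicNetwork

variable {V E : Type*} [Fintype V] [DecidableEq V] [Fintype E] (N : AcyclicNetwork V E)

omit [DecidableEq V] [Fintype E] in
/-- Reachability is a partial order in an acyclic graph; a linear extension of it is a topological
order. -/
theorem exists_isTopologicalOrder :
    ∃ rank : V ≃ Fin (Fintype.card V), N.IsTopologicalOrder rank := by
  classical
  set r : V → V → Prop := fun a b => Relation.ReflTransGen
    (fun a b => ∃ e, N.src e = a ∧ N.dst e = b) b a with hr
  have hanti : ∀ a b, r a b → r b a → a = b := by
    intro a b hab hba
    rcases Relation.reflTransGen_iff_eq_or_transGen.mp hab with h | h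
    · exact h
    · exact absurd (h.trans_left hba) (N.acyclic b)
  have : IsPartialOrder V r :=
    { refl := fun a => Relation.ReflTransGen.refl
      trans := fun a b c hab hbc => hbc.trans hab
      antisymm := hanti }
  obtain ⟨s, hs, hrs⟩ := extend_partialOrder r
  let _ : LinearOrder V :=
    { le := s
      le_refl := hs.refl
      le_trans := hs.trans
      le_antisymm := hs.antisymm
      le_total := hs.total
      toDecidableLE := Classical.decRel _ }
  set φ := (Fintype.orderIsoFinOfCardEq V rfl).symm
  have hle : ∀ a b, r a b → φ a ≤ φ b := fun a b h => φ.monotone (hrs a b h)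
  refine ⟨φ.toEquiv, ?_, fun e => ?_⟩
  · have hpos : 0 < Fintype.card V := Fintype.card_pos_iff.mpr ⟨N.t⟩
    obtain ⟨v, hv⟩ := φ.surjective ⟨0, hpos⟩
    have := hle N.t v (N.sink_reachable v)
    rw [hv, Fin.le_def] at this
    simpa using this
  · refine lt_of_le_of_ne (hle _ _ (Relation.ReflTransGen.single ⟨e, rfl, rfl⟩)) fun h => ?_
    exact N.acyclic (N.src e) (Relation.TransGen.single ⟨e, rfl, φ.injective h⟩)

/-- The requirements on a feasible flow up to the time `h`, at all nodes except the sink. -/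
structure IsFeasibleUntil (f : FlowOverTime E) (h : ℝ) : Prop where
  integrable : ∀ e, Network.LocallyIntegrableRates f e
  inflow_nonneg : ∀ e, ∀ θ : ℝ, 0 ≤ θ → 0 ≤ f.inflow e θ
  outflow_nonneg : ∀ e, ∀ θ : ℝ, 0 ≤ θ → 0 ≤ f.outflow e θ
  conservation : ∀ v, v ≠ N.t → ∀ θ : ℝ, 0 ≤ θ → θ < h →
    ∑ e with N.src e = v, f.inflow e θ = N.grossInflow f v θ
  no_early_outflow : ∀ e, ∀ θ : ℝ, 0 ≤ θ → θ < N.τ e → f.outflow e θ = 0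
  queue_op : ∀ e, ∀ θ : ℝ, 0 ≤ θ → θ < h → N.QueueOperatesAtCapacity f e θ

variable {N} {f : FlowOverTime E}

omit [Fintype V] in
theorem isFeasibleUntil_of_isFeasible (hf : N.IsFeasible f) (h : ℝ) : N.IsFeasibleUntil f h where
  integrable e θ hθ := by
    rw [intervalIntegrable_iff_integrableOn_Ioc_of_le hθ,
      intervalIntegrable_iff_integrableOn_Ioc_of_le hθ]
    exact ⟨(hf.inflow_integrable e).mono_set fun z hz => hz.1.le,
      (hf.outflow_integrable e).mono_set fun z hz => hz.1.le⟩
  inflow_nonneg := hf.inflow_nonneg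
  outflow_nonneg := hf.outflow_nonneg
  conservation v hv θ h0 _ := by
    have := hf.conservation v hv θ h0
    rw [Network.grossInflow]
    linarith
  no_early_outflow := hf.no_early_outflow
  queue_op e θ h0 _ := hf.queue_op e θ h0

theorem IsPartialIDE.isFeasibleUntil {H : V → ℝ} (hf : N.IsPartialIDE f H) {h : ℝ}
    (hH : ∀ v, v ≠ N.t → h ≤ H v) : N.IsFeasibleUntil f h where
  integrable := hf.integrable
  inflow_nonneg e θ _ := hf.inflow_nonneg e θ
  outflow_nonneg e θ _ := hf.outflow_nonneg e θ
  conservation v hv θ h0 h1 := hf.conservation v hv θ h0 (h1.trans_le (hH v hv))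
  no_early_outflow e θ _ := hf.outflow_early e θ
  queue_op e θ h0 h1 := hf.queue_op e θ h0 (h1.trans_le (hH _ (N.src_ne_sink e)))

namespace IsFeasibleUntil

omit [Fintype V]

theorem queue_nonneg {h : ℝ} (hf : N.IsFeasibleUntil f h) (e : E) {θ : ℝ} (h0 : 0 ≤ θ)
    (h1 : θ ≤ h) : 0 ≤ N.queue f e θ :=
  Network.queue_nonneg_of_operates (hf.integrable e) le_rfl
    (Network.queue_zero (hf.no_early_outflow e)).ge (hf.queue_op e) θ h0 h1

/-- Nonnegative queues: not more flow leaves an edge than enters it. -/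
theorem outflow_integral_le {h : ℝ} (hf : N.IsFeasibleUntil f h) {e : E} {B : ℝ}
    (hB : ∀ θ, 0 ≤ θ → θ ≤ h → ∫ ζ in (0 : ℝ)..θ, f.inflow e ζ ≤ B) {θ : ℝ} (h0 : 0 ≤ θ)
    (h1 : θ ≤ h) : ∫ ζ in (0 : ℝ)..θ, f.outflow e ζ ≤ B := by
  have hτ := N.τ_pos' e
  rcases le_total (N.τ e : ℝ) θ with h2 | h2
  · have h3 := hf.queue_nonneg e (sub_nonneg.mpr h2) (by linarith)
    rw [Network.queue, sub_add_cancel] at h3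
    have := hB _ (sub_nonneg.mpr h2) (by linarith)
    linarith
  · rw [Network.integral_congr_of_lt h0 (h := fun _ => 0) fun z e1 e2 =>
      hf.no_early_outflow e z e1 (e2.trans_le h2)]
    have := hB 0 le_rfl (h0.trans h1)
    simpa using this

/-- Uniform bounds at one node: no outgoing edge carries flow from some time on, and the volume
entering it is bounded. The bounds of the predecessors bound the inflow into the node, and a queue
without further inflow drains. -/
theorem exists_bounds [Fintype V] {rank : V ≃ Fin (Fintype.card V)}
    (hrank : N.IsTopologicalOrder rank) (v : V) :
    ∃ M B : ℝ, 0 ≤ M ∧ ∀ (h : ℝ) (f : FlowOverTime E), N.IsFeasibleUntil f h → ∀ e, N.src e = v →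
      (∀ θ, M ≤ θ → θ < h → f.inflow e θ = 0 ∧ N.queue f e θ = 0) ∧
      ∀ θ, 0 ≤ θ → θ ≤ h → ∫ ζ in (0 : ℝ)..θ, f.inflow e ζ ≤ B := by
  induction v using (InvImage.wf (fun v => rank v) (wellFounded_gt (α := Fin _))).induction with
  | _ v ih =>
  by_cases hv : v = N.t
  · exact ⟨0, 0, le_rfl, fun h f _ e he => absurd (he.trans hv) (N.src_ne_sink e)⟩
  have hpred : ∀ e, ∃ M B : ℝ, 0 ≤ M ∧ (N.dst e = v → ∀ (h : ℝ) (f : FlowOverTime E),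
      N.IsFeasibleUntil f h →
      (∀ θ, M ≤ θ → θ < h → f.inflow e θ = 0 ∧ N.queue f e θ = 0) ∧
      ∀ θ, 0 ≤ θ → θ ≤ h → ∫ ζ in (0 : ℝ)..θ, f.inflow e ζ ≤ B) := by
    intro e
    by_cases he : N.dst e = v
    · obtain ⟨M, B, hM, hMB⟩ := ih (N.src e) (he ▸ hrank.2 e)
      exact ⟨M, B, hM, fun _ h f hf => hMB h f hf e rfl⟩
    · exact ⟨0, 0, le_rfl, fun h => absurd h he⟩
  choose M B hM hMB using hpred
  obtain ⟨Mu, hMu⟩ := N.u_bounded_support v hv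
  have hu := (N.u_step v hv).isStepOver ⊤
  have huint := hu.integrableOn_Ici hMu
  set C : ℝ := ∫ ζ in Set.Ici (0 : ℝ), N.u v ζ with hC
  set M₀ : ℝ := ∑ e, (M e + N.τ e) + max Mu 0 with hM₀
  set B₀ : ℝ := max 0 (∑ e with N.dst e = v, B e + C) with hB₀
  have hMτ : ∀ e, 0 ≤ M e + N.τ e := fun e => add_nonneg (hM e) (N.τ_pos' e).le
  have hM₀le : ∀ e, M e + N.τ e ≤ M₀ := fun e =>
    (Finset.single_le_sum (fun e _ => hMτ e) (Finset.mem_univ e)).trans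
      (le_add_of_nonneg_right (le_max_right _ _))
  have hsumM : 0 ≤ ∑ e, (M e + N.τ e) := Finset.sum_nonneg fun e _ => hMτ e
  have hM₀0 : 0 ≤ M₀ := add_nonneg hsumM (le_max_right _ _)
  have hM₀u : Mu ≤ M₀ := (le_max_left _ _).trans (le_add_of_nonneg_left hsumM)
  have hdiv : ∀ e, 0 ≤ B₀ / N.ν e := fun e => div_nonneg (le_max_left _ _) (N.ν_pos' e).le
  refine ⟨M₀ + ∑ e, B₀ / N.ν e, B₀, add_nonneg hM₀0 (Finset.sum_nonneg fun e _ => hdiv e), ?_⟩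
  intro h f hf e he
  have hin : ∀ θ, 0 ≤ θ → θ < h → f.inflow e θ ≤ N.grossInflow f v θ := by
    intro θ h0 h1
    rw [← hf.conservation v hv θ h0 h1]
    exact Finset.single_le_sum (f := fun e => f.inflow e θ)
      (fun e _ => hf.inflow_nonneg e θ h0) (by simp [he])
  have hzero : ∀ θ, M₀ ≤ θ → θ < h → f.inflow e θ = 0 := by
    intro θ h0 h1
    refine le_antisymm ((hin θ (hM₀0.trans h0) h1).trans ?_) (hf.inflow_nonneg e θ (hM₀0.trans h0))
    rw [Network.grossInflow, hMu θ (hM₀u.trans h0), add_zero]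
    refine (Finset.sum_eq_zero fun e' he' => ?_).le
    have hτ := N.τ_pos' e'
    have hθ : M e' ≤ θ - N.τ e' := by linarith [hM₀le e']
    have h2 := ((hMB e' (by simpa using he') h f hf).1 _ hθ (by linarith))
    have h3 := hf.queue_op e' _ ((hM e').trans hθ) (by linarith)
    rwa [Network.QueueOperatesAtCapacity, sub_add_cancel, h2.2, h2.1, if_neg (lt_irrefl _),
      min_eq_left (N.ν_pos' e').le] at h3
  have hvol : ∀ θ, 0 ≤ θ → θ ≤ h → ∫ ζ in (0 : ℝ)..θ, f.inflow e ζ ≤ B₀ := by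
    intro θ h0 h1
    have hui := hu.intervalIntegrable_zero h0
    have houti : ∀ e' ∈ Finset.univ.filter (fun e' => N.dst e' = v),
        IntervalIntegrable (f.outflow e') volume 0 θ :=
      fun e' _ => (hf.integrable e' θ h0).2
    calc ∫ ζ in (0 : ℝ)..θ, f.inflow e ζ ≤ ∫ ζ in (0 : ℝ)..θ, N.grossInflow f v ζ := by
          refine intervalIntegral.integral_mono_on_of_le_Ioo h0 (hf.integrable e θ h0).1 ?_
            fun z hz => hin z hz.1.le (hz.2.trans_le h1)
          have := (IntervalIntegrable.sum _ houti).add hui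
          refine this.congr fun z _ => ?_
          simp [Network.grossInflow]
      _ = (∑ e' with N.dst e' = v, ∫ ζ in (0 : ℝ)..θ, f.outflow e' ζ) +
            ∫ ζ in (0 : ℝ)..θ, N.u v ζ := by
          simp only [Network.grossInflow]
          have hsum : IntervalIntegrable (fun ζ => ∑ e' with N.dst e' = v, f.outflow e' ζ)
              volume 0 θ := by
            refine (IntervalIntegrable.sum _ houti).congr fun z _ => ?_
            simp
          rw [intervalIntegral.integral_add hsum hui, intervalIntegral.integral_finsetSum houti]
      _ ≤ ∑ e' with N.dst e' = v, B e' + C := by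
          refine add_le_add (Finset.sum_le_sum fun e' he' =>
            hf.outflow_integral_le (hMB e' (Finset.mem_filter.mp he').2 h f hf).2 h0 h1) ?_
          rw [intervalIntegral.integral_of_le h0]
          refine setIntegral_mono_set huint ?_ (Filter.Eventually.of_forall fun z hz => hz.1.le)
          exact (ae_restrict_iff' measurableSet_Ici).mpr
            (Filter.Eventually.of_forall fun z hz => N.u_nonneg v hv z hz)
      _ ≤ B₀ := le_max_right _ _
  refine ⟨fun θ h0 h1 => ?_, hvol⟩
  have hMle : M₀ + B₀ / N.ν e ≤ θ :=
    (add_le_add_right (Finset.single_le_sum (f := fun e => B₀ / (N.ν e : ℝ)) (fun e _ => hdiv e)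
      (Finset.mem_univ e)) _).trans h0
  have hM₀θ : M₀ ≤ θ := by linarith [hdiv e]
  refine ⟨hzero θ hM₀θ h1, ?_⟩
  have hν := N.ν_pos' e
  have hq0 := hf.queue_nonneg e hM₀0 (hM₀θ.trans h1.le)
  rw [Network.queue_eq_max (hf.integrable e) (x := 0) hM₀0 hq0 hzero
    (fun z e1 e2 => hf.queue_op e z (hM₀0.trans e1) e2) θ hM₀θ h1.le]
  refine max_eq_left ?_
  have hqB : N.queue f e M₀ ≤ B₀ := by
    have h2 := hvol M₀ hM₀0 (hM₀θ.trans h1.le)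
    have h3 : 0 ≤ ∫ ζ in (0 : ℝ)..(M₀ + N.τ e), f.outflow e ζ :=
      intervalIntegral.integral_nonneg (add_nonneg hM₀0 (N.τ_pos' e).le)
        fun z hz => hf.outflow_nonneg e z hz.1
    rw [Network.queue]
    linarith
  have h4 : B₀ ≤ N.ν e * (θ - M₀) := by
    rw [← div_le_iff₀' hν]; linarith
  linarith

/-- From some time on, the same for all flows, the edges carry no flow. -/
theorem exists_empty_from [Fintype V] (N : AcyclicNetwork V E) :
    ∃ M : ℝ, 0 ≤ M ∧ ∀ (h : ℝ) (f : FlowOverTime E), N.IsFeasibleUntil f h → ∀ e,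
      ∀ θ, M ≤ θ → θ < h → f.inflow e θ = 0 ∧ N.queue f e θ = 0 := by
  obtain ⟨rank, hrank⟩ := N.exists_isTopologicalOrder
  choose M B hM hMB using exists_bounds (N := N) hrank
  refine ⟨∑ v, M v, Finset.sum_nonneg fun v _ => hM v, fun h f hf e θ h0 h1 => ?_⟩
  exact (hMB (N.src e) h f hf e rfl).1 θ
    ((Finset.single_le_sum (fun v _ => hM v) (Finset.mem_univ _)).trans h0) h1

end IsFeasibleUntil

/-- After an edge has ceased to receive flow and its queue is empty, the flow on it leaves within
the travel time of the edge. -/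
theorem exists_isTerminationBound (N : AcyclicNetwork V E) : ∃ T : ℚ, N.IsTerminationBound T := by
  obtain ⟨M, hM, hempty⟩ := IsFeasibleUntil.exists_empty_from N
  obtain ⟨T, hT⟩ := exists_rat_gt (M + ∑ e, (N.τ e : ℝ))
  have hτsum : ∀ e, (N.τ e : ℝ) ≤ ∑ e, (N.τ e : ℝ) := fun e =>
    Finset.single_le_sum (fun e _ => (N.τ_pos' e).le) (Finset.mem_univ e)
  have hτ0 : 0 ≤ ∑ e, (N.τ e : ℝ) := Finset.sum_nonneg fun e _ => (N.τ_pos' e).le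
  refine ⟨T, by exact_mod_cast (show (0 : ℝ) ≤ T by linarith), ?_⟩
  intro f hf θ hθ e
  have hfeas := fun h => isFeasibleUntil_of_isFeasible hf.1 h
  have hpos : ∀ z, M ≤ z → f.inflow e z = 0 ∧ N.queue f e z = 0 := fun z hz =>
    hempty (z + 1) f (hfeas _) e z hz (by linarith)
  have hτ := N.τ_pos' e
  have hq := (hpos (θ - N.τ e) (by linarith [hτsum e])).2
  rw [Network.queue, sub_add_cancel] at hq
  have hint := (hfeas 0).integrable e
  have hθ0 : 0 ≤ θ - N.τ e := by linarith [hτsum e]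
  have h1 := intervalIntegral.integral_add_adjacent_intervals (hint.inflow le_rfl hθ0)
    (hint.inflow hθ0 (by linarith : (0 : ℝ) ≤ θ))
  have h2 : ∫ ζ in (θ - N.τ e)..θ, f.inflow e ζ = 0 := by
    refine (intervalIntegral.integral_congr (g := fun _ => 0) fun z hz => ?_).trans (by simp)
    rw [Set.uIcc_of_le (by linarith)] at hz
    exact (hpos z (by linarith [hτsum e, hz.1])).1
  linarith

end AcyclicNetwork

/-! ### Finitely many local phases at one node -/

/-- Truncation at `0` of a linear evolution started at a nonnegative value is a semigroup. -/
theorem max_zero_add_mul {A k u w : ℝ} (hA : 0 ≤ A) (hu : 0 ≤ u) (hw : 0 ≤ w) :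
    max 0 (A + k * (u + w)) = max 0 (max 0 (A + k * u) + k * w) := by
  rcases le_total 0 (A + k * u) with h | h
  · rw [max_eq_right h]; ring_nf
  · rw [max_eq_left h, zero_add]
    have hk : k ≤ 0 ∨ u = 0 := by
      by_contra! hcon
      have := mul_pos hcon.1 (lt_of_le_of_ne hu (Ne.symm hcon.2))
      linarith
    rcases hk with hk | rfl
    · have h2 := mul_nonneg (neg_nonneg.mpr hk) hw
      rw [max_eq_left (by linarith), max_eq_left (by linarith)]
    · have : A = 0 := by linarith
      simp [this]

namespace AcyclicNetwork

variable {V E : Type*} [Fintype V] [DecidableEq V] [Fintype E] {N : AcyclicNetwork V E}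

/-- An infinite sequence of successive local phases at the node `v`, where `t n` is the starting
time and `X n` the distribution of the phase `n`. -/
structure InfinitePhases (N : AcyclicNetwork V E) (F : ℕ → FlowOverTime E) (t : ℕ → ℝ)
    (X : ℕ → E → ℝ) (v : V) (c : ℝ) : Prop where
  ne_sink : v ≠ N.t
  zero_le : 0 ≤ t 0
  isPartialIDE : ∀ n, ∃ H : V → ℝ, H v = t n ∧ N.IsPartialIDE (F n) H
  phase : ∀ n, N.IsLocalPhase (F n) (F (n + 1)) v (t n) (t (n + 1)) c (X n)

namespace InfinitePhases

variable {F : ℕ → FlowOverTime E} {t : ℕ → ℝ} {X : ℕ → E → ℝ} {v : V} {c : ℝ}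
  {rank : V ≃ Fin (Fintype.card V)}

theorem strictMono (P : N.InfinitePhases F t X v c) : StrictMono t :=
  strictMono_nat_of_lt_succ fun n => (P.phase n).2.1.lt

theorem nonneg (P : N.InfinitePhases F t X v c) (n : ℕ) : 0 ≤ t n :=
  P.zero_le.trans (P.strictMono.monotone (Nat.zero_le n))

theorem shift (P : N.InfinitePhases F t X v c) (m : ℕ) :
    N.InfinitePhases (fun n => F (n + m)) (fun n => t (n + m)) (fun n => X (n + m)) v c where
  ne_sink := P.ne_sink
  zero_le := P.nonneg _
  isPartialIDE n := P.isPartialIDE (n + m)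
  phase n := by
    have := P.phase (n + m)
    rwa [add_right_comm] at this

theorem step (P : N.InfinitePhases F t X v c) (n : ℕ) (e : E) :
    IsStepOver ⊤ ((F n).inflow e) ∧ IsStepOver ⊤ ((F n).outflow e) := by
  obtain ⟨H, -, h⟩ := P.isPartialIDE n
  exact h.step e

theorem queue_nonneg (P : N.InfinitePhases F t X v c) (n : ℕ) {e : E} (he : N.src e = v) :
    0 ≤ N.queue (F n) e (t n) := by
  obtain ⟨H, hH, h⟩ := P.isPartialIDE n
  exact h.queue_nonneg e (P.nonneg n) (by rw [he, hH])

theorem succ_eq (P : N.InfinitePhases F t X v c) (n : ℕ) :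
    F (n + 1) = N.extend (F n) v (t n) (t (n + 1)) (X n) :=
  (P.phase n).2.1.eq_extend N (P.step n) (P.nonneg n) fun _ he => P.queue_nonneg n he

theorem queue_eq_of_ne (P : N.InfinitePhases F t X v c) (n : ℕ) {e : E} (he : N.src e ≠ v)
    (θ : ℝ) : N.queue (F n) e θ = N.queue (F 0) e θ := by
  induction n with
  | zero => rfl
  | succ n ih => rw [P.succ_eq n, N.queue_extend_of_ne he, ih]

theorem queue_eq_of_le (P : N.InfinitePhases F t X v c) {m n : ℕ} {e : E} {θ : ℝ} (h0 : 0 ≤ θ)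
    (hm : θ ≤ t m) (hn : θ ≤ t n) : N.queue (F m) e θ = N.queue (F n) e θ := by
  have key : ∀ m n, m ≤ n → θ ≤ t m → N.queue (F n) e θ = N.queue (F m) e θ := by
    intro m n hmn hm
    induction n, hmn using Nat.le_induction with
    | base => rfl
    | succ n hmn ih =>
      rw [P.succ_eq n, N.queue_extend_of_le h0 (hm.trans (P.strictMono.monotone hmn)), ih]
  rcases le_total m n with h | h
  exacts [(key m n h hm).symm, key n m h hn]

theorem queue_eq_max (P : N.InfinitePhases F t X v c) (n : ℕ) {e : E} (he : N.src e = v) {θ : ℝ}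
    (h1 : t n ≤ θ) (h2 : θ ≤ t (n + 1)) : N.queue (F (n + 1)) e θ =
      max 0 (N.queue (F n) e (t n) + (X n e - N.ν e) * (θ - t n)) := by
  rw [P.succ_eq n, N.queue_extend (P.step n) (P.nonneg n) (P.queue_nonneg n he) he h1 h2]

theorem outflow_eq_of_ne (P : N.InfinitePhases F t X v c) (n : ℕ) {e : E} (he : N.src e ≠ v) :
    (F n).outflow e = (F 0).outflow e := by
  induction n with
  | zero => rfl
  | succ n ih => rw [P.succ_eq n, N.extend_outflow_of_ne he, ih]

theorem grossInflow_eq (hrank : N.IsTopologicalOrder rank) (P : N.InfinitePhases F t X v c)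
    (n : ℕ) (θ : ℝ) : N.grossInflow (F n) v θ = N.grossInflow (F 0) v θ := by
  rw [Network.grossInflow, Network.grossInflow]
  congr 1
  refine Finset.sum_congr rfl fun e he => ?_
  rw [P.outflow_eq_of_ne n fun hc => ?_]
  have := hrank.2 e
  rw [hc, (Finset.mem_filter.mp he).2] at this
  exact lt_irrefl _ this

theorem label_dst_eq (hrank : N.IsTopologicalOrder rank) (P : N.InfinitePhases F t X v c)
    (n : ℕ) {e : E} (he : N.src e = v) (θ : ℝ) :
    N.label (F n) (N.dst e) θ = N.label (F 0) (N.dst e) θ := by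
  refine N.label_congr hrank fun e' he' => P.queue_eq_of_ne n (fun hc => ?_) θ
  have := hrank.2 e
  rw [he, ← hc] at this
  exact absurd he' (not_le.mpr this)

theorem sum_eq (hrank : N.IsTopologicalOrder rank) (P : N.InfinitePhases F t X v c) (n : ℕ)
    {θ : ℝ} (h1 : t n ≤ θ) (h2 : θ < t (n + 1)) :
    ∑ e with N.src e = v, X n e = N.grossInflow (F 0) v θ := by
  rw [(P.phase n).2.1.conservation θ h1 h2, P.grossInflow_eq hrank]

theorem isActive_iff (hrank : N.IsTopologicalOrder rank) (P : N.InfinitePhases F t X v c) {n : ℕ}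
    {e : E} (he : N.src e = v) {θ : ℝ} : N.IsActive (F n) e θ ↔
      N.label (F n) v θ = N.label (F 0) (N.dst e) θ + N.τ e + N.queue (F n) e θ / N.ν e := by
  rw [IsActive, he, P.label_dst_eq hrank n he, Network.travelTime, add_assoc]

/-- The index of the phase during which the time `θ` lies. -/
def phaseIndex (t : ℕ → ℝ) (θ : ℝ) : ℕ := sInf {n | θ < t (n + 1)}

theorem phaseIndex_eq (P : N.InfinitePhases F t X v c) {n : ℕ} {θ : ℝ} (h1 : t n ≤ θ)
    (h2 : θ < t (n + 1)) : phaseIndex t θ = n := by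
  refine le_antisymm (Nat.sInf_le h2) ?_
  have hmem : phaseIndex t θ ∈ {n | θ < t (n + 1)} := Nat.sInf_mem ⟨n, h2⟩
  by_contra! hlt
  exact absurd (hmem.trans_le (P.strictMono.monotone hlt)) (not_lt.mpr h1)

theorem exists_phase {z : ℝ} (hz : IsLUB (Set.range t) z) {θ : ℝ} (h1 : t 0 ≤ θ) (h2 : θ < z) :
    ∃ n, t n ≤ θ ∧ θ < t (n + 1) := by
  obtain ⟨_, ⟨m, rfl⟩, hm, -⟩ := hz.exists_between h2
  have hne : {n | θ < t (n + 1)}.Nonempty := by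
    cases m with
    | zero => exact absurd hm (not_lt.mpr h1)
    | succ m => exact ⟨m, hm⟩
  refine ⟨sInf {n | θ < t (n + 1)}, ?_, Nat.sInf_mem hne⟩
  by_contra! hlt
  cases hk : sInf {n | θ < t (n + 1)} with
  | zero => rw [hk] at hlt; exact absurd hlt (not_lt.mpr h1)
  | succ k =>
    rw [hk] at hlt
    have : sInf {n | θ < t (n + 1)} ≤ k := Nat.sInf_le hlt
    omega

/-- While the gross inflow rate is constant and the labels of the neighbours are affine, the phases
form a distribution process. -/
theorem nodeDistribution (hrank : N.IsTopologicalOrder rank) (P : N.InfinitePhases F t X v c)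
    {z B : ℝ} (hz : IsLUB (Set.range t) z) (hB : 0 < B) {α β : E → ℝ}
    (hgross : ∀ θ, t 0 ≤ θ → θ < z → N.grossInflow (F 0) v θ = B)
    (hlab : ∀ e, N.src e = v → ∀ θ, t 0 ≤ θ → θ < z →
      N.label (F 0) (N.dst e) θ + N.τ e = α e + β e * θ) :
    NodeDistribution (ι := {e // N.src e = v}) (t 0) z B (fun e => N.ν e.1)
      (fun e => α e.1) (fun e => β e.1) (fun e θ => X (phaseIndex t θ) e.1)
      (fun e θ => N.queue (F (phaseIndex t θ + 1)) e.1 θ / N.ν e.1)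
      (fun θ => N.label (F (phaseIndex t θ + 1)) v θ) := by
  have hmono := P.strictMono
  have hphase := fun {θ : ℝ} => exists_phase (t := t) hz (θ := θ)
  have hp : ∀ (e : {e // N.src e = v}) n θ, t n ≤ θ → θ ≤ t (n + 1) →
      N.queue (F (phaseIndex t θ + 1)) e.1 θ / N.ν e.1 =
        max 0 (N.queue (F (phaseIndex t (t n) + 1)) e.1 (t n) / N.ν e.1 +
          (X n e.1 / N.ν e.1 - 1) * (θ - t n)) := by
    intro e n θ h1 h2
    have hν := N.ν_pos' e.1
    have h0 : 0 ≤ θ := (P.nonneg n).trans h1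
    have hθ : θ < t (phaseIndex t θ + 1) := by
      have : phaseIndex t θ ∈ {n | θ < t (n + 1)} :=
        Nat.sInf_mem ⟨n + 1, h2.trans_lt (hmono (Nat.lt_succ_self _))⟩
      exact this
    rw [P.phaseIndex_eq le_rfl (hmono (Nat.lt_succ_self n)), P.queue_eq_of_le h0 hθ.le h2,
      P.queue_eq_max n e.2 h1 h2, P.queue_eq_of_le (P.nonneg n) (hmono.monotone n.le_succ) le_rfl,
      ← max_div_div_right hν.le, zero_div, add_div, sub_mul, sub_mul, sub_div]
    congr 3
    · rw [div_mul_eq_mul_div]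
    · field_simp
  have hqnn : ∀ (e : {e // N.src e = v}) n,
      0 ≤ N.queue (F (phaseIndex t (t n) + 1)) e.1 (t n) / N.ν e.1 := by
    intro e n
    rw [P.phaseIndex_eq le_rfl (hmono (Nat.lt_succ_self n)),
      P.queue_eq_of_le (P.nonneg n) (hmono.monotone n.le_succ) le_rfl]
    exact div_nonneg (P.queue_nonneg n e.2) (N.ν_pos' e.1).le
  constructor
  · exact hB
  · exact fun e => N.ν_pos' e.1
  · intro e θ h1 h2
    exact (P.phase _).2.1.nonneg e.1 e.2
  · intro e θ h1 h2
    obtain ⟨n, e1, e2⟩ := hphase h1 h2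
    rw [hp e n θ e1 e2.le]
    exact le_max_left _ _
  · intro θ h1 h2
    obtain ⟨n, e1, e2⟩ := hphase h1 h2
    rw [P.phaseIndex_eq e1 e2, ← hgross θ h1 h2, ← P.sum_eq hrank n e1 e2]
    exact (Finset.sum_subtype _ (by simp) _).symm
  · intro θ h1 h2 e
    obtain ⟨n, e1, e2⟩ := hphase h1 h2
    filter_upwards [eventually_lt_nhdsGE e2] with y hy
    rw [P.phaseIndex_eq e1 e2, P.phaseIndex_eq (e1.trans hy.1) hy.2]
    refine ⟨rfl, ?_⟩
    have h3 := hp e n y (e1.trans hy.1) hy.2.le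
    have h4 := hp e n θ e1 e2.le
    rw [P.phaseIndex_eq (e1.trans hy.1) hy.2] at h3
    rw [P.phaseIndex_eq e1 e2] at h4
    rw [h3, h4, ← max_zero_add_mul (hqnn e n) (sub_nonneg.mpr e1) (sub_nonneg.mpr hy.1)]
    congr 3
    ring
  · intro θ h1 h2
    obtain ⟨n, e1, e2⟩ : ∃ n, t n < θ ∧ θ ≤ t (n + 1) := by
      obtain ⟨n, e1, e2⟩ := hphase h1.le h2
      rcases e1.eq_or_lt with h3 | h3
      · cases n with
        | zero => exact absurd h1 (h3 ▸ lt_irrefl _)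
        | succ n => exact ⟨n, h3 ▸ hmono (Nat.lt_succ_self n), h3.ge⟩
      · exact ⟨n, h3, e2.le⟩
    refine ⟨t n, hmono.monotone (Nat.zero_le n), e1, fun e y hy1 hy2 => ⟨fun hy3 => ?_, ?_⟩⟩
    · rw [P.phaseIndex_eq hy1 (hy3.trans_le e2),
        P.phaseIndex_eq le_rfl (hmono (Nat.lt_succ_self n))]
    · have := hp e n y hy1 (hy2.trans e2)
      rw [this, P.phaseIndex_eq le_rfl (hmono (Nat.lt_succ_self n))]
  · intro e θ h1 h2
    have := N.label_le (f := F (phaseIndex t θ + 1)) e.1 θ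
    rw [e.2, P.label_dst_eq hrank _ e.2, Network.travelTime, ← add_assoc,
      hlab e.1 e.2 θ h1 h2] at this
    exact this
  · intro e θ h1 h2 hx
    obtain ⟨n, e1, e2⟩ := hphase h1 h2
    rw [P.phaseIndex_eq e1 e2] at hx ⊢
    have := (P.isActive_iff hrank e.2).mp ((P.phase n).2.1.only_active e.1 e.2 hx θ e1 e2)
    rw [this, hlab e.1 e.2 θ h1 h2]

/-- Once the distribution process is stationary, a phase can be continued through the next one,
contradicting its maximality. -/
theorem false_of_affine (hrank : N.IsTopologicalOrder rank) (P : N.InfinitePhases F t X v c)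
    {z B : ℝ} (hz : IsLUB (Set.range t) z) {α β : E → ℝ}
    (hgross : ∀ θ, t 0 ≤ θ → θ < z → N.grossInflow (F 0) v θ = B)
    (hlab : ∀ e, N.src e = v → ∀ θ, t 0 ≤ θ → θ < z →
      N.label (F 0) (N.dst e) θ + N.τ e = α e + β e * θ) :
    False := by
  have hmono := P.strictMono
  have hlt : ∀ n, t n < z := fun n => (hmono (Nat.lt_succ_self n)).trans_le (hz.1 ⟨n + 1, rfl⟩)
  have hidx : ∀ n, phaseIndex t (t n) = n := fun n =>
    P.phaseIndex_eq le_rfl (hmono (Nat.lt_succ_self n))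
  have hge : ∀ n, t 0 ≤ t n := fun n => hmono.monotone (Nat.zero_le n)
  have hsumB : ∀ n, ∑ e with N.src e = v, X n e = B := fun n => by
    rw [P.sum_eq hrank n le_rfl (hmono (Nat.lt_succ_self n)), hgross _ (hge n) (hlt n)]
  have hXnn : ∀ n e, N.src e = v → 0 ≤ X n e := fun n => (P.phase n).2.1.nonneg
  have hB : 0 ≤ B := by
    rw [← hsumB 0]
    exact Finset.sum_nonneg fun e he => hXnn 0 e (Finset.mem_filter.mp he).2
  obtain ⟨w, htw, hwz, hstat⟩ : ∃ w, t 0 ≤ w ∧ w < z ∧ ∀ e, N.src e = v →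
      ((∀ θ θ', w ≤ θ → θ < z → w ≤ θ' → θ' < z →
          X (phaseIndex t θ) e = X (phaseIndex t θ') e) ∨
        ∀ θ, w ≤ θ → θ < z → N.queue (F (phaseIndex t θ + 1)) e θ = 0) ∧
      ∀ θ, w ≤ θ → θ < z → 0 < X (phaseIndex t θ) e → ∀ θ', w ≤ θ' → θ' < z →
        N.IsActive (F (phaseIndex t θ' + 1)) e θ' := by
    rcases hB.eq_or_lt with h0 | hpos
    -- Without gross inflow the only distribution is zero.
    · have hX0 : ∀ n e, N.src e = v → X n e = 0 := by
        intro n e he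
        refine (Finset.sum_eq_zero_iff_of_nonneg fun e he => ?_).mp ((hsumB n).trans h0.symm) e
          (by simp [he])
        exact hXnn n e (Finset.mem_filter.mp he).2
      refine ⟨t 0, le_rfl, hlt 0, fun e he => ⟨Or.inl fun θ θ' _ _ _ _ => ?_, fun θ _ _ h => ?_⟩⟩
      · rw [hX0 _ e he, hX0 _ e he]
      · rw [hX0 _ e he] at h; exact absurd h (lt_irrefl _)
    · obtain ⟨w, h1, h2, h3⟩ :=
        (P.nodeDistribution hrank hz hpos hgross hlab).eventually_stationary (hlt 0)
      refine ⟨w, h1, h2, fun e he => ⟨?_, fun θ e1 e2 hx θ' e3 e4 => ?_⟩⟩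
      · rcases (h3 ⟨e, he⟩).1 with h | h
        · exact Or.inl h
        · refine Or.inr fun θ e1 e2 => ?_
          exact (div_eq_zero_iff.mp (h θ e1 e2)).resolve_right (N.ν_pos' e).ne'
      · rw [P.isActive_iff hrank he, hlab e he θ' (h1.trans e3) e4]
        exact (h3 ⟨e, he⟩).2 θ e1 e2 hx θ' e3 e4
  obtain ⟨_, ⟨n, rfl⟩, hn, -⟩ := hz.exists_between hwz
  have hn1 : t n < t (n + 1) := hmono (Nat.lt_succ_self n)
  have hn2 : t (n + 1) < t (n + 2) := hmono (Nat.lt_succ_self _)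
  obtain ⟨H, hHv, hpart⟩ := P.isPartialIDE n
  have hn0 := P.nonneg n
  -- Keeping up the distribution of phase `n` during phase `n + 1` yields the same queues: an edge
  -- whose inflow rate differs has no queue in both phases.
  set g := N.extend (F n) v (t n) (t (n + 2)) (X n) with hg
  have hqueue : ∀ e θ, t n ≤ θ → θ ≤ t (n + 2) → N.queue g e θ = N.queue (F (n + 2)) e θ := by
    intro e θ h1 h2
    have h0 := hn0.trans h1
    by_cases he : N.src e = v
    swap
    · rw [hg, N.queue_extend_of_ne he, P.queue_eq_of_ne n he, P.queue_eq_of_ne (n + 2) he]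
    rw [hg, N.queue_extend (P.step n) hn0 (P.queue_nonneg n he) he h1 h2]
    rcases le_total θ (t (n + 1)) with h3 | h3
    · rw [P.queue_eq_of_le h0 h2 h3, P.queue_eq_max n he h1 h3]
    have hmid := P.queue_eq_max n he hn1.le le_rfl
    rcases (hstat e he).1 with hX | hp
    · have hXn : X (n + 1) e = X n e := by
        have := hX (t (n + 1)) (t n) (hn.trans hn1).le (hlt _) hn.le (hlt _)
        rwa [hidx, hidx] at this
      rw [P.queue_eq_max (n + 1) he h3 h2, hmid, hXn,
        ← max_zero_add_mul (P.queue_nonneg n he) (sub_nonneg.mpr hn1.le) (sub_nonneg.mpr h3)]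
      congr 3
      ring
    · have hzero : ∀ m θ, 0 ≤ θ → w ≤ θ → θ ≤ t m → N.queue (F m) e θ = 0 := by
        intro m θ e0 e1 e2
        have hθ : θ < t (phaseIndex t θ + 1) := by
          have : phaseIndex t θ ∈ {n | θ < t (n + 1)} :=
            Nat.sInf_mem ⟨m, e2.trans_lt (hmono (Nat.lt_succ_self _))⟩
          exact this
        rw [P.queue_eq_of_le e0 e2 hθ.le]
        exact hp θ e1 (e2.trans_lt (hlt m))
      rw [hzero (n + 2) θ h0 (hn.le.trans h1) h2]
      rw [hzero (n + 1) _ (P.nonneg _) (hn.trans hn1).le le_rfl,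
        hzero n _ hn0 hn.le le_rfl, zero_add, eq_comm, max_eq_left_iff] at hmid
      rw [hzero n _ hn0 hn.le le_rfl, zero_add, max_eq_left_iff]
      have : X n e - N.ν e ≤ 0 := by
        by_contra! hcon
        exact absurd hmid (not_le.mpr (mul_pos hcon (sub_pos.mpr hn1)))
      exact mul_nonpos_of_nonpos_of_nonneg this (sub_nonneg.mpr h1)
  refine (P.phase n).2.2 (t (n + 2)) g hn2 (P.phase (n + 1)).1 ?_
  refine hpart.isConstantExtension_extend hHv hn0 (hn1.trans hn2) (hXnn n) ?_ ?_
  · intro θ h1 h2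
    rw [hsumB n, P.grossInflow_eq hrank n, hgross θ ((hge n).trans h1) (h2.trans (hlt _))]
  · intro e he hx θ h1 h2
    rw [← hg, N.isActive_congr hrank fun e' _ => hqueue e' θ h1 h2.le]
    have h3 := (hstat e he).2 (t n) hn.le (hlt n) (by rwa [hidx]) θ (hn.le.trans h1)
      (h2.trans (hlt _))
    have hθ : θ < t (phaseIndex t θ + 1) := by
      have : phaseIndex t θ ∈ {n | θ < t (n + 1)} := Nat.sInf_mem ⟨n + 1, h2⟩
      exact this
    rwa [N.isActive_congr hrank fun e' _ =>
      P.queue_eq_of_le (hn0.trans h1) hθ.le h2.le] at h3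

/-- There are no infinitely many local phases at one node within a bounded time: shortly before the
limit of their starting times, the gross inflow rate of the node is constant and the labels of its
neighbours are affine. -/
theorem false (hrank : N.IsTopologicalOrder rank) (P : N.InfinitePhases F t X v c) : False := by
  have hmono := P.strictMono
  have hbdd : BddAbove (Set.range t) := by
    refine ⟨c, ?_⟩
    rintro _ ⟨n, rfl⟩
    exact (P.phase n).2.1.lt.le.trans (P.phase n).1
  have hz := isLUB_csSup (Set.range_nonempty t) hbdd
  set z := sSup (Set.range t)
  have hz0 : 0 < z := (P.nonneg 0).trans_lt ((hmono (Nat.lt_succ_self 0)).trans_le (hz.1 ⟨1, rfl⟩))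
  obtain ⟨B, -, hB, -⟩ := (N.isStepOver_grossInflow (P.step 0) P.ne_sink).eventually_left hz0
  choose α hα β hβ hlab using fun e =>
    (N.isPiecewiseAffine_label (P.step 0) (N.dst e) z hz0.le).2 hz0
  have hall : ∀ᶠ y in 𝓝[<] z, N.grossInflow (F 0) v y = B ∧
      ∀ e, N.label (F 0) (N.dst e) y = α e + β e * y :=
    hB.and (Filter.eventually_all.mpr fun e =>
      (hlab e).filter_mono (nhdsWithin_mono z Set.Iio_subset_Iic_self))
  obtain ⟨w, hwz, hw⟩ := mem_nhdsLT_iff_exists_Ioo_subset.mp hall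
  obtain ⟨_, ⟨m, rfl⟩, hm, -⟩ := hz.exists_between hwz
  refine (P.shift m).false_of_affine hrank (z := z) (B := B) (α := fun e => α e + N.τ e) (β := β)
    ?_ ?_ ?_
  · refine ⟨?_, fun b hb => hz.2 ?_⟩
    · rintro _ ⟨n, rfl⟩
      exact hz.1 ⟨n + m, rfl⟩
    · rintro _ ⟨n, rfl⟩
      exact (hmono.monotone (Nat.le_add_right n m)).trans (hb ⟨n, rfl⟩)
  · intro θ h1 h2
    simp only [Nat.zero_add] at h1 ⊢
    rw [P.grossInflow_eq hrank]
    exact (hw ⟨hm.trans_le h1, h2⟩).1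
  · intro e he θ h1 h2
    simp only [Nat.zero_add] at h1 ⊢
    rw [P.label_dst_eq hrank m he, (hw ⟨hm.trans_le h1, h2⟩).2 e]
    ring

end InfinitePhases

end AcyclicNetwork

/-! ### Runs of the algorithm and their output -/

namespace AcyclicNetwork

variable {V E : Type*} [Fintype V] [DecidableEq V] [Fintype E] {N : AcyclicNetwork V E}
  {T : ℚ} {rank : V ≃ Fin (Fintype.card V)}

omit [Fintype V] [DecidableEq V] in
theorem τmin_le (e : E) : N.τmin ≤ N.τ e :=
  ciInf_le (Set.finite_range fun e => (N.τ e : ℝ)).bddBelow e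

omit [Fintype V] [DecidableEq V] [Fintype E] in
theorem τmin_nonneg : 0 ≤ N.τmin := Real.iInf_nonneg fun e => (N.τ_pos' e).le

omit [Fintype V] [DecidableEq V] in
theorem exists_τ_eq_τmin [Nonempty E] : ∃ e, (N.τ e : ℝ) = N.τmin :=
  exists_eq_ciInf_of_finite

omit [Fintype V] [DecidableEq V] in
theorem τmin_pos [Nonempty E] : 0 < N.τmin := by
  obtain ⟨e, he⟩ := N.exists_τ_eq_τmin
  exact he ▸ N.τ_pos' e

omit [Fintype V] [DecidableEq V] in
theorem τmin_mem (K : Subfield ℝ) : N.τmin ∈ K := by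
  rcases isEmpty_or_nonempty E with h | h
  · rw [Network.τmin, Real.iInf_of_isEmpty]; exact K.zero_mem
  · obtain ⟨e, he⟩ := N.exists_τ_eq_τmin
    exact he ▸ SubfieldClass.ratCast_mem K _

omit [DecidableEq V] [Fintype E] in
theorem rank_pos (hrank : N.IsTopologicalOrder rank) {v : V} (hv : v ≠ N.t) :
    1 ≤ (rank v : ℕ) := by
  by_contra! h
  have h0 : (rank v : ℕ) = 0 := by omega
  exact hv (rank.injective (Fin.ext (h0.trans hrank.1.symm)))

/-- The time up to which the algorithm has extended the flow at the node `v`. -/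
def horizon (N : AcyclicNetwork V E) (rank : V ≃ Fin (Fintype.card V)) (s : AlgState E) (v : V) :
    ℝ :=
  if (rank v : ℕ) < s.pos then (s.round + 1) * N.τmin
  else if (rank v : ℕ) = s.pos then s.time else s.round * N.τmin

/-- The invariant of the algorithm: the flow is an equilibrium up to the time to which it has been
extended at each node, and the counters are in their ranges. -/
structure IsValidState (N : AcyclicNetwork V E) (T : ℚ) (rank : V ≃ Fin (Fintype.card V))
    (s : AlgState E) : Prop where
  isPartialIDE : N.IsPartialIDE s.flow (N.horizon rank s)
  one_le_pos : 1 ≤ s.pos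
  pos_le : s.pos ≤ Fintype.card V
  le_time : s.round * N.τmin ≤ s.time
  time_le : s.time ≤ (s.round + 1) * N.τmin
  round_le : s.round ≤ N.lastRound T + 1
  pos_of_final : s.round = N.lastRound T + 1 → s.pos = 1 ∧ s.time = s.round * N.τmin

theorem isValidState_initial (hrank : N.IsTopologicalOrder rank) :
    N.IsValidState T rank (AlgState.initial E) where
  isPartialIDE := by
    refine IsPartialIDE.zero.congr fun v hv => ?_
    have := rank_pos hrank hv
    simp [horizon, AlgState.initial, show ¬ (rank v : ℕ) = 0 by omega]
  one_le_pos := le_rfl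
  pos_le := Fintype.card_pos_iff.mpr ⟨N.t⟩
  le_time := by simp [AlgState.initial]
  time_le := by simpa [AlgState.initial] using N.τmin_nonneg
  round_le := Nat.zero_le _
  pos_of_final h := absurd h (by simp [AlgState.initial])

namespace IsValidState

variable {s s' : AlgState E}

theorem horizon_le (hs : N.IsValidState T rank s) (v : V) :
    N.horizon rank s v ≤ (s.round + 1) * N.τmin := by
  have := hs.time_le
  have := N.τmin_nonneg
  unfold horizon
  split_ifs <;> linarith

theorem time_nonneg (hs : N.IsValidState T rank s) : 0 ≤ s.time :=
  (mul_nonneg (Nat.cast_nonneg _) N.τmin_nonneg).trans hs.le_time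

theorem ne_sink (hrank : N.IsTopologicalOrder rank) (hs : N.IsValidState T rank s) {v : V}
    (hv : (rank v : ℕ) = s.pos) : v ≠ N.t := by
  rintro rfl
  have h1 := hs.one_le_pos
  rw [← hv, hrank.1] at h1
  omega

omit [DecidableEq V] [Fintype E] in
theorem horizon_self {v : V} (hv : (rank v : ℕ) = s.pos) :
    N.horizon rank s v = s.time := by
  simp [horizon, hv]

theorem step (hrank : N.IsTopologicalOrder rank) (hs : N.IsValidState T rank s)
    (h : N.Step T rank s s') : N.IsValidState T rank s' := by
  cases h with
  | phase v x b f' hround hv hphase =>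
    obtain ⟨hbc, hext, -⟩ := hphase
    have hpart := hs.isPartialIDE.extend hrank (horizon_self hv) hs.time_nonneg (fun w hw => ?_)
      (fun e _ => ?_) hext
    · refine ⟨hpart.congr fun w _ => ?_, hs.one_le_pos, hs.pos_le, hs.le_time.trans hext.lt.le, hbc,
        hs.round_le, fun hf => ?_⟩
      · by_cases hwv : w = v
        · subst hwv
          simp [horizon, hv]
        · have : ¬ (rank w : ℕ) = s.pos := fun h =>
            hwv (rank.injective (Fin.ext (h.trans hv.symm)))
          rw [Function.update_of_ne hwv]
          simp [horizon, this]
      · simp only at hf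
        omega
    · have h1 : (rank v : ℕ) < rank w := hw
      rw [horizon, if_neg (by omega), if_neg (by omega)]
      exact hs.le_time
    · have h1 := hs.horizon_le (N.dst e)
      have h2 := N.τmin_le e
      have h3 := hs.le_time
      linarith
  | nextNode hround hpos htime =>
    have hτ := N.τmin_nonneg
    refine ⟨hs.isPartialIDE.congr fun w _ => ?_, by simp, hpos, le_rfl, ?_, hs.round_le,
      fun hf => ?_⟩
    · simp only [horizon]
      rcases lt_trichotomy (rank w : ℕ) s.pos with h | h | h
      · rw [if_pos (by omega), if_pos h]
      · rw [if_pos (by omega), if_neg (by omega), if_pos h, htime]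
      · rw [if_neg (by omega), if_neg (by omega : ¬ (rank w : ℕ) < s.pos),
          if_neg (by omega : ¬ (rank w : ℕ) = s.pos)]
        split_ifs <;> rfl
    · simp only
      linarith
    · simp only at hf
      omega
  | nextRound hround hpos =>
    have hτ := N.τmin_nonneg
    refine ⟨hs.isPartialIDE.congr fun w hw => ?_, le_rfl, Fintype.card_pos_iff.mpr ⟨N.t⟩, ?_, ?_,
      by simpa using hround, fun _ => ⟨rfl, by push_cast; rfl⟩⟩
    · have h1 := rank_pos hrank hw
      have h2 : (rank w : ℕ) < s.pos := (rank w).2.trans_eq hpos.symm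
      simp only [horizon, if_neg (by omega : ¬ (rank w : ℕ) < 1), if_pos h2]
      split_ifs <;> push_cast <;> rfl
    · push_cast; exact le_rfl
    · push_cast; linarith

theorem of_reachable (hrank : N.IsTopologicalOrder rank) (hs : N.IsValidState T rank s)
    (h : Relation.ReflTransGen (N.Step T rank) s s') : N.IsValidState T rank s' := by
  induction h with
  | refl => exact hs
  | tail _ h ih => exact ih.step hrank h

/-- As long as the algorithm has not ended there is a next step, and it can be chosen over the
subfield `K` if the state is a state over `K`. -/
theorem exists_step (hrank : N.IsTopologicalOrder rank) (hs : N.IsValidState T rank s)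
    (hfinal : ¬ N.IsFinal T s) {K : Subfield ℝ} (htime : s.time ∈ K)
    (hK : ∀ e, IsStepOver K (s.flow.inflow e) ∧ IsStepOver K (s.flow.outflow e)) :
    ∃ s', N.Step T rank s s' ∧ s'.time ∈ K ∧
      ∀ e, IsStepOver K (s'.flow.inflow e) ∧ IsStepOver K (s'.flow.outflow e) := by
  have hround : s.round ≤ N.lastRound T := by
    have h1 := hs.round_le
    have h2 : s.round ≠ N.lastRound T + 1 := hfinal
    omega
  have hcK : ((s.round : ℝ) + 1) * N.τmin ∈ K :=
    K.mul_mem (K.add_mem (natCast_mem K _) K.one_mem) (N.τmin_mem K)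
  rcases hs.pos_le.eq_or_lt with hpos | hpos
  · exact ⟨_, .nextRound s hround hpos, hcK, hK⟩
  rcases hs.time_le.eq_or_lt with ht | ht
  · exact ⟨_, .nextNode s hround hpos ht, K.mul_mem (natCast_mem K _) (N.τmin_mem K), hK⟩
  set v := rank.symm ⟨s.pos, hpos⟩ with hv
  have hrv : (rank v : ℕ) = s.pos := by simp [hv]
  obtain ⟨x, b, hxK, hbK, hphase⟩ := hs.isPartialIDE.exists_isLocalPhase hrank hK
    (hs.ne_sink hrank hrv) (horizon_self hrv) hs.time_nonneg htime ht hcK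
  exact ⟨_, .phase s v x b _ hround hrv hphase, hbK,
    N.isStepOver_extend hK hs.time_nonneg htime hbK hxK⟩

/-- Every run of the algorithm is finite. -/
theorem no_infinite_run (hrank : N.IsTopologicalOrder rank) {run : ℕ → AlgState E}
    (h0 : N.IsValidState T rank (run 0)) (hrun : ∀ n, N.Step T rank (run n) (run (n + 1))) :
    False := by
  have hvalid : ∀ n, N.IsValidState T rank (run n) := by
    intro n
    induction n with
    | zero => exact h0
    | succ n ih => exact ih.step hrank (hrun n)
  -- A bounded count of the node and round changes. A round change increases it because the position
  -- drops by less than the number of nodes.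
  set μ : ℕ → ℕ := fun n => (run n).round * (Fintype.card V + 1) + (run n).pos with hμ
  have hbound : ∀ n, μ n ≤ (N.lastRound T + 1) * (Fintype.card V + 1) + Fintype.card V := fun n =>
    add_le_add (Nat.mul_le_mul_right _ (hvalid n).round_le) (hvalid n).pos_le
  have hstep : ∀ n, μ n < μ (n + 1) ∨ ((run (n + 1)).round = (run n).round ∧
      (run (n + 1)).pos = (run n).pos ∧ ∃ v x, (rank v : ℕ) = (run n).pos ∧
        N.IsLocalPhase (run n).flow (run (n + 1)).flow v (run n).time (run (n + 1)).time
          (((run n).round + 1) * N.τmin) x) := by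
    intro n
    have h := hrun n
    generalize hs' : run (n + 1) = s' at h
    simp only [hμ, hs']
    cases h with
    | phase v x b f' hround hv hphase => exact Or.inr ⟨rfl, rfl, v, x, hv, hphase⟩
    | nextNode hround hpos htime => left; simp only; omega
    | nextRound hround hpos =>
      left
      simp only [hpos]
      ring_nf
      omega
  have hμmono : Monotone μ := monotone_nat_of_le_succ fun n => by
    rcases hstep n with h | ⟨h1, h2, -⟩
    · exact h.le
    · simp only [hμ, h1, h2]; exact le_rfl
  obtain ⟨m, hm⟩ : ∃ m, ∀ n, μ n ≤ μ m := by
    obtain ⟨m, hm⟩ := Nat.sSup_mem (s := Set.range μ) (Set.range_nonempty μ)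
      ⟨_, by rintro _ ⟨n, rfl⟩; exact hbound n⟩
    exact ⟨m, fun n => hm ▸ le_csSup ⟨_, by rintro _ ⟨n, rfl⟩; exact hbound n⟩ ⟨n, rfl⟩⟩
  have hlate : ∀ n, (run (m + n + 1)).round = (run (m + n)).round ∧
      (run (m + n + 1)).pos = (run (m + n)).pos ∧ ∃ v x, (rank v : ℕ) = (run (m + n)).pos ∧
        N.IsLocalPhase (run (m + n)).flow (run (m + n + 1)).flow v (run (m + n)).time
          (run (m + n + 1)).time (((run (m + n)).round + 1) * N.τmin) x := fun n =>
    (hstep (m + n)).resolve_left fun h =>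
      absurd (hm (m + n + 1)) (not_le.mpr ((hμmono (Nat.le_add_right m n)).trans_lt h))
  have hconst : ∀ n, (run (m + n)).round = (run m).round ∧ (run (m + n)).pos = (run m).pos := by
    intro n
    induction n with
    | zero => exact ⟨rfl, rfl⟩
    | succ n ih => exact ⟨(hlate n).1.trans ih.1, (hlate n).2.1.trans ih.2⟩
  choose w x hw hx using fun n => (hlate n).2.2
  have hwv : ∀ n, w n = w 0 := fun n => rank.injective (Fin.ext (by
    rw [hw n, hw 0, (hconst n).2, (hconst 0).2]))
  refine InfinitePhases.false (F := fun n => (run (m + n)).flow) (t := fun n => (run (m + n)).time)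
    (X := x) (v := w 0) (c := ((run m).round + 1) * N.τmin) hrank
    ⟨(hvalid _).ne_sink hrank (hw 0), (hvalid _).time_nonneg, fun n => ?_, fun n => ?_⟩
  · exact ⟨_, horizon_self ((hwv n) ▸ hw n), (hvalid (m + n)).isPartialIDE⟩
  · have := hx n
    rwa [hwv n, (hconst n).1] at this

/-- The algorithm can be completed from every valid state. -/
theorem exists_final (hrank : N.IsTopologicalOrder rank) (hs : N.IsValidState T rank s) :
    ∃ s', Relation.ReflTransGen (N.Step T rank) s s' ∧ N.IsFinal T s' := by
  by_contra! hcon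
  have hnext : ∀ p : {s' // Relation.ReflTransGen (N.Step T rank) s s'},
      ∃ q : {s' // Relation.ReflTransGen (N.Step T rank) s s'}, N.Step T rank p.1 q.1 := by
    rintro ⟨s', hs'⟩
    have hv := hs.of_reachable hrank hs'
    obtain ⟨s'', h, -⟩ := hv.exists_step hrank (hcon s' hs') (K := ⊤) (Subfield.mem_top _)
      hv.isPartialIDE.step
    exact ⟨⟨s'', hs'.tail h⟩, h⟩
  choose g hg using hnext
  let run : ℕ → {s' // Relation.ReflTransGen (N.Step T rank) s s'} := fun n => g^[n] ⟨s, .refl⟩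
  refine no_infinite_run (run := fun n => (run n).1) hrank hs fun n => ?_
  simp only [run, Function.iterate_succ_apply']
  exact hg _

/-- The flow constructed in previous rounds is not changed any more. -/
theorem flow_eq_of_reachable (hrank : N.IsTopologicalOrder rank) (hs : N.IsValidState T rank s)
    (h : Relation.ReflTransGen (N.Step T rank) s s') : s.round ≤ s'.round ∧
      ∀ e, (∀ θ : ℝ, θ < s.round * N.τmin → s'.flow.inflow e θ = s.flow.inflow e θ) ∧
        ∀ θ : ℝ, θ < s.round * N.τmin + N.τ e → s'.flow.outflow e θ = s.flow.outflow e θ := by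
  induction h with
  | refl => exact ⟨le_rfl, fun e => ⟨fun _ _ => rfl, fun _ _ => rfl⟩⟩
  | @tail s₁ s₂ h₁ h₂ ih =>
    have hv := hs.of_reachable hrank h₁
    cases h₂ with
    | phase v x b f' hround hrv hphase =>
      refine ⟨ih.1, fun e => ?_⟩
      have hext := hphase.2.1
      have hle : s.round * N.τmin ≤ s₁.time :=
        (mul_le_mul_of_nonneg_right (Nat.cast_le.mpr ih.1) N.τmin_nonneg).trans hv.le_time
      by_cases he : N.src e = v
      · refine ⟨fun θ hθ => ?_, fun θ hθ => ?_⟩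
        · rw [hext.inflow_eq e he, if_neg fun hc => absurd hc.1 (by linarith)]
          exact (ih.2 e).1 θ hθ
        · rw [hext.outflow_eq e he θ fun hc => absurd hc.1 (by linarith)]
          exact (ih.2 e).2 θ hθ
      · simp only [(hext.other_edges e he).1, (hext.other_edges e he).2]
        exact ih.2 e
    | nextNode hround hpos htime => exact ih
    | nextRound hround hpos => exact ⟨ih.1.trans (Nat.le_succ _), ih.2⟩

/-- At the end the flow has been extended up to the same time at all nodes. -/
theorem isPartialIDE_of_final (hrank : N.IsTopologicalOrder rank) (hs : N.IsValidState T rank s)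
    (hfinal : N.IsFinal T s) : N.IsPartialIDE s.flow fun _ => s.round * N.τmin := by
  refine hs.isPartialIDE.congr fun v hv => ?_
  obtain ⟨h1, h2⟩ := hs.pos_of_final hfinal
  have := rank_pos hrank hv
  rw [horizon, if_neg (by omega), h2, ite_self]

end IsValidState

/-- A partial equilibrium that extends beyond the time from which the network is empty is an
instantaneous dynamic equilibrium. -/
theorem exists_isIDE_of_isPartialIDE (N : AcyclicNetwork V E) :
    ∃ M : ℝ, ∀ (h : ℝ) (f : FlowOverTime E), M < h → N.IsPartialIDE f (fun _ => h) → N.IsIDE f := by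
  obtain ⟨M, hM, hempty⟩ := IsFeasibleUntil.exists_empty_from N
  have hu : ∀ v, ∃ m : ℝ, 0 ≤ m ∧ (v ≠ N.t → ∀ θ : ℝ, m ≤ θ → N.u v θ = 0) := by
    intro v
    by_cases hv : v = N.t
    · exact ⟨0, le_rfl, fun h => absurd hv h⟩
    · obtain ⟨m, hm⟩ := N.u_bounded_support v hv
      exact ⟨max m 0, le_max_right _ _, fun _ θ hθ => hm θ ((le_max_left _ _).trans hθ)⟩
  choose m hm0 hm using hu
  have hτle : ∀ e, (N.τ e : ℝ) ≤ ∑ e, (N.τ e : ℝ) := fun e =>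
    Finset.single_le_sum (fun e _ => (N.τ_pos' e).le) (Finset.mem_univ e)
  have hτ0 : 0 ≤ ∑ e, (N.τ e : ℝ) := Finset.sum_nonneg fun e _ => (N.τ_pos' e).le
  have hmle : ∀ v, m v ≤ ∑ v, m v := fun v =>
    Finset.single_le_sum (fun v _ => hm0 v) (Finset.mem_univ v)
  have hm0' : 0 ≤ ∑ v, m v := Finset.sum_nonneg fun v _ => hm0 v
  refine ⟨M + ∑ e, (N.τ e : ℝ) + ∑ v, m v, fun h f hh hf => ?_⟩
  have hlate := hempty h f (hf.isFeasibleUntil fun _ _ => le_rfl)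
  have hin : ∀ e θ, M ≤ θ → f.inflow e θ = 0 := by
    intro e θ hθ
    rcases lt_or_ge θ h with h1 | h1
    exacts [(hlate e θ hθ h1).1, hf.inflow_late e θ h1]
  have hout : ∀ e θ, M ≤ θ → f.outflow e (θ + N.τ e) = 0 := by
    intro e θ hθ
    rcases lt_or_ge θ h with h1 | h1
    · have h2 := hf.queue_op e θ (hM.trans hθ) h1
      rwa [Network.QueueOperatesAtCapacity, (hlate e θ hθ h1).2, (hlate e θ hθ h1).1,
        if_neg (lt_irrefl _), min_eq_left (N.ν_pos' e).le] at h2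
    · exact hf.outflow_late e _ (by linarith)
  have hqueue : ∀ e θ, M ≤ θ → N.queue f e θ = 0 := by
    intro e θ hθ
    rw [Network.queue_eq_add_mul (hf.integrable e) (k := 0) hM hθ fun z h1 _ => by
      rw [hin e z h1.le, hout e z h1.le, sub_zero], (hlate e M le_rfl (by linarith)).2]
    ring
  have hgross : ∀ v θ, h ≤ θ → ∑ e with N.dst e = v, f.outflow e θ = 0 := by
    refine fun v θ hθ => Finset.sum_eq_zero fun e _ => ?_
    have := hout e (θ - N.τ e) (by linarith [hτle e])
    rwa [sub_add_cancel] at this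
  refine ⟨⟨fun e θ _ => hf.inflow_nonneg e θ, fun e θ _ => hf.outflow_nonneg e θ,
    fun e => (hf.step e).1.integrableOn_Ici (hf.inflow_late e),
    fun e => (hf.step e).2.integrableOn_Ici (hf.outflow_late e), ?_, ?_,
    fun e θ _ => hf.outflow_early e θ, ?_⟩, ?_⟩
  · intro v hv θ h0
    rcases lt_or_ge θ h with h1 | h1
    · have := hf.conservation v hv θ h0 h1
      rw [Network.grossInflow] at this
      linarith
    · rw [hgross v θ h1, Finset.sum_eq_zero fun e _ => hin e θ (by linarith),
        hm v hv θ (by linarith [hmle v]), sub_zero]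
  · intro θ h0
    rw [Finset.sum_eq_zero fun e he =>
      absurd (Finset.mem_filter.mp he).2 (N.src_ne_sink e), zero_sub, neg_nonpos]
    exact Finset.sum_nonneg fun e _ => hf.outflow_nonneg e θ
  · intro e θ h0
    rcases lt_or_ge θ h with h1 | h1
    · exact hf.queue_op e θ h0 h1
    · have hθ : M ≤ θ := by linarith
      rw [Network.QueueOperatesAtCapacity, hqueue e θ hθ, hin e θ hθ, hout e θ hθ,
        if_neg (lt_irrefl _), min_eq_left (N.ν_pos' e).le]
  · intro θ h0 e hpos
    rcases lt_or_ge θ h with h1 | h1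
    · exact hf.active e θ h0 h1 hpos
    · rw [hf.inflow_late e θ h1] at hpos
      exact absurd hpos (lt_irrefl _)

/-- A nonnegative step function vanishes at the start of an interval of nonpositive integral, by
right-continuity. -/
theorem _root_.IsStepOver.eq_zero_of_integral_le_zero {K : Subfield ℝ} {g : ℝ → ℝ}
    (hg : IsStepOver K g) (h0 : ∀ θ, 0 ≤ g θ) {c d : ℝ} (hc : 0 ≤ c) (hcd : c < d)
    (hint : ∫ ζ in c..d, g ζ ≤ 0) : g c = 0 := by
  obtain ⟨w, hcw, hw⟩ := mem_nhdsGE_iff_exists_Icc_subset.mp (hg.eventually_right hc)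
  have hlt : c < min w d := lt_min hcw hcd
  have hi : ∀ {y z : ℝ}, 0 ≤ y → 0 ≤ z → IntervalIntegrable g volume y z := fun hy hz =>
    (hg.intervalIntegrable_zero hy).symm.trans (hg.intervalIntegrable_zero hz)
  have h1 := intervalIntegral.integral_add_adjacent_intervals (hi hc (hc.trans hlt.le))
    (hi (hc.trans hlt.le) (hc.trans hcd.le))
  have h2 : 0 ≤ ∫ ζ in (min w d)..d, g ζ :=
    intervalIntegral.integral_nonneg (min_le_right _ _) fun z _ => h0 z
  have h3 : ∫ ζ in c..(min w d), g ζ = ∫ ζ in c..(min w d), g c := by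
    refine intervalIntegral.integral_congr fun z hz => ?_
    rw [Set.uIcc_of_le hlt.le] at hz
    exact hw ⟨hz.1, hz.2.trans (min_le_left _ _)⟩
  rw [intervalIntegral.integral_const, smul_eq_mul] at h3
  refine le_antisymm ?_ (h0 c)
  by_contra! hpos
  have := mul_pos (sub_pos.mpr hlt) hpos
  linarith

/-- In an equilibrium with step functions as rates no edge carries flow after the termination. -/
theorem IsPartialIDE.eq_zero_of_terminatesBy {f : FlowOverTime E} {h : ℝ}
    (hf : N.IsPartialIDE f fun _ => h) (hide : N.IsIDE f) {T : ℝ} (hT0 : 0 ≤ T)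
    (hT : f.TerminatesBy T) (e : E) {θ : ℝ} (hθ : T ≤ θ) :
    f.inflow e θ = 0 ∧ f.outflow e θ = 0 := by
  have h0 := hT0.trans hθ
  have hτ := N.τ_pos' e
  have hint := hf.integrable e
  have hq : 0 ≤ N.queue f e θ :=
    (isFeasibleUntil_of_isFeasible hide.1 θ).queue_nonneg e h0 le_rfl
  have h1 := hT θ hθ e
  have h2 := hT (θ + N.τ e) (by linarith) e
  have h3 := intervalIntegral.integral_add_adjacent_intervals (hint.inflow le_rfl h0)
    (hint.inflow h0 (by linarith : 0 ≤ θ + (N.τ e : ℝ)))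
  have h4 := intervalIntegral.integral_add_adjacent_intervals (hint.outflow le_rfl h0)
    (hint.outflow h0 (by linarith : 0 ≤ θ + (N.τ e : ℝ)))
  rw [Network.queue] at hq
  exact ⟨(hf.step e).1.eq_zero_of_integral_le_zero (hf.inflow_nonneg e) h0
      (by linarith : θ < θ + N.τ e) (by linarith),
    (hf.step e).2.eq_zero_of_integral_le_zero (hf.outflow_nonneg e) h0
      (by linarith : θ < θ + N.τ e) (by linarith)⟩

omit [Fintype V] [DecidableEq V] in
theorem lt_lastRound_mul [Nonempty E] (T : ℚ) :
    (T : ℝ) < ((N.lastRound T + 1 : ℕ) : ℝ) * N.τmin := by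
  rw [← div_lt_iff₀ τmin_pos]
  push_cast
  exact Nat.lt_floor_add_one _

/-- A step for the bound `T` is a step for every larger bound. -/
theorem Step.mono {T T' : ℚ} (hT : T ≤ T') {s s' : AlgState E} (h : N.Step T rank s s') :
    N.Step T' rank s s' := by
  have hround : N.lastRound T ≤ N.lastRound T' :=
    Nat.floor_le_floor (div_le_div_of_nonneg_right (Rat.cast_le.mpr hT) N.τmin_nonneg)
  cases h with
  | phase v x b f' h1 h2 h3 => exact .phase s v x b f' (h1.trans hround) h2 h3
  | nextNode h1 h2 h3 => exact .nextNode s (h1.trans hround) h2 h3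
  | nextRound h1 h2 => exact .nextRound s (h1.trans hround) h2

/-- The output of the algorithm is an equilibrium: continuing the algorithm up to a larger horizon,
beyond the time from which the network is empty, gives an equilibrium. It terminates by time `T`
and hence vanishes afterwards, so it is the output itself. -/
theorem isIDE_of_final (hrank : N.IsTopologicalOrder rank) (hT : N.IsTerminationBound T)
    {s : AlgState E} (hs : Relation.ReflTransGen (N.Step T rank) (AlgState.initial E) s)
    (hfinal : N.IsFinal T s) : N.IsIDE s.flow := by
  obtain ⟨M, hM⟩ := exists_isIDE_of_isPartialIDE N
  rcases isEmpty_or_nonempty E with hE | hE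
  -- Without edges `τmin` is zero and the rounds cover no time, but there is nothing to do.
  · have hV : ∀ v, v = N.t := by
      intro v
      by_contra hv
      obtain ⟨e, -⟩ := N.exists_outgoing hv
      exact hE.false e
    refine hM (M + 1) s.flow (by linarith) ?_
    exact ⟨fun e => hE.elim e, fun e => hE.elim e, fun e => hE.elim e, fun e => hE.elim e,
      fun e => hE.elim e, fun e => hE.elim e, fun e => hE.elim e, fun v hv => absurd (hV v) hv,
      fun e => hE.elim e⟩
  have hvalid := (isValidState_initial (T := T) hrank).of_reachable hrank hs
  have hpart := hvalid.isPartialIDE_of_final hrank hfinal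
  obtain ⟨T', hT'⟩ := exists_rat_gt (max M T)
  have hTT' : T ≤ T' := by
    exact_mod_cast ((le_max_right M (T : ℝ)).trans hT'.le)
  have hvalid' := (isValidState_initial (T := T') hrank).of_reachable hrank
    (Relation.ReflTransGen.mono (fun _ _ h => Step.mono hTT' h) _ _ hs)
  obtain ⟨s', hss', hfinal'⟩ := hvalid'.exists_final hrank
  have hpart' := (hvalid'.of_reachable hrank hss').isPartialIDE_of_final hrank hfinal'
  have hlong : M < s'.round * N.τmin := by
    have h1 : s'.round = N.lastRound T' + 1 := hfinal'
    rw [h1]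
    exact ((le_max_left M (T : ℝ)).trans_lt hT').trans (lt_lastRound_mul T')
  have hide := hM _ _ hlong hpart'
  have hzero := fun e (θ : ℝ) (hθ : (T : ℝ) ≤ θ) => hpart'.eq_zero_of_terminatesBy hide
    (by exact_mod_cast hT.1) (hT.2 _ hide) e hθ
  have hTs : (T : ℝ) < s.round * N.τmin := by
    have h1 : s.round = N.lastRound T + 1 := hfinal
    rw [h1]
    exact lt_lastRound_mul T
  have hagree := (hvalid'.flow_eq_of_reachable hrank hss').2
  have heq : s.flow = s'.flow := by
    have hin : s.flow.inflow = s'.flow.inflow := by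
      funext e θ
      rcases lt_or_ge θ (s.round * N.τmin) with h1 | h1
      · exact ((hagree e).1 θ h1).symm
      · rw [hpart.inflow_late e θ h1, (hzero e θ (hTs.le.trans h1)).1]
    have hout : s.flow.outflow = s'.flow.outflow := by
      funext e θ
      rcases lt_or_ge θ (s.round * N.τmin + N.τ e) with h1 | h1
      · exact ((hagree e).2 θ h1).symm
      · rw [hpart.outflow_late e θ h1, (hzero e θ (by linarith [N.τ_pos' e])).2]
    cases hf : s.flow
    cases hf' : s'.flow
    simp_all
  rw [heq]
  exact hide

end AcyclicNetwork

theorem AlgState.isRational_iff {E : Type*} (s : AlgState E) :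
    s.IsRational ↔ s.time ∈ ratSubfield ∧ ∀ e, IsStepOver ratSubfield (s.flow.inflow e) ∧
      IsStepOver ratSubfield (s.flow.outflow e) := by
  simp only [AlgState.IsRational, mem_ratSubfield, isRationalStepFunction_iff]

end

theorem theorem3p2 {V E : Type*} [Fintype V] [DecidableEq V] [Fintype E]
    (N : AcyclicNetwork V E) :
    (∃ T : ℚ, N.IsTerminationBound T) ∧
    (∃ rank : V ≃ Fin (Fintype.card V), N.IsTopologicalOrder rank) ∧
    ∀ T : ℚ, N.IsTerminationBound T →
    ∀ rank : V ≃ Fin (Fintype.card V), N.IsTopologicalOrder rank →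
      -- every run is finite
      (¬ ∃ run : ℕ → AlgState E, run 0 = AlgState.initial E ∧
        ∀ n, N.Step T rank (run n) (run (n + 1))) ∧
      ∀ s : AlgState E, Relation.ReflTransGen (N.Step T rank) (AlgState.initial E) s →
        -- no run gets stuck before it is complete, not even in exact rational arithmetic
        (¬ N.IsFinal T s → ∃ s', N.Step T rank s s') ∧
        (¬ N.IsFinal T s → s.IsRational → ∃ s', N.Step T rank s s' ∧ s'.IsRational) ∧
        -- the output is an IDE
        (N.IsFinal T s → N.IsIDE s.flow) := by
  refine ⟨N.exists_isTerminationBound, N.exists_isTopologicalOrder, fun T hT rank hrank => ?_⟩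
  have h0 := AcyclicNetwork.isValidState_initial (N := N) (T := T) hrank
  refine ⟨fun ⟨run, hrun0, hrun⟩ =>
    AcyclicNetwork.IsValidState.no_infinite_run hrank (hrun0 ▸ h0) hrun, fun s hs => ?_⟩
  have hvalid := h0.of_reachable hrank hs
  refine ⟨fun hfinal => ?_, fun hfinal hrat => ?_, AcyclicNetwork.isIDE_of_final hrank hT hs⟩
  · obtain ⟨s', h, -⟩ := hvalid.exists_step hrank hfinal (K := ⊤) (Subfield.mem_top _)
      hvalid.isPartialIDE.step
    exact ⟨s', h⟩
  · obtain ⟨htime, hK⟩ := s.isRational_iff.mp hrat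
    obtain ⟨s', h, h'⟩ := hvalid.exists_step hrank hfinal htime hK
    exact ⟨s', h, s'.isRational_iff.mpr h'⟩
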